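/- Let $\mathbb K$ be $\mathbb R$ or $\mathbb C$ and let $M=(M,\mathcal O_M)$ be a manifold of dimension $m$ over $\mathbb K$, i.e. a space with a sheaf of commutative $\mathbb K$-algebras that is locally isomorphic to $\mathbb K^m$ with its sheaf of $C^k$ functions ($0\le k\le\infty$ or $k=\omega$), or, in the algebraic case, to a nonsingular affine variety of dimension $m$. Put $T_+=T_M=\mathrm{Der}_{\mathbb K}(\mathcal O_M)$. A supermanifold $S$ of dimension $(m|n)$ with reduced space $M$ is a sheaf $\mathcal O_S$ of $\mathbb Z/2$-graded supercommutative $\mathbb K$-algebras on $M$ with a homomorphism $\mathcal O_S\to\mathcal O_M$ such that $\mathcal O_S\to\mathcal O_M$ is locally isomorphic (as graded algebras, compatibly with the maps to $\mathcal O_M$) to $\bigwedge^\bullet(\mathcal O_M^{\oplus n})\to\mathcal O_M$; thus $\mathcal O_M=\mathcal O_S/J$, where $J\subset\mathcal O_S$ is the ideal generated by the odd functions. Its odd tangent bundle is $T_-S=(J/J^2)^\vee$. It is projected if $\mathcal O_S\to\mathcal O_M$ has a section that is an even homomorphism of sheaves of $\mathbb K$-algebras, and split if it is isomorphic to $S(M,V)=(M,\bigwedge^\bullet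 V^\vee)$ for some vector bundle $V$ of rank $n$ on $M$. For a rank $2$ vector bundle $V$ on $M$, a supermanifold $S$ of dimension $(m|2)$ with reduced space $M$ and an isomorphism $\rho:V\cong T_-S$, the class $\omega_2(S,\rho)\in H^1(M,\mathcal Hom(\bigwedge^2V,T_M))$ is defined as follows. Choose local isomorphisms $\sigma_x:S(M,V)|_{U_x}\cong S|_{U_x}$ inducing the identity of $M$ and $\rho$. The transition automorphisms $\sigma_x^{-1}\sigma_y$ act on functions $f$ on $U_x\cap U_y$ by $f\mapsto f+z_{xy}(f)$ modulo $J^3$, with $z_{xy}$ a derivation with values in $\bigwedge^2V^\vee$, that is, a section of $\mathcal Hom(\bigwedge^2V,T_M)$, and $\omega_2(S,\rho)$ is the class of the cocycle $(z_{xy})$. Then: 1. Every supermanifold $S$ of dimension $(m|2)$ with reduced space $M$ admits a rank $2$ vector bundle $V$ on $M$ and an isomorphism $\rho:V\cong T_-S$; and for every $V$ and every pair $(S,\rho)$ as above the class $\omega_2(S,\rho)$ exists and is independent of the choices. 2. $S$ is determined by the triple $(M,V,\omega_2)$: for pairs $(S,\rho)$ and $(S',\rho')$ with the same $M$ and $V$,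 there is an isomorphism $S\cong S'$ inducing the identity on $M$ and on $V$ if and only if $\omega_2(S,\rho)=\omega_2(S',\rho')$. 3. Every triple arises: for every rank $2$ vector bundle $V$ on $M$ and every $\omega\in H^1(M,\mathcal Hom(\bigwedge^2V,T_M))$ there is a pair $(S,\rho)$ with $\omega_2(S,\rho)=\omega$. 4. A supermanifold $S$ of dimension $(m|2)$ with reduced space $M$ is projected if and only if it is split. -/

import Mathlib

open CategoryTheory TopologicalSpace Opposite
open scoped Manifold

universe u

noncomputable section

namespace SuperGeometry

/-! ### Sheaves of commutative `𝕜`-algebras and of modules over them -/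

/-- A sheaf of commutative `𝕜`-algebras on the space `X`. -/
structure FunctionSheaf (𝕜 : Type) [Field 𝕜] (X : TopCat.{u}) where
  /-- the underlying sheaf of commutative rings -/
  sheaf : X.Sheaf CommRingCat.{u}
  /-- the `𝕜`-algebra structure on sections -/
  algebra : ∀ U : Opens X, Algebra 𝕜 (sheaf.obj.obj (op U))
  map_algebraMap : ∀ {U W : Opens X} (h : W ≤ U) (c : 𝕜),
    (sheaf.obj.map (homOfLE h).op).hom (algebraMap 𝕜 (sheaf.obj.obj (op U)) c) =
      algebraMap 𝕜 (sheaf.obj.obj (op W)) c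

variable {𝕜 : Type} [Field 𝕜] {X : TopCat.{u}}

namespace FunctionSheaf

/-- Sections over `U`. -/
abbrev sec (O : FunctionSheaf 𝕜 X) (U : Opens X) : Type u := O.sheaf.obj.obj (op U)

instance (O : FunctionSheaf 𝕜 X) (U : Opens X) : Algebra 𝕜 (O.sec U) := O.algebra U

/-- Restriction of sections. -/
def res (O : FunctionSheaf 𝕜 X) {U W : Opens X} (h : W ≤ U) : O.sec U →ₐ[𝕜] O.sec W :=
  { (O.sheaf.obj.map (homOfLE h).op).hom with
    commutes' := fun c => O.map_algebraMap h c }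

theorem res_self (O : FunctionSheaf 𝕜 X) {U : Opens X} (f : O.sec U) :
    O.res (le_refl U) f = f := by
  change (O.sheaf.obj.map (𝟙 _)).hom f = f
  simp

theorem res_res (O : FunctionSheaf 𝕜 X) {U W Z : Opens X} (h : W ≤ U) (h' : Z ≤ W)
    (f : O.sec U) : O.res h' (O.res h f) = O.res (h'.trans h) f := by
  have : (homOfLE (h'.trans h)).op = (homOfLE h).op ≫ (homOfLE h').op := rfl
  change (O.sheaf.obj.map (homOfLE h').op).hom ((O.sheaf.obj.map (homOfLE h).op).hom f) =
    (O.sheaf.obj.map (homOfLE (h'.trans h)).op).hom f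
  rw [this, Functor.map_comp]
  rfl

end FunctionSheaf

variable {O : FunctionSheaf 𝕜 X}

/-- Sheaves of `O`-modules. -/
abbrev ModuleSheaf (O : FunctionSheaf 𝕜 X) : Type (u + 1) :=
  SheafOfModules.{u} ((sheafCompose (Opens.grothendieckTopology X)
    (forget₂ CommRingCat.{u} RingCat.{u})).obj O.sheaf)

namespace ModuleSheaf

/-- Sections over `U`. -/
abbrev sec (V : ModuleSheaf O) (U : Opens X) : Type u := V.val.presheaf.obj (op U)

instance (V : ModuleSheaf O) (U : Opens X) : Module (O.sec U) (V.sec U) :=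
  (V.val.obj (op U)).isModule

/-- Restriction of sections. -/
def res (V : ModuleSheaf O) {U W : Opens X} (h : W ≤ U) : V.sec U →+ V.sec W :=
  (V.val.presheaf.map (homOfLE h).op).hom

theorem res_smul (V : ModuleSheaf O) {U W : Opens X} (h : W ≤ U) (f : O.sec U) (v : V.sec U) :
    V.res h (f • v) = O.res h f • V.res h v :=
  V.val.map_smul _ _ _

theorem res_self (V : ModuleSheaf O) {U : Opens X} (v : V.sec U) :
    V.res (le_refl U) v = v := by
  change (V.val.presheaf.map (𝟙 _)).hom v = v
  rw [CategoryTheory.Functor.map_id]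
  rfl

theorem res_res (V : ModuleSheaf O) {U W Z : Opens X} (h : W ≤ U) (h' : Z ≤ W)
    (v : V.sec U) : V.res h' (V.res h v) = V.res (h'.trans h) v := by
  have : (homOfLE (h'.trans h)).op = (homOfLE h).op ≫ (homOfLE h').op := rfl
  change (V.val.presheaf.map (homOfLE h').op).hom ((V.val.presheaf.map (homOfLE h).op).hom v) =
    (V.val.presheaf.map (homOfLE (h'.trans h)).op).hom v
  rw [this, Functor.map_comp]
  rfl

/-- `e` is a frame of `V` over `U`: an isomorphism from `O^n` to `V` over `U`. -/
def IsFrame (V : ModuleSheaf O) {n : ℕ} {U : Opens X} (e : Fin n → V.sec U) : Prop :=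
  ∀ (W : Opens X) (h : W ≤ U),
    Function.Bijective fun c : Fin n → O.sec W => ∑ i, c i • V.res h (e i)

/-- `V` is a vector bundle of rank `n`: a locally free sheaf of `O`-modules of rank `n`. -/
def IsVectorBundle (V : ModuleSheaf O) (n : ℕ) : Prop :=
  ∀ x : X, ∃ U : Opens X, x ∈ U ∧ ∃ e : Fin n → V.sec U, V.IsFrame e

/-- Sections over `U` of the dual sheaf `V^∨ = Hom(V, O)`: morphisms `V|_U → O|_U`. -/
def dual (V : ModuleSheaf O) (U : Opens X) :
    AddSubgroup (∀ W : Set.Iic U, V.sec W.1 →ₗ[O.sec W.1] O.sec W.1) where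
  carrier := {φ | ∀ (W W' : Set.Iic U) (h : W'.1 ≤ W.1) (v : V.sec W.1),
    O.res h (φ W v) = φ W' (V.res h v)}
  zero_mem' := by intro W W' h v; exact map_zero _
  add_mem' := by
    intro a b ha hb W W' h v
    simp only [Pi.add_apply, LinearMap.add_apply, map_add, ha W W' h v, hb W W' h v]
  neg_mem' := by
    intro a ha W W' h v
    simp only [Pi.neg_apply, LinearMap.neg_apply, map_neg, ha W W' h v]

/-- Evaluation of a covector field `φ ∈ V^∨(U)` on `v ∈ V(W)` for `W ≤ U`. -/
def ev (V : ModuleSheaf O) {U W : Opens X} (h : W ≤ U) (φ : V.dual U) (v : V.sec W) : O.sec W :=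
  φ.1 ⟨W, h⟩ v

/-- Restriction `V^∨(U) → V^∨(W)`. -/
def dualRes (V : ModuleSheaf O) {U W : Opens X} (h : W ≤ U) : V.dual U →+ V.dual W where
  toFun φ := ⟨fun Z => φ.1 ⟨Z.1, Z.2.trans h⟩, fun Z Z' hZ v => φ.2 ⟨Z.1, _⟩ ⟨Z'.1, _⟩ hZ v⟩
  map_zero' := rfl
  map_add' _ _ := rfl

instance (V : ModuleSheaf O) (U : Opens X) : SMul (O.sec U) (V.dual U) where
  smul f φ := ⟨fun W => O.res W.2 f • φ.1 W, by
    intro W W' h v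
    simp only [LinearMap.smul_apply, smul_eq_mul, map_mul, φ.2 W W' h v]
    exact congrArg (· * _) (O.res_res _ _ f)⟩

theorem smul_val (V : ModuleSheaf O) {U : Opens X} (f : O.sec U) (φ : V.dual U)
    (W : Set.Iic U) : (f • φ).1 W = O.res W.2 f • φ.1 W := rfl

instance (V : ModuleSheaf O) (U : Opens X) : Module (O.sec U) (V.dual U) where
  one_smul φ := by
    refine Subtype.ext (funext fun W => ?_)
    rw [smul_val, map_one, one_smul]
  mul_smul f g φ := by
    refine Subtype.ext (funext fun W => ?_)
    rw [smul_val, smul_val, smul_val, map_mul, mul_smul]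
  smul_zero f := by
    refine Subtype.ext (funext fun W => ?_)
    rw [smul_val]
    exact smul_zero _
  smul_add f φ ψ := by
    refine Subtype.ext (funext fun W => ?_)
    change (f • (φ + ψ)).1 W = (f • φ).1 W + (f • ψ).1 W
    rw [smul_val, smul_val, smul_val]
    exact smul_add _ _ _
  add_smul f g φ := by
    refine Subtype.ext (funext fun W => ?_)
    change ((f + g) • φ).1 W = (f • φ).1 W + (g • φ).1 W
    rw [smul_val, smul_val, smul_val, map_add, add_smul]
  zero_smul φ := by
    refine Subtype.ext (funext fun W => ?_)
    rw [smul_val, map_zero, zero_smul]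
    rfl

/-- Sections over `U` of the sheaf `Hom(∧²V, T)`, where `T = Der_𝕜(O)` is the tangent sheaf.
By the universal property of `∧²`, a morphism `∧²V|_U → T|_U` is an alternating bilinear map of
sheaves `V|_U × V|_U → T|_U`. As a section of `T` over `W` is a derivation of the sheaf `O|_W`,
this amounts to a family of alternating `O(W)`-bilinear maps `V(W) × V(W) → Der_𝕜(O(W))`, for
`W ≤ U`, that commutes with the restriction of both kinds of arguments. -/
def altTangent (V : ModuleSheaf O) (U : Opens X) :
    AddSubgroup (∀ W : Set.Iic U,
      V.sec W.1 [⋀^Fin 2]→ₗ[O.sec W.1] Derivation 𝕜 (O.sec W.1) (O.sec W.1)) where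
  carrier := {β | ∀ (W W' : Set.Iic U) (h : W'.1 ≤ W.1) (v : Fin 2 → V.sec W.1) (f : O.sec W.1),
    O.res h (β W v f) = β W' (fun i => V.res h (v i)) (O.res h f)}
  zero_mem' := by intro W W' h v f; exact map_zero _
  add_mem' := by
    intro a b ha hb W W' h v f
    simp only [Pi.add_apply, AlternatingMap.add_apply, Derivation.add_apply, map_add,
      ha W W' h v f, hb W W' h v f]
  neg_mem' := by
    intro a ha W W' h v f
    simp only [Pi.neg_apply, AlternatingMap.neg_apply, Derivation.neg_apply, map_neg,
      ha W W' h v f]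

/-- Restriction of sections of `Hom(∧²V, T)`. -/
def altTangentRes (V : ModuleSheaf O) {U W : Opens X} (h : W ≤ U) :
    V.altTangent U →+ V.altTangent W where
  toFun β := ⟨fun Z => β.1 ⟨Z.1, Z.2.trans h⟩, fun Z Z' hZ v f => β.2 ⟨Z.1, _⟩ ⟨Z'.1, _⟩ hZ v f⟩
  map_zero' := rfl
  map_add' _ _ := rfl

/-- The sheaf of abelian groups `Hom(∧²V, T)` on `X`. -/
def homExtSqTangent (V : ModuleSheaf O) : TopCat.Presheaf AddCommGrpCat.{u} X where
  obj U := AddCommGrpCat.of (V.altTangent U.unop)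
  map i := AddCommGrpCat.ofHom (V.altTangentRes i.unop.le)
  map_id _ := rfl
  map_comp _ _ := rfl

end ModuleSheaf

/-! ### The first cohomology group -/

namespace Cech

/-- Restriction of sections of an abelian (pre)sheaf. -/
def res (F : TopCat.Presheaf AddCommGrpCat.{u} X) {U W : Opens X} (h : W ≤ U) :
    F.obj (op U) →+ F.obj (op W) :=
  (F.map (homOfLE h).op).hom

theorem res_res (F : TopCat.Presheaf AddCommGrpCat.{u} X) {U W Z : Opens X} (h : W ≤ U)
    (h' : Z ≤ W) (s : F.obj (op U)) : res F h' (res F h s) = res F (h'.trans h) s := by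
  have : (homOfLE (h'.trans h)).op = (homOfLE h).op ≫ (homOfLE h').op := rfl
  change (F.map (homOfLE h').op).hom ((F.map (homOfLE h).op).hom s) =
    (F.map (homOfLE (h'.trans h)).op).hom s
  rw [this, Functor.map_comp]
  rfl

variable (X) in
/-- Open covers of `X`, in the form of a choice of an open neighbourhood `U x` of every point `x`.
Every open cover is refined by one of this form. -/
structure Cover where
  /-- the chosen neighbourhood of a point -/
  nhd : X → Opens X
  mem : ∀ x, x ∈ nhd x

/-- Covers are ordered by refinement: `𝒰 ≤ 𝒲` if `𝒲` is finer than `𝒰`. -/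
instance : Preorder (Cover X) where
  le 𝒰 𝒲 := ∀ x, 𝒲.nhd x ≤ 𝒰.nhd x
  le_refl _ _ := le_rfl
  le_trans _ _ _ h h' x := (h' x).trans (h x)

/-- The `1`-cocycles of a cover: families `c x y ∈ F(U x ∩ U y)` with `c x y + c y z = c x z` on
`U x ∩ U y ∩ U z`. -/
def cocycles (F : TopCat.Presheaf AddCommGrpCat.{u} X) (𝒰 : Cover X) :
    AddSubgroup (∀ x y : X, F.obj (op (𝒰.nhd x ⊓ 𝒰.nhd y))) where
  carrier := {c | ∀ (x y z : X) (W : Opens X) (hx : W ≤ 𝒰.nhd x) (hy : W ≤ 𝒰.nhd y)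
    (hz : W ≤ 𝒰.nhd z), res F (le_inf hx hy) (c x y) + res F (le_inf hy hz) (c y z) =
      res F (le_inf hx hz) (c x z)}
  zero_mem' := by intro x y z W hx hy hz; simp
  add_mem' := by
    intro a b ha hb x y z W hx hy hz
    simp only [Pi.add_apply, map_add, ← ha x y z W hx hy hz, ← hb x y z W hx hy hz]
    abel
  neg_mem' := by
    intro a ha x y z W hx hy hz
    simp only [Pi.neg_apply, map_neg, ← ha x y z W hx hy hz]
    abel

/-- The coboundary `(db) x y = b y - b x` of a `0`-cochain, as a cocycle. -/
def coboundary (F : TopCat.Presheaf AddCommGrpCat.{u} X) (𝒰 : Cover X) :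
    (∀ x : X, F.obj (op (𝒰.nhd x))) →+ cocycles F 𝒰 where
  toFun b := ⟨fun x y => res F inf_le_right (b y) - res F inf_le_left (b x), by
    intro x y z W hx hy hz
    simp only [map_sub, res_res]
    abel⟩
  map_zero' := by
    refine Subtype.ext (funext fun x => funext fun y => ?_)
    simp
  map_add' a b := by
    refine Subtype.ext (funext fun x => funext fun y => ?_)
    simp only [Pi.add_apply, map_add, AddSubgroup.coe_add]
    abel

/-- `H¹(𝒰, F)` for a fixed cover. -/
abbrev H1Cover (F : TopCat.Presheaf AddCommGrpCat.{u} X) (𝒰 : Cover X) : Type u :=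
  cocycles F 𝒰 ⧸ (coboundary F 𝒰).range

/-- Restriction of cocycles to a finer cover. -/
def refineCocycle (F : TopCat.Presheaf AddCommGrpCat.{u} X) (𝒰 𝒲 : Cover X) (h : 𝒰 ≤ 𝒲) :
    cocycles F 𝒰 →+ cocycles F 𝒲 where
  toFun c := ⟨fun x y => res F (inf_le_inf (h x) (h y)) (c.1 x y), by
    intro x y z W hx hy hz
    simp only [res_res]
    exact c.2 x y z W (hx.trans (h x)) (hy.trans (h y)) (hz.trans (h z))⟩
  map_zero' := by
    refine Subtype.ext (funext fun x => funext fun y => ?_)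
    simp
  map_add' a b := by
    refine Subtype.ext (funext fun x => funext fun y => ?_)
    simp

/-- The refinement map `H¹(𝒰, F) → H¹(𝒲, F)`. -/
def refine (F : TopCat.Presheaf AddCommGrpCat.{u} X) (𝒰 𝒲 : Cover X) (h : 𝒰 ≤ 𝒲) :
    H1Cover F 𝒰 →+ H1Cover F 𝒲 :=
  QuotientAddGroup.map _ _ (refineCocycle F 𝒰 𝒲 h) (by
    rintro _ ⟨b, rfl⟩
    refine ⟨fun x => res F (h x) (b x), ?_⟩
    refine Subtype.ext (funext fun x => funext fun y => ?_)
    simp only [coboundary, refineCocycle, AddMonoidHom.coe_mk, ZeroHom.coe_mk, map_sub, res_res])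

open Classical in
/-- The first cohomology group `H¹(X, F)` of an abelian sheaf `F` on `X`, as Cech cohomology: the
direct limit of the groups `H¹(𝒰, F)` over all open covers of `X`. In degree one this is the
cohomology of the sheaf `F` on an arbitrary topological space. -/
abbrev H1 (F : TopCat.Presheaf AddCommGrpCat.{u} X) : Type u :=
  AddCommGroup.DirectLimit (H1Cover F) (refine F)

open Classical in
/-- The class in `H¹(X, F)` of a cocycle on an open cover. -/
def classOf (F : TopCat.Presheaf AddCommGrpCat.{u} X) (𝒰 : Cover X) (c : cocycles F 𝒰) : H1 F :=
  AddCommGroup.DirectLimit.of (H1Cover F) (refine F) 𝒰 (QuotientAddGroup.mk c)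

end Cech

/-! ### Supermanifolds -/

/-- A sheaf of supercommutative `𝕜`-algebras on `X`, together with a homomorphism to the sheaf `O`
of functions on `X` (which is going to be the quotient by the ideal of nilpotents). -/
structure SuperSheaf (O : FunctionSheaf 𝕜 X) where
  /-- the sheaf of algebras -/
  sheaf : X.Sheaf (AlgCat.{u} 𝕜)
  /-- the even part (index `0`) and the odd part (index `1`) -/
  part : ∀ U : Opens X, ZMod 2 → Submodule 𝕜 (sheaf.obj.obj (op U))
  gradedMonoid : ∀ U, SetLike.GradedMonoid (part U)
  isInternal : ∀ U, DirectSum.IsInternal (part U)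
  map_mem : ∀ {U W : Opens X} (h : W ≤ U) (i : ZMod 2) (a : sheaf.obj.obj (op U)),
    a ∈ part U i → (sheaf.obj.map (homOfLE h).op).hom a ∈ part W i
  supercomm : ∀ (U : Opens X) (i j : ZMod 2) (a b : sheaf.obj.obj (op U)),
    a ∈ part U i → b ∈ part U j → a * b = (-1) ^ (i.val * j.val) * (b * a)
  /-- restriction of superfunctions to the reduced space -/
  red : ∀ U : Opens X, sheaf.obj.obj (op U) →ₐ[𝕜] O.sec U
  red_map : ∀ {U W : Opens X} (h : W ≤ U) (a : sheaf.obj.obj (op U)),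
    red W ((sheaf.obj.map (homOfLE h).op).hom a) = O.res h (red U a)
  red_odd : ∀ (U : Opens X) (a : sheaf.obj.obj (op U)), a ∈ part U 1 → red U a = 0

namespace SuperSheaf

/-- Sections over `U`. -/
abbrev sec (S : SuperSheaf O) (U : Opens X) : Type u := S.sheaf.obj.obj (op U)

/-- Restriction of sections. -/
def res (S : SuperSheaf O) {U W : Opens X} (h : W ≤ U) : S.sec U →ₐ[𝕜] S.sec W :=
  (S.sheaf.obj.map (homOfLE h).op).hom

theorem res_res (S : SuperSheaf O) {U W Z : Opens X} (h : W ≤ U) (h' : Z ≤ W)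
    (a : S.sec U) : S.res h' (S.res h a) = S.res (h'.trans h) a := by
  have : (homOfLE (h'.trans h)).op = (homOfLE h).op ≫ (homOfLE h').op := rfl
  change (S.sheaf.obj.map (homOfLE h').op).hom ((S.sheaf.obj.map (homOfLE h).op).hom a) =
    (S.sheaf.obj.map (homOfLE (h'.trans h)).op).hom a
  rw [this, Functor.map_comp]
  rfl

/-- A projection over `U`: an even homomorphism of sheaves of algebras `O|_U → O_S|_U` that is a
section of `O_S → O`. -/
structure Projection (S : SuperSheaf O) (U : Opens X) where
  /-- the embedding of functions into superfunctions -/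
  emb : ∀ W : Opens X, W ≤ U → (O.sec W →ₐ[𝕜] S.sec W)
  emb_res : ∀ {W W' : Opens X} (h : W ≤ U) (h' : W' ≤ W) (f : O.sec W),
    S.res h' (emb W h f) = emb W' (h'.trans h) (O.res h' f)
  emb_even : ∀ (W : Opens X) (h : W ≤ U) (f : O.sec W), emb W h f ∈ S.part W 0
  red_emb : ∀ (W : Opens X) (h : W ≤ U) (f : O.sec W), S.red W (emb W h f) = f

/-- An isomorphism over `U` of `S` with the local model `S(X, O^n)`, the sheaf of exterior
algebras `∧(O^n) = O[θ₁, …, θₙ]`; it is compatible with the maps to `O`. -/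
structure OddCoordinates (S : SuperSheaf O) (n : ℕ) (U : Opens X) extends Projection S U where
  /-- the odd coordinates -/
  θ : Fin n → S.sec U
  odd : ∀ i, θ i ∈ S.part U 1
  isExterior : ∀ (W : Opens X) (h : W ≤ U),
    ∃ Φ : ExteriorAlgebra (O.sec W) (Fin n → O.sec W) ≃+* S.sec W,
      (∀ f, Φ (algebraMap _ _ f) = emb W h f) ∧
      ∀ i, Φ (ExteriorAlgebra.ι _ (Pi.single i 1)) = S.res h (θ i)

/-- `S` is a supermanifold of odd dimension `n` with reduced space `(X, O)`: it is locally
isomorphic to `S(X, O^n)`. In particular `O` is the quotient of `O_S` by the ideal generated by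
the odd functions. -/
def IsSupermanifold (S : SuperSheaf O) (n : ℕ) : Prop :=
  ∀ x : X, ∃ U : Opens X, x ∈ U ∧ Nonempty (S.OddCoordinates n U)

/-- The power `J^k(U)` of the sheaf of ideals `J` generated by the odd functions: the sections that
locally lie in the `k`-th power of the ideal generated by the odd sections. -/
def J (S : SuperSheaf O) (k : ℕ) (U : Opens X) : Submodule 𝕜 (S.sec U) where
  carrier := {a | ∀ x ∈ U, ∃ (W : Opens X) (h : W ≤ U), x ∈ W ∧
    S.res h a ∈ ((⊤ : Submodule 𝕜 (S.sec W)) * S.part W 1) ^ k}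
  zero_mem' := by
    intro x hx
    exact ⟨U, le_rfl, hx, by rw [map_zero]; exact zero_mem _⟩
  smul_mem' := by
    intro c a ha x hx
    obtain ⟨W, h, hW, h'⟩ := ha x hx
    exact ⟨W, h, hW, by rw [map_smul]; exact Submodule.smul_mem _ _ h'⟩
  add_mem' := by
    intro a b ha hb x hx
    obtain ⟨W, h, hW, h'⟩ := ha x hx
    obtain ⟨Z, g, hZ, g'⟩ := hb x hx
    have key : ∀ {U W : Opens X} (h : W ≤ U) (a : S.sec U),
        a ∈ ((⊤ : Submodule 𝕜 (S.sec U)) * S.part U 1) ^ k →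
        S.res h a ∈ ((⊤ : Submodule 𝕜 (S.sec W)) * S.part W 1) ^ k := by
      intro U W h a ha
      have h1 : S.res h a ∈
          (((⊤ : Submodule 𝕜 (S.sec U)) * S.part U 1) ^ k).map (S.res h).toLinearMap :=
        ⟨a, ha, rfl⟩
      rw [Submodule.map_pow, Submodule.map_mul] at h1
      have h2 : (S.part U 1).map (S.res h).toLinearMap ≤ S.part W 1 := by
        rintro _ ⟨b, hb, rfl⟩
        exact S.map_mem h 1 b hb
      have h3 : (Submodule.map (S.res h).toLinearMap ⊤ *
          (S.part U 1).map (S.res h).toLinearMap) ^ k ≤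
          ((⊤ : Submodule 𝕜 (S.sec W)) * S.part W 1) ^ k :=
        pow_le_pow_left' (mul_le_mul' le_top h2) k
      exact h3 h1
    refine ⟨W ⊓ Z, inf_le_left.trans h, ⟨hW, hZ⟩, ?_⟩
    rw [map_add, ← S.res_res h inf_le_left, ← S.res_res g inf_le_right]
    exact add_mem (key _ _ h') (key _ _ g')

/-- An isomorphism `ρ` of `V` with the odd tangent bundle `T₋S = (J/J²)^∨`, given by the
corresponding isomorphism `J/J² ≅ V^∨` of sheaves of `O`-modules. -/
structure OddTangentIso (S : SuperSheaf O) (V : ModuleSheaf O) where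
  /-- the map `J → V^∨` -/
  toDual : ∀ U : Opens X, S.J 1 U →+ V.dual U
  toDual_res : ∀ {U W : Opens X} (h : W ≤ U) (a : S.J 1 U) (b : S.J 1 W),
    S.res h a = b → toDual W b = V.dualRes h (toDual U a)
  toDual_mul : ∀ (U : Opens X) (a : S.sec U) (b c : S.J 1 U), (c : S.sec U) = a * b →
    toDual U c = S.red U a • toDual U b
  /-- the kernel is `J²` -/
  toDual_eq_zero : ∀ (U : Opens X) (a : S.J 1 U), toDual U a = 0 ↔ (a : S.sec U) ∈ S.J 2 U
  /-- the map is an epimorphism of sheaves -/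
  toDual_surj : ∀ (U : Opens X) (φ : V.dual U), ∀ x ∈ U, ∃ (W : Opens X) (h : W ≤ U), x ∈ W ∧
    ∃ a : S.J 1 W, toDual W a = V.dualRes h φ

/-- An isomorphism over `U` of `S` with the split supermanifold `S(X, V)`, whose structure sheaf
`∧V^∨` is the sheaf associated with `W ↦ ∧(V^∨(W))`. It consists of homomorphisms
`emb : O → O_S` and `coord : V^∨ → O_S` on `U` such that the homomorphism `∧V^∨ → O_S` defined by
them is locally an isomorphism. -/
structure Splitting (S : SuperSheaf O) (V : ModuleSheaf O) (U : Opens X)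
    extends Projection S U where
  /-- the embedding of the fibrewise linear functions -/
  coord : ∀ W : Opens X, W ≤ U → (V.dual W →+ S.sec W)
  coord_res : ∀ {W W' : Opens X} (h : W ≤ U) (h' : W' ≤ W) (φ : V.dual W),
    S.res h' (coord W h φ) = coord W' (h'.trans h) (V.dualRes h' φ)
  coord_smul : ∀ (W : Opens X) (h : W ≤ U) (f : O.sec W) (φ : V.dual W),
    coord W h (f • φ) = emb W h f * coord W h φ
  coord_odd : ∀ (W : Opens X) (h : W ≤ U) (φ : V.dual W), coord W h φ ∈ S.part W 1
  isExterior : ∀ x ∈ U, ∃ (Z : Opens X), x ∈ Z ∧ Z ≤ U ∧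
    ∀ (W : Opens X) (_ : W ≤ Z) (h : W ≤ U),
      ∃ Φ : ExteriorAlgebra (O.sec W) (V.dual W) ≃+* S.sec W,
        (∀ f, Φ (algebraMap _ _ f) = emb W h f) ∧
        ∀ φ, Φ (ExteriorAlgebra.ι _ φ) = coord W h φ

/-- The splitting `S(X, V) ≅ S` over `U` induces the given isomorphism `ρ` on odd tangent
bundles. -/
def Splitting.Induces {S : SuperSheaf O} {V : ModuleSheaf O} {U : Opens X}
    (σ : S.Splitting V U) (ρ : S.OddTangentIso V) : Prop :=
  ∀ (W : Opens X) (h : W ≤ U) (φ : V.dual W) (a : S.J 1 W), (a : S.sec W) = σ.coord W h φ →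
    ρ.toDual W a = φ

/-- `S` is projected: `O_S → O` has a global section that is an (even) homomorphism of sheaves of
algebras; equivalently, `O_S` has the structure of a sheaf of `O`-algebras compatible with
`O_S → O`. -/
def IsProjected (S : SuperSheaf O) : Prop := Nonempty (S.Projection ⊤)

/-- `S`, of odd dimension `n`, is split: it is isomorphic to `S(X, V)` for some vector bundle `V`
of rank `n`. -/
def IsSplit (S : SuperSheaf O) (n : ℕ) : Prop :=
  ∃ V : ModuleSheaf O, V.IsVectorBundle n ∧ Nonempty (S.Splitting V ⊤)

/-- Two local splittings `σ` over `U` and `τ` over `U'` differ on `U ⊓ U'` by the automorphism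
`g = σ⁻¹τ` of `S(X, V)`. This says that `z` is the image of `g` in `Hom(∧²V, T)`, that is,
`g f ≡ f + z(f)` modulo `J³` for functions `f`, where `z(f) ∈ ∧²V^∨` and `∧²V^∨` is identified with
the alternating forms on `V` by `φ ∧ ψ ↦ ((v, w) ↦ φ(v) ψ(w) - φ(w) ψ(v))`. -/
def IsTransition {S : SuperSheaf O} {V : ModuleSheaf O} {U U' : Opens X}
    (σ : S.Splitting V U) (τ : S.Splitting V U') (z : V.altTangent (U ⊓ U')) : Prop :=
  ∀ (W : Opens X) (h : W ≤ U) (h' : W ≤ U') (f : O.sec W), ∀ x ∈ W,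
    ∃ (Z : Opens X) (hZ : Z ≤ W), x ∈ Z ∧ ∃ (r : ℕ) (φ ψ : Fin r → V.dual Z),
      S.res hZ (τ.emb W h' f) - S.res hZ (σ.emb W h f) -
        ∑ k, σ.coord Z (hZ.trans h) (φ k) * σ.coord Z (hZ.trans h) (ψ k) ∈ S.J 3 Z ∧
      ∀ (Y : Opens X) (hY : Y ≤ Z) (v w : V.sec Y),
        z.1 ⟨Y, le_inf ((hY.trans hZ).trans h) ((hY.trans hZ).trans h')⟩ ![v, w]
            (O.res (hY.trans hZ) f) =
          ∑ k, (V.ev hY (φ k) v * V.ev hY (ψ k) w - V.ev hY (φ k) w * V.ev hY (ψ k) v)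

/-- `ω ∈ H¹(X, Hom(∧²V, T))` is the first obstruction class `ω₂` of the pair `(S, ρ)`: it is the
class of the cocycle formed by the images in `Hom(∧²V, T)` of the transition automorphisms between
local splittings of `(S, ρ)`. -/
def IsFirstObstruction (S : SuperSheaf O) {V : ModuleSheaf O} (ρ : S.OddTangentIso V)
    (ω : Cech.H1 V.homExtSqTangent) : Prop :=
  ∃ (𝒰 : Cech.Cover X) (σ : ∀ x, S.Splitting V (𝒰.nhd x))
    (z : Cech.cocycles V.homExtSqTangent 𝒰),
    (∀ x, (σ x).Induces ρ) ∧ (∀ x y, IsTransition (σ x) (σ y) (z.1 x y)) ∧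
      Cech.classOf V.homExtSqTangent 𝒰 z = ω

/-- An isomorphism of supermanifolds with reduced space `(X, O)` and odd tangent bundle identified
with `V` that induces the identity on `(X, O)` and on `V`. -/
structure Iso {S S' : SuperSheaf O} {V : ModuleSheaf O} (ρ : S.OddTangentIso V)
    (ρ' : S'.OddTangentIso V) where
  /-- the isomorphism on sections -/
  equiv : ∀ U : Opens X, S.sec U ≃ₐ[𝕜] S'.sec U
  equiv_res : ∀ {U W : Opens X} (h : W ≤ U) (a : S.sec U),
    S'.res h (equiv U a) = equiv W (S.res h a)
  equiv_mem : ∀ (U : Opens X) (i : ZMod 2) (a : S.sec U), a ∈ S.part U i → equiv U a ∈ S'.part U i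
  red_equiv : ∀ (U : Opens X) (a : S.sec U), S'.red U (equiv U a) = S.red U a
  toDual_equiv : ∀ (U : Opens X) (a : S.J 1 U) (b : S'.J 1 U), equiv U a = b →
    ρ'.toDual U b = ρ.toDual U a

end SuperSheaf

/-! ### Manifolds -/

/-- The kinds of manifolds: those with functions of class `C^k` over the ground field, where
`k = 0` stands for continuous functions, `k = ∞` for smooth ones and `k = ω` for (real or complex)
analytic ones; and algebraic manifolds. -/
inductive ManifoldKind where
  | contDiff (k : WithTop ℕ∞)
  | algebraic

/-- The image in `Y` of an open subset of the source of a chart. -/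
def imageOpen {Y : Type*} [TopologicalSpace Y] (χ : OpenPartialHomeomorph X Y) (W : Opens X)
    (h : (W : Set X) ⊆ χ.source) : Opens Y :=
  ⟨χ '' W, χ.isOpen_image_of_subset_source W.isOpen h⟩

namespace FunctionSheaf

/-- A chart of `(X, O)` with values in affine space `𝕜^m` and its sheaf of functions of
class `C^k`. -/
structure ContDiffChart {𝕜 : Type} [RCLike 𝕜] {X : TopCat.{u}} (O : FunctionSheaf 𝕜 X)
    (k : WithTop ℕ∞) (m : ℕ) where
  /-- the underlying map -/
  chart : OpenPartialHomeomorph X (EuclideanSpace 𝕜 (Fin m))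
  /-- the isomorphism of sheaves of algebras -/
  iso : ∀ (W : Opens X) (h : (W : Set X) ⊆ chart.source),
    O.sec W ≃ₐ[𝕜] C^k⟮𝓘(𝕜, EuclideanSpace 𝕜 (Fin m)), imageOpen chart W h; 𝓘(𝕜, 𝕜), 𝕜⟯
  iso_res : ∀ (W W' : Opens X) (h : (W : Set X) ⊆ chart.source) (hW : W' ≤ W) (f : O.sec W)
    (y : EuclideanSpace 𝕜 (Fin m)) (hy : y ∈ imageOpen chart W h)
    (hy' : y ∈ imageOpen chart W' (Set.Subset.trans hW h)),
    iso W' (Set.Subset.trans hW h) (O.res hW f) ⟨y, hy'⟩ = iso W h f ⟨y, hy⟩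

/-- A chart of `(X, O)` with values in the affine scheme `Spec R` of a ring `R`. -/
structure AffineChart {𝕜 : Type} [Field 𝕜] {X : TopCat.{u}} (O : FunctionSheaf 𝕜 X)
    (R : Type u) [CommRing R] [Algebra 𝕜 R] where
  /-- the underlying map -/
  chart : OpenPartialHomeomorph X (PrimeSpectrum R)
  /-- the isomorphism of sheaves of rings -/
  iso : ∀ (W : Opens X) (h : (W : Set X) ⊆ chart.source),
    O.sec W ≃+* (AlgebraicGeometry.Spec.structureSheaf R).obj.obj (op (imageOpen chart W h))
  iso_res : ∀ (W W' : Opens X) (h : (W : Set X) ⊆ chart.source) (hW : W' ≤ W) (f : O.sec W)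
    (i : imageOpen chart W' (Set.Subset.trans hW h) ⟶ imageOpen chart W h),
    iso W' (Set.Subset.trans hW h) (O.res hW f) =
      ((AlgebraicGeometry.Spec.structureSheaf R).obj.map i.op).hom (iso W h f)
  iso_algebraMap : ∀ (W : Opens X) (h : (W : Set X) ⊆ chart.source) (c : 𝕜),
    iso W h (algebraMap 𝕜 (O.sec W) c) =
      @algebraMap R _ _ _ (AlgebraicGeometry.StructureSheaf.openAlgebra R (op (imageOpen chart W h)))
        (algebraMap 𝕜 R c)

/-- `(X, O)` is a manifold of dimension `m`: it is locally isomorphic to `𝕜^m` with its sheaf of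
functions of class `C^k`, respectively to a nonsingular affine variety of dimension `m`. -/
def IsManifold {𝕜 : Type} [RCLike 𝕜] {X : TopCat.{u}} (O : FunctionSheaf 𝕜 X) (m : ℕ) :
    ManifoldKind → Prop
  | .contDiff k => ∀ x : X, ∃ c : O.ContDiffChart k m, x ∈ c.chart.source
  | .algebraic => ∀ x : X, ∃ (R : Type u) (_ : CommRing R) (_ : Algebra 𝕜 R),
      IsDomain R ∧ Algebra.FiniteType 𝕜 R ∧ Algebra.Smooth 𝕜 R ∧ ringKrullDim R = m ∧
        ∃ c : O.AffineChart R, x ∈ c.chart.source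

end FunctionSheaf

end SuperGeometry

end

/-! In odd dimension two the ideal `J` generated by the odd functions satisfies `J³ = 0`, and
locally a superfunction is uniquely of the form `a + bs + ct + dst` (`NormalForm`). Hence `J` is the
kernel of `O_S → O`, `J²` consists of the even nilpotent functions, and the odd functions are a
complement of `J²` in `J`. An isomorphism `ρ : V ≅ T₋S` therefore identifies odd functions with
`V^∨` (`oddSec`) and `J²` with `∧²V^∨` (`topSec`), without any choice. The only freedom left in a
splitting that induces `ρ` is its embedding `O → O_S`, that is, a projection. So a projected
supermanifold is split, with `V = T₋S`, and `ω₂` measures the failure of local projections to agree.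

Two projections differ by a map `O → J² ≅ ∧²V^∨`. Because `J²·J = 0`, this map is a derivation, that
is, a section of `Hom(∧²V, T)` (`exists_isDifference`); conversely, modifying a projection by such a
derivation gives a projection again (`Projection.twist`). The differences of local projections thus
form an additive cocycle, and another choice of projections changes it by a coboundary. This gives
existence and uniqueness of `ω₂`.

With respect to local projections `π_x` on `U_x`, a superfunction is a triple `(f, φ, (α_x))`,
standing for `π_x(f) + φ + α_x` on each `U_x`. Comparison on overlaps gives the single condition
`α_x - α_y = z_xy(f)`. The algebra of such triples (`twistedAlgebra`) depends only on the cocycle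
`z`. Therefore supermanifolds with the same cocycle are isomorphic (`nonempty_iso`), and
cohomologous cocycles can be made equal by twisting the projections. For an arbitrary cocycle the
same triples define a supermanifold (`twisted`) whose obstruction is the given class. -/

noncomputable section

namespace SuperGeometry

universe v w

/-! ### Gluing -/

section Gluing

variable {X : TopCat.{u}}

/-- A family of sets `F U` with restriction maps `r` is a sheaf of sets on `X`. -/
structure IsSheafRes (F : Opens X → Type v) (r : ∀ U W : Opens X, W ≤ U → F U → F W) : Prop where
  self : ∀ (U : Opens X) (a : F U), r U U le_rfl a = a
  comp : ∀ (U W Z : Opens X) (h : W ≤ U) (h' : Z ≤ W) (a : F U),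
    r W Z h' (r U W h a) = r U Z (h'.trans h) a
  sep : ∀ (U : Opens X) (a b : F U),
    (∀ x ∈ U, ∃ (W : Opens X) (h : W ≤ U), x ∈ W ∧ r U W h a = r U W h b) → a = b
  -- The sections to be glued are described by a predicate `P` instead of a family indexed by a
  -- cover. Stability under restriction together with uniqueness replaces agreement on overlaps, so
  -- no intersections have to be named when gluing.
  glue : ∀ (U : Opens X) (P : ∀ W : Opens X, F W → Prop),
    (∀ x ∈ U, ∃ (W : Opens X) (_ : W ≤ U), x ∈ W ∧ ∃ s, P W s) →
    (∀ (W Z : Opens X) (h : Z ≤ W) (s : F W), P W s → P Z (r W Z h s)) →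
    (∀ (W : Opens X) (s t : F W), W ≤ U → P W s → P W t → s = t) →
    ∃ s : F U, ∀ (W : Opens X) (h : W ≤ U) (t : F W), P W t → r U W h s = t

variable {F : Opens X → Type v} {r : ∀ U W : Opens X, W ≤ U → F U → F W}
  {G : Opens X → Type w} {q : ∀ U W : Opens X, W ≤ U → G U → G W}

/-- An injective morphism of sheaves that is locally surjective is surjective. -/
theorem IsSheafRes.surjective_of_locally (hF : IsSheafRes F r) (hG : IsSheafRes G q)
    (η : ∀ U, F U → G U) (nat : ∀ (U W : Opens X) (h : W ≤ U) (a : F U),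
      η W (r U W h a) = q U W h (η U a)) (U : Opens X)
    (inj : ∀ W : Opens X, W ≤ U → Function.Injective (η W)) (b : G U)
    (loc : ∀ x ∈ U, ∃ (W : Opens X) (h : W ≤ U), x ∈ W ∧ ∃ a, η W a = q U W h b) :
    ∃ a, η U a = b := by
  obtain ⟨s, hs⟩ := hF.glue U (fun W s => ∃ h : W ≤ U, η W s = q U W h b)
    (fun x hx => by
      obtain ⟨W, hW, hxW, s, hs⟩ := loc x hx
      exact ⟨W, hW, hxW, s, hW, hs⟩)
    (fun W Z h s ⟨hW, hs⟩ => ⟨h.trans hW, by rw [nat, hs, hG.comp]⟩)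
    (fun W s t hW ⟨_, hs⟩ ⟨_, ht⟩ => inj W hW (hs.trans ht.symm))
  refine ⟨s, hG.sep U _ _ fun x hx => ?_⟩
  obtain ⟨W, hW, hxW, t, ht⟩ := loc x hx
  refine ⟨W, hW, hxW, ?_⟩
  rw [← nat, hs W hW t ⟨hW, ht⟩, ht]

/-- A morphism of sheaves that is bijective on small open sets is bijective. -/
theorem IsSheafRes.bijective_of_locally (hF : IsSheafRes F r) (hG : IsSheafRes G q)
    (η : ∀ U, F U → G U) (nat : ∀ (U W : Opens X) (h : W ≤ U) (a : F U),
      η W (r U W h a) = q U W h (η U a)) (U : Opens X)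
    (loc : ∀ x ∈ U, ∃ (W : Opens X) (_ : W ≤ U), x ∈ W ∧
      ∀ Z : Opens X, Z ≤ W → Function.Bijective (η Z)) : Function.Bijective (η U) := by
  -- Injectivity is needed on every open subset of `U`, since it is what makes local preimages
  -- compatible and hence gluable.
  have inj : ∀ W : Opens X, W ≤ U → Function.Injective (η W) := by
    intro W hW a b hab
    refine hF.sep W a b fun x hx => ?_
    obtain ⟨Z, hZ, hxZ, hb⟩ := loc x (hW hx)
    refine ⟨W ⊓ Z, inf_le_left, ⟨hx, hxZ⟩, (hb _ inf_le_right).1 ?_⟩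
    rw [nat, nat, hab]
  refine ⟨inj U le_rfl, fun b => hF.surjective_of_locally hG η nat U inj b fun x hx => ?_⟩
  obtain ⟨W, hW, hxW, hb⟩ := loc x hx
  exact ⟨W, hW, hxW, (hb W le_rfl).2 _⟩

/-- The subsheaf cut out by a local condition. -/
theorem IsSheafRes.subtype (hF : IsSheafRes F r) (p : ∀ U, F U → Prop)
    (hp : ∀ (U W : Opens X) (h : W ≤ U) (a : F U), p U a → p W (r U W h a))
    (loc : ∀ (U : Opens X) (a : F U),
      (∀ x ∈ U, ∃ (W : Opens X) (h : W ≤ U), x ∈ W ∧ p W (r U W h a)) → p U a) :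
    IsSheafRes (fun U => {a : F U // p U a}) fun U W h a => ⟨r U W h a.1, hp U W h a.1 a.2⟩ where
  self U a := Subtype.ext (hF.self U a.1)
  comp U W Z h h' a := Subtype.ext (hF.comp U W Z h h' a.1)
  sep U a b hab := Subtype.ext (hF.sep U a.1 b.1 fun x hx => by
    obtain ⟨W, h, hxW, e⟩ := hab x hx
    exact ⟨W, h, hxW, congrArg Subtype.val e⟩)
  glue U P ex st un := by
    obtain ⟨s, hs⟩ := hF.glue U (fun W a => ∃ h : p W a, P W ⟨a, h⟩)
      (fun x hx => by
        obtain ⟨W, h, hxW, s, hP⟩ := ex x hx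
        exact ⟨W, h, hxW, s.1, s.2, hP⟩)
      (fun W Z h s ⟨hs, hP⟩ => ⟨hp _ _ h _ hs, st W Z h ⟨s, hs⟩ hP⟩)
      (fun W s t hW ⟨hs, hP⟩ ⟨ht, hP'⟩ => congrArg Subtype.val (un W ⟨s, hs⟩ ⟨t, ht⟩ hW hP hP'))
    refine ⟨⟨s, loc U s fun x hx => ?_⟩, fun W h t hP => Subtype.ext (hs W h t.1 ⟨t.2, hP⟩)⟩
    obtain ⟨W, h, hxW, t, hP⟩ := ex x hx
    refine ⟨W, h, hxW, ?_⟩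
    rw [hs W h t.1 ⟨t.2, hP⟩]
    exact t.2

/-- A subpresheaf of a sheaf whose membership is a local condition is a sheaf. -/
theorem IsSheafRes.of_injective (hF : IsSheafRes F r) (ι : ∀ U, G U → F U)
    (inj : ∀ U, Function.Injective (ι U))
    (nat : ∀ (U W : Opens X) (h : W ≤ U) (a : G U), ι W (q U W h a) = r U W h (ι U a))
    (loc : ∀ (U : Opens X) (a : F U), (∀ x ∈ U, ∃ (W : Opens X) (h : W ≤ U), x ∈ W ∧
      ∃ b, ι W b = r U W h a) → ∃ b, ι U b = a) : IsSheafRes G q where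
  self U a := inj U (by rw [nat, hF.self])
  comp U W Z h h' a := inj Z (by rw [nat, nat, nat, hF.comp])
  sep U a b hab := inj U (hF.sep U _ _ fun x hx => by
    obtain ⟨W, h, hxW, e⟩ := hab x hx
    exact ⟨W, h, hxW, by rw [← nat, ← nat, e]⟩)
  glue U P ex st un := by
    obtain ⟨s, hs⟩ := hF.glue U (fun W a => ∃ b, ι W b = a ∧ P W b)
      (fun x hx => by
        obtain ⟨W, h, hxW, s, hP⟩ := ex x hx
        exact ⟨W, h, hxW, _, s, rfl, hP⟩)
      (by
        rintro W Z h _ ⟨b, rfl, hP⟩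
        exact ⟨_, nat W Z h b, st W Z h b hP⟩)
      (by
        rintro W _ _ hW ⟨b, rfl, hP⟩ ⟨b', rfl, hP'⟩
        rw [un W b b' hW hP hP'])
    obtain ⟨b, rfl⟩ := loc U s fun x hx => by
      obtain ⟨W, h, hxW, t, hP⟩ := ex x hx
      exact ⟨W, h, hxW, t, (hs W h _ ⟨t, rfl, hP⟩).symm⟩
    exact ⟨b, fun W h t hP => inj W (by rw [nat, hs W h _ ⟨t, rfl, hP⟩])⟩

/-- The sheaf of morphisms from a presheaf of sets to a sheaf. -/
theorem IsSheafRes.hom (hG : IsSheafRes G q)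
    (comp : ∀ (U W Z : Opens X) (h : W ≤ U) (h' : Z ≤ W) (a : F U),
      r W Z h' (r U W h a) = r U Z (h'.trans h) a) :
    IsSheafRes (fun U => {φ : ∀ W : Set.Iic U, F W.1 → G W.1 //
        ∀ (W W' : Set.Iic U) (h : W'.1 ≤ W.1) (v : F W.1),
          q W.1 W'.1 h (φ W v) = φ W' (r W.1 W'.1 h v)})
      fun _ _ h φ => ⟨fun Z => φ.1 ⟨Z.1, Z.2.trans h⟩,
        fun Z Z' hZ v => φ.2 ⟨Z.1, Z.2.trans h⟩ ⟨Z'.1, Z'.2.trans h⟩ hZ v⟩ where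
  self _ _ := rfl
  comp _ _ _ _ _ _ := rfl
  sep U a b hab := by
    refine Subtype.ext (funext fun W => funext fun v => hG.sep W.1 _ _ fun x hx => ?_)
    obtain ⟨Z, hZ, hxZ, e⟩ := hab x (W.2 hx)
    refine ⟨W.1 ⊓ Z, inf_le_left, ⟨hx, hxZ⟩, ?_⟩
    rw [a.2 W ⟨W.1 ⊓ Z, Set.mem_Iic.2 (inf_le_left.trans W.2)⟩ inf_le_left,
      b.2 W ⟨W.1 ⊓ Z, Set.mem_Iic.2 (inf_le_left.trans W.2)⟩ inf_le_left]
    exact congrFun (congrFun (congrArg Subtype.val e) ⟨W.1 ⊓ Z, Set.mem_Iic.2 inf_le_right⟩) _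
  glue U P ex st un := by
    -- The glued morphism is determined pointwise: its value on `v` is glued from the values on
    -- restrictions of `v` of the local morphisms allowed by `P`.
    have key : ∀ (W : Set.Iic U) (v : F W.1), ∃ s : G W.1, ∀ (Z : Opens X) (h : Z ≤ W.1) φ,
        P Z φ → q W.1 Z h s = φ.1 ⟨Z, Set.mem_Iic.2 le_rfl⟩ (r W.1 Z h v) := by
      intro W v
      obtain ⟨s, hs⟩ := hG.glue W.1
        (fun Z t => ∃ (h : Z ≤ W.1) (φ : _) (_ : P Z φ), t = φ.1 ⟨Z, Set.mem_Iic.2 le_rfl⟩ (r W.1 Z h v))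
        (fun x hx => by
          obtain ⟨Z, hZ, hxZ, φ, hP⟩ := ex x (W.2 hx)
          exact ⟨W.1 ⊓ Z, inf_le_left, ⟨hx, hxZ⟩, _, inf_le_left, _,
            st Z (W.1 ⊓ Z) inf_le_right φ hP, rfl⟩)
        (by
          rintro Z Y h _ ⟨hZ, φ, hP, rfl⟩
          refine ⟨h.trans hZ, _, st Z Y h φ hP, ?_⟩
          rw [φ.2 ⟨Z, Set.mem_Iic.2 le_rfl⟩ ⟨Y, h⟩ h, comp])
        (by
          rintro Z _ _ hZ ⟨_, φ, hP, rfl⟩ ⟨_, ψ, hP', rfl⟩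
          rw [un Z φ ψ (hZ.trans W.2) hP hP'])
      exact ⟨s, fun Z h φ hP => hs Z h _ ⟨h, φ, hP, rfl⟩⟩
    choose s hs using key
    refine ⟨⟨s, fun W W' h v => hG.sep W'.1 _ _ fun x hx => ?_⟩, fun W h φ hP => ?_⟩
    · obtain ⟨Z, hZ, hxZ, φ, hP⟩ := ex x (W'.2 hx)
      have hP' := st Z (W'.1 ⊓ Z) inf_le_right φ hP
      refine ⟨W'.1 ⊓ Z, inf_le_left, ⟨hx, hxZ⟩, ?_⟩
      rw [hG.comp, hs W v _ _ _ hP', hs W' _ _ _ _ hP', comp]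
    · refine Subtype.ext (funext fun Z => funext fun v => ?_)
      have hP' := st W Z.1 Z.2 φ hP
      have e := hs ⟨Z.1, Z.2.trans h⟩ v Z.1 le_rfl _ hP'
      rw [hG.self] at e
      refine e.trans ?_
      change φ.1 ⟨Z.1, _⟩ (r Z.1 Z.1 le_rfl v) = φ.1 ⟨Z.1, _⟩ v
      rw [← φ.2 ⟨Z.1, Z.2⟩ ⟨Z.1, Z.2⟩ le_rfl v, hG.self]

/-- A member of `P` is chosen near each point. On an overlap the restrictions of two chosen members
both satisfy `P`, so they agree by uniqueness and the usual gluing axiom applies. -/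
theorem isSheafRes_of_isSheaf {C : Type*} [Category.{u} C] {FC : C → C → Type*}
    {CC : C → Type u} [∀ X Y, FunLike (FC X Y) (CC X) (CC Y)] [ConcreteCategory C FC]
    [Limits.HasLimitsOfSize.{u, u} C] [(forget C).ReflectsIsomorphisms]
    [Limits.PreservesLimitsOfSize.{u, u} (forget C)] (S : TopCat.Sheaf C X) :
    IsSheafRes (fun U => ToType (S.obj.obj (op U)))
      fun _ _ h a => (S.obj.map (homOfLE h).op) a where
  self U a := by
    change S.obj.map (𝟙 _) a = a
    rw [S.obj.map_id, ConcreteCategory.id_apply]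
  comp U W Z h h' a := by
    rw [← ConcreteCategory.comp_apply, ← S.obj.map_comp]
    rfl
  sep U a b hab := by
    choose W h hx e using hab
    refine S.eq_of_locally_eq' (fun x : U => W x.1 x.2) U (fun x => homOfLE (h x.1 x.2))
      (fun x hxU => Opens.mem_iSup.2 ⟨⟨x, hxU⟩, hx x hxU⟩) a b fun x => e x.1 x.2
  glue U P ex st un := by
    choose W h hx s hs using ex
    obtain ⟨t, ht, -⟩ := S.existsUnique_gluing' (fun x : U => W x.1 x.2) U
      (fun x => homOfLE (h x.1 x.2)) (fun x hxU => Opens.mem_iSup.2 ⟨⟨x, hxU⟩, hx x hxU⟩)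
      (fun x => s x.1 x.2)
      (fun x y => un _ _ _ (inf_le_left.trans (h _ _)) (st _ _ _ _ (hs _ _)) (st _ _ _ _ (hs _ _)))
    refine ⟨t, fun Z hZ a ha => ?_⟩
    -- A section `a` over `Z` in `P` need not be one of the chosen ones, but on each `Z ⊓ W x` both
    -- satisfy `P`, so `a` agrees there with the glued section.
    refine S.eq_of_locally_eq' (fun x : Z => Z ⊓ W x.1 (hZ x.2)) Z (fun x => homOfLE inf_le_left)
      (fun x hxZ => Opens.mem_iSup.2 ⟨⟨x, hxZ⟩, hxZ, hx x _⟩) _ _ fun x => ?_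
    have h1 := ht ⟨x.1, hZ x.2⟩
    refine un _ _ _ (inf_le_left.trans hZ) ?_ (st _ _ _ _ ha)
    have h2 := st _ (Z ⊓ W x.1 (hZ x.2)) inf_le_right _ (hs x.1 (hZ x.2))
    convert! h2 using 1
    change _ = S.obj.map (homOfLE _).op (s x.1 (hZ x.2))
    rw [← show _ = s x.1 (hZ x.2) from h1, ← ConcreteCategory.comp_apply,
      ← ConcreteCategory.comp_apply, ← S.obj.map_comp, ← S.obj.map_comp]
    rfl

/-- For a compatible family `s`, the predicate to glue is "restriction of some `s i`". Its
uniqueness clause is exactly compatibility on the intersections `U i ⊓ U j`. -/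
theorem IsSheafRes.isSheaf {C : Type*} [Category.{u} C] {FC : C → C → Type*}
    {CC : C → Type u} [∀ X Y, FunLike (FC X Y) (CC X) (CC Y)] [ConcreteCategory C FC]
    [Limits.HasLimitsOfSize.{u, u} C] [(forget C).ReflectsIsomorphisms]
    [Limits.PreservesLimitsOfSize.{u, u} (forget C)] (S : TopCat.Presheaf C X)
    (hS : IsSheafRes (fun U => ToType (S.obj (op U))) fun _ _ h a => (S.map (homOfLE h).op) a) :
    S.IsSheaf := by
  refine (TopCat.Presheaf.isSheaf_iff_isSheafUniqueGluing S).2 fun ι U s hs => ?_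
  obtain ⟨t, ht⟩ := hS.glue (iSup U)
    (fun W a => ∃ (i : ι) (h : W ≤ U i), a = S.map (homOfLE h).op (s i))
    (fun x hx => by
      obtain ⟨i, hi⟩ := Opens.mem_iSup.1 hx
      exact ⟨U i, le_iSup U i, hi, s i, i, le_rfl, (hS.self _ _).symm⟩)
    (by
      rintro W Z h _ ⟨i, hi, rfl⟩
      exact ⟨i, h.trans hi, hS.comp _ _ _ hi h (s i)⟩)
    (by
      rintro W _ _ - ⟨i, hi, rfl⟩ ⟨j, hj, rfl⟩
      have := congrArg (S.map (homOfLE (le_inf hi hj)).op) (hs i j)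
      exact (hS.comp _ _ _ inf_le_left (le_inf hi hj) (s i)).symm.trans
        (this.trans (hS.comp _ _ _ inf_le_right (le_inf hi hj) (s j))))
  have ht' : ∀ i, S.map (homOfLE (le_iSup U i)).op t = s i := fun i =>
    ht (U i) (le_iSup U i) (s i) ⟨i, le_rfl, (hS.self _ _).symm⟩
  refine ⟨t, ht', fun t' h' => hS.sep _ _ _ fun x hx => ?_⟩
  obtain ⟨i, hi⟩ := Opens.mem_iSup.1 hx
  exact ⟨U i, le_iSup U i, hi, (h' i).trans (ht' i).symm⟩

end Gluing

/-! ### Structure sheaves as sheaves of sets -/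

section Instances

variable {𝕜 : Type} [Field 𝕜] {X : TopCat.{u}} {O : FunctionSheaf 𝕜 X}

theorem FunctionSheaf.isSheafRes (O : FunctionSheaf 𝕜 X) :
    IsSheafRes O.sec fun _ _ h => O.res h :=
  isSheafRes_of_isSheaf O.sheaf

theorem SuperSheaf.isSheafRes (S : SuperSheaf O) : IsSheafRes S.sec fun _ _ h => S.res h :=
  isSheafRes_of_isSheaf S.sheaf

end Instances

end SuperGeometry

end


noncomputable section

namespace SuperGeometry

/-! ### Exterior algebras of free modules of rank two -/

/-- The ring `R ⊕ M ⊕ N` in which elements of `M` are multiplied by the pairing `B : M × M → N`,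
while `M * N = N * N = 0`. -/
@[ext]
structure PairingAlgebra {R M N : Type*} [CommRing R] [AddCommGroup M] [Module R M]
    [AddCommGroup N] [Module R N] (B : M →ₗ[R] M →ₗ[R] N) where
  /-- the scalar component -/
  fn : R
  /-- the linear component -/
  lin : M
  /-- the component in `N` -/
  top : N

namespace PairingAlgebra

variable {R M N : Type*} [CommRing R] [AddCommGroup M] [Module R M]
  [AddCommGroup N] [Module R N] {B : M →ₗ[R] M →ₗ[R] N}

instance : Zero (PairingAlgebra B) := ⟨⟨0, 0, 0⟩⟩
instance : One (PairingAlgebra B) := ⟨⟨1, 0, 0⟩⟩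
instance : Add (PairingAlgebra B) := ⟨fun a b => ⟨a.fn + b.fn, a.lin + b.lin, a.top + b.top⟩⟩
instance : Neg (PairingAlgebra B) := ⟨fun a => ⟨-a.fn, -a.lin, -a.top⟩⟩
instance : Mul (PairingAlgebra B) := ⟨fun a b => ⟨a.fn * b.fn, a.fn • b.lin + b.fn • a.lin,
  a.fn • b.top + b.fn • a.top + B a.lin b.lin⟩⟩

@[simp] theorem zero_fn : (0 : PairingAlgebra B).fn = 0 := rfl
@[simp] theorem zero_lin : (0 : PairingAlgebra B).lin = 0 := rfl
@[simp] theorem zero_top : (0 : PairingAlgebra B).top = 0 := rfl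
@[simp] theorem one_fn : (1 : PairingAlgebra B).fn = 1 := rfl
@[simp] theorem one_lin : (1 : PairingAlgebra B).lin = 0 := rfl
@[simp] theorem one_top : (1 : PairingAlgebra B).top = 0 := rfl

variable (a b : PairingAlgebra B)

@[simp] theorem add_fn : (a + b).fn = a.fn + b.fn := rfl
@[simp] theorem add_lin : (a + b).lin = a.lin + b.lin := rfl
@[simp] theorem add_top : (a + b).top = a.top + b.top := rfl
@[simp] theorem neg_fn : (-a).fn = -a.fn := rfl
@[simp] theorem neg_lin : (-a).lin = -a.lin := rfl
@[simp] theorem neg_top : (-a).top = -a.top := rfl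
@[simp] theorem mul_fn : (a * b).fn = a.fn * b.fn := rfl
@[simp] theorem mul_lin : (a * b).lin = a.fn • b.lin + b.fn • a.lin := rfl
@[simp] theorem mul_top :
    (a * b).top = a.fn • b.top + b.fn • a.top + B a.lin b.lin := rfl

instance : Ring (PairingAlgebra B) where
  add_assoc a b c := by ext <;> simp [add_assoc]
  zero_add a := by ext <;> simp
  add_zero a := by ext <;> simp
  add_comm a b := by ext <;> simp [add_comm]
  nsmul := nsmulRec
  zsmul := zsmulRec
  neg_add_cancel a := by ext <;> simp
  mul_assoc a b c := by
    ext
    · simp [mul_assoc]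
    · simp only [mul_lin, mul_fn]; module
    -- Both bracketings give the three terms in which a scalar part multiplies the pairing of the
    -- other two linear parts; triple products of linear parts vanish.
    · simp only [mul_top, mul_fn, mul_lin, map_add, map_smul, LinearMap.add_apply,
        LinearMap.smul_apply]
      module
  one_mul a := by ext <;> simp
  mul_one a := by ext <;> simp
  zero_mul a := by ext <;> simp
  mul_zero a := by ext <;> simp
  left_distrib a b c := by
    ext
    · simp [mul_add]
    · simp only [mul_lin, add_lin, add_fn]; module
    · simp only [mul_top, add_top, add_fn, add_lin, map_add]; module
  right_distrib a b c := by
    ext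
    · simp [add_mul]
    · simp only [mul_lin, add_lin, add_fn]; module
    · simp only [mul_top, add_top, add_fn, add_lin, map_add, LinearMap.add_apply]; module

/-- The embedding of the scalars. -/
def scalar (B : M →ₗ[R] M →ₗ[R] N) : R →+* PairingAlgebra B where
  toFun f := ⟨f, 0, 0⟩
  map_one' := rfl
  map_zero' := rfl
  map_mul' f g := by ext <;> simp
  map_add' f g := by ext <;> simp

@[simp] theorem scalar_fn (f : R) : (scalar B f).fn = f := rfl
@[simp] theorem scalar_lin (f : R) : (scalar B f).lin = 0 := rfl
@[simp] theorem scalar_top (f : R) : (scalar B f).top = 0 := rfl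

instance {k : Type*} [CommRing k] [Algebra k R] : Algebra k (PairingAlgebra B) :=
  ((scalar B).comp (algebraMap k R)).toAlgebra' fun c a => by
    ext <;> simp [mul_comm]

theorem algebraMap_eq {k : Type*} [CommRing k] [Algebra k R] (c : k) :
    algebraMap k (PairingAlgebra B) c = scalar B (algebraMap k R c) := rfl

@[simp] theorem smul_fn {k : Type*} [CommRing k] [Algebra k R] (c : k) : (c • a).fn = c • a.fn := by
  rw [Algebra.smul_def, Algebra.smul_def]; rfl

@[simp] theorem smul_lin {k : Type*} [CommRing k] [Algebra k R] (c : k) :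
    (c • a).lin = algebraMap k R c • a.lin := by
  rw [Algebra.smul_def, algebraMap_eq]; simp

@[simp] theorem smul_top {k : Type*} [CommRing k] [Algebra k R] (c : k) :
    (c • a).top = algebraMap k R c • a.top := by
  rw [Algebra.smul_def, algebraMap_eq]; simp

/-- The homomorphism from the exterior algebra defined by an alternating pairing. -/
def ofExterior (hB : ∀ m, B m m = 0) : ExteriorAlgebra R M →ₐ[R] PairingAlgebra B :=
  ExteriorAlgebra.lift R ⟨{ toFun := fun m => ⟨0, m, 0⟩
                            map_add' := fun m m' => by ext <;> simp
                            map_smul' := fun c m => by ext <;> simp },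
    fun m => by ext <;> simp [hB]⟩

theorem ofExterior_ι (hB : ∀ m, B m m = 0) (m : M) :
    ofExterior hB (ExteriorAlgebra.ι R m) = ⟨0, m, 0⟩ := by
  rw [ofExterior, ExteriorAlgebra.lift_ι_apply]; rfl

end PairingAlgebra

section Exterior

variable {R M : Type*} [CommRing R] [AddCommGroup M] [Module R M]

/-- The combination `a + bs + ct + dst` of elements of a ring, with coefficients in `R`. -/
def combination {A : Type*} [Ring A] (i : R → A) (s t : A) (p : R × R × R × R) : A :=
  i p.1 + i p.2.1 * s + i p.2.2.1 * t + i p.2.2.2 * (s * t)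

/-- The squares of `s` and `t` vanish and `ts = -st`, so only the determinant of the coefficients
survives. This is the source both of `a² = 0` for odd `a` and of the match with `∧` below. -/
theorem linear_mul_linear {A : Type*} [Ring A] (i : R →+* A) {s t : A}
    (comm : ∀ r a, i r * a = a * i r) (hs : s * s = 0) (ht : t * t = 0) (hst : t * s = -(s * t))
    (a b c d : R) : (i a * s + i b * t) * (i c * s + i d * t) = i (a * d - b * c) * (s * t) := by
  have key : ∀ (f g : R) (s t : A), i f * s * (i g * t) = i (f * g) * (s * t) := by
    intro f g s t
    rw [mul_assoc, ← mul_assoc s, ← comm g s, map_mul]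
    simp only [mul_assoc]
  rw [add_mul, mul_add, mul_add, key, key, key, key, hs, ht, hst, mul_zero, mul_zero, map_sub,
    sub_mul, mul_neg]
  abel

-- The elements `1, b₀, b₁, b₀b₁` form a basis. Independence is seen in the concrete ring
-- `PairingAlgebra` for the determinant pairing, where the four coefficients can be read off. They
-- span because their combinations contain the generators and are closed under products.
open ExteriorAlgebra in
theorem exterior_combination_bijective (b : Module.Basis (Fin 2) R M) :
    Function.Bijective (combination (algebraMap R (ExteriorAlgebra R M))
      (ι R (b 0)) (ι R (b 1))) := by
  -- The determinant in the basis `b`, normalised by `B (b 0) (b 1) = 1`, so that the top component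
  -- is the coefficient of `b₀b₁`.
  let B : M →ₗ[R] M →ₗ[R] R := LinearMap.mk₂ R
    (fun m m' => b.coord 0 m * b.coord 1 m' - b.coord 1 m * b.coord 0 m')
    (fun _ _ _ => by simp only [map_add]; ring) (fun _ _ _ => by simp only [map_smul, smul_eq_mul]; ring)
    (fun _ _ _ => by simp only [map_add]; ring) (fun _ _ _ => by simp only [map_smul, smul_eq_mul]; ring)
  have hB : ∀ m, B m m = 0 := fun m => by simp only [B, LinearMap.mk₂_apply]; ring
  have sq0 : ∀ m : M, ι R m * ι R m = 0 := ι_sq_zero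
  have anti : ι R (b 1) * ι R (b 0) = -(ι R (b 0) * ι R (b 1)) := by
    rw [eq_neg_iff_add_eq_zero, ι_add_mul_swap]
  constructor
  · have h1 : ∀ p : R × R × R × R, PairingAlgebra.ofExterior hB
        (combination (algebraMap R (ExteriorAlgebra R M)) (ι R (b 0)) (ι R (b 1)) p) =
        ⟨p.1, p.2.1 • b 0 + p.2.2.1 • b 1, p.2.2.2⟩ := by
      intro p
      simp only [combination, map_add, map_mul, PairingAlgebra.ofExterior_ι, AlgHom.commutes,
        PairingAlgebra.algebraMap_eq]
      ext <;> simp [B]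
    intro p p' hp
    have h2 := congrArg (PairingAlgebra.ofExterior hB) hp
    rw [h1, h1, PairingAlgebra.mk.injEq] at h2
    obtain ⟨e1, e2, e3⟩ := h2
    have e4 := congrArg (b.coord 0) e2
    have e5 := congrArg (b.coord 1) e2
    simp at e4 e5
    exact Prod.ext e1 (Prod.ext e4 (Prod.ext e5 e3))
  · intro a
    induction a using ExteriorAlgebra.induction with
    | algebraMap f => exact ⟨(f, 0, 0, 0), by simp [combination]⟩
    | ι m =>
      refine ⟨(0, b.coord 0 m, b.coord 1 m, 0), ?_⟩
      conv_rhs => rw [← b.sum_repr m, Fin.sum_univ_two, map_add, map_smul, map_smul]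
      simp only [combination, ← Algebra.smul_def, map_zero, zero_add, zero_mul, add_zero]
      rfl
    | add a a' h h' =>
      obtain ⟨p, rfl⟩ := h
      obtain ⟨p', rfl⟩ := h'
      refine ⟨p + p', ?_⟩
      simp only [combination, Prod.fst_add, Prod.snd_add, map_add, add_mul]
      abel
    | mul a a' h h' =>
      obtain ⟨⟨x, y, z, w⟩, rfl⟩ := h
      obtain ⟨⟨x', y', z', w'⟩, rfl⟩ := h'
      -- The last coefficient collects scalar times top and the determinant `yz' - zy'` of the
      -- linear parts.
      refine ⟨(x * x', x * y' + x' * y, x * z' + x' * z, x * w' + x' * w + y * z' - z * y'), ?_⟩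
      have e1 : ι R (b 0) * (ι R (b 0) * ι R (b 1)) = 0 := by rw [← mul_assoc, sq0, zero_mul]
      have e2 : ι R (b 0) * ι R (b 1) * ι R (b 1) = 0 := by rw [mul_assoc, sq0, mul_zero]
      have e3 : ι R (b 1) * (ι R (b 0) * ι R (b 1)) = 0 := by
        rw [← mul_assoc, anti, neg_mul, mul_assoc, sq0, mul_zero, neg_zero]
      have e4 : ι R (b 0) * ι R (b 1) * ι R (b 0) = 0 := by
        rw [mul_assoc, anti, mul_neg, e1, neg_zero]
      have e5 : ι R (b 0) * ι R (b 1) * (ι R (b 0) * ι R (b 1)) = 0 := by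
        rw [mul_assoc, e3, mul_zero]
      simp only [combination, Algebra.algebraMap_eq_smul_one, mul_add, add_mul, smul_mul_assoc,
        mul_smul_comm, one_mul, mul_one, e1, e2, e3, e4, e5, sq0, anti, smul_zero]
      module

/-- A criterion for a ring to be the exterior algebra of a free module of rank two. -/
theorem exists_exterior_ringEquiv (b : Module.Basis (Fin 2) R M) {A : Type*} [Ring A]
    (i : R →+* A) (j : M →+ A) (comm : ∀ r a, i r * a = a * i r)
    (smul : ∀ r m, j (r • m) = i r * j m) (sq : ∀ m, j m * j m = 0)
    (hb : Function.Bijective (combination i (j (b 0)) (j (b 1)))) :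
    ∃ Φ : ExteriorAlgebra R M ≃+* A, (∀ f, Φ (algebraMap _ _ f) = i f) ∧
      ∀ m, Φ (ExteriorAlgebra.ι R m) = j m := by
  let _ : Algebra R A := i.toAlgebra' comm
  let Φ : ExteriorAlgebra R M →ₐ[R] A := ExteriorAlgebra.lift R
    ⟨{ toFun := j, map_add' := j.map_add, map_smul' := fun r m => by
        rw [smul]; rfl }, sq⟩
  have h1 : ∀ m, Φ (ExteriorAlgebra.ι R m) = j m := fun m => by
    simp only [Φ, ExteriorAlgebra.lift_ι_apply]; rfl
  have h0 : ∀ f, Φ (algebraMap _ _ f) = i f := fun f => Φ.commutes f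
  have h2 : Function.Bijective Φ := by
    -- `Φ` carries normal forms in the exterior algebra to normal forms in `A`; both
    -- parametrisations by `R⁴` are bijective, hence so is `Φ`.
    have e := exterior_combination_bijective b
    refine (Function.Bijective.of_comp_iff Φ e).1 ?_
    convert hb using 1
    funext p
    simp only [Function.comp, combination, map_add, map_mul, h1, h0]
  exact ⟨RingEquiv.ofBijective Φ h2, h0, h1⟩

end Exterior

end SuperGeometry

end


noncomputable section

namespace SuperGeometry

variable {𝕜 : Type} [Field 𝕜] {X : TopCat.{u}} {O : FunctionSheaf 𝕜 X}

namespace SuperSheaf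

/-! ### Parity -/

section Parity

variable (S : SuperSheaf O) {U W : Opens X}

theorem isCompl_part (U : Opens X) : IsCompl (S.part U 0) (S.part U 1) :=
  (S.isInternal U).isCompl (by decide) (by
    refine (Set.eq_univ_of_forall fun i => ?_).symm
    fin_cases i
    · exact Or.inl rfl
    · exact Or.inr rfl)

theorem res_self (a : S.sec U) : S.res le_rfl a = a := S.isSheafRes.self U a

theorem res_mem (h : W ≤ U) {i : ZMod 2} {a : S.sec U} (ha : a ∈ S.part U i) :
    S.res h a ∈ S.part W i := S.map_mem h i a ha

theorem red_res (h : W ≤ U) (a : S.sec U) : S.red W (S.res h a) = O.res h (S.red U a) :=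
  S.red_map h a

theorem exists_parts (a : S.sec U) :
    ∃ a₀ ∈ S.part U 0, ∃ a₁ ∈ S.part U 1, a₀ + a₁ = a :=
  Submodule.mem_sup.1 ((S.isCompl_part U).sup_eq_top ▸ Submodule.mem_top)

variable {S}

theorem eq_zero_of_even_of_odd {a : S.sec U} (h₀ : a ∈ S.part U 0) (h₁ : a ∈ S.part U 1) :
    a = 0 :=
  (Submodule.disjoint_def.1 (S.isCompl_part U).disjoint) a h₀ h₁

theorem parts_unique {a₀ a₁ b₀ b₁ : S.sec U} (ha₀ : a₀ ∈ S.part U 0) (ha₁ : a₁ ∈ S.part U 1)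
    (hb₀ : b₀ ∈ S.part U 0) (hb₁ : b₁ ∈ S.part U 1) (h : a₀ + a₁ = b₀ + b₁) :
    a₀ = b₀ ∧ a₁ = b₁ := by
  have e : a₀ - b₀ = b₁ - a₁ := by rw [sub_eq_sub_iff_add_eq_add, h, add_comm]
  have h0 : a₀ - b₀ = 0 :=
    eq_zero_of_even_of_odd (sub_mem ha₀ hb₀) (e ▸ sub_mem hb₁ ha₁)
  exact ⟨sub_eq_zero.1 h0, (sub_eq_zero.1 (e ▸ h0)).symm⟩

theorem even_mul_even {a b : S.sec U} (ha : a ∈ S.part U 0) (hb : b ∈ S.part U 0) :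
    a * b ∈ S.part U 0 := (S.gradedMonoid U).mul_mem ha hb

theorem even_mul_odd {a b : S.sec U} (ha : a ∈ S.part U 0) (hb : b ∈ S.part U 1) :
    a * b ∈ S.part U 1 := (S.gradedMonoid U).mul_mem ha hb

theorem odd_mul_odd {a b : S.sec U} (ha : a ∈ S.part U 1) (hb : b ∈ S.part U 1) :
    a * b ∈ S.part U 0 := (S.gradedMonoid U).mul_mem ha hb

theorem even_mul_comm {a : S.sec U} (ha : a ∈ S.part U 0) (b : S.sec U) : a * b = b * a := by
  obtain ⟨b₀, h₀, b₁, h₁, rfl⟩ := S.exists_parts b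
  have e0 := S.supercomm U 0 0 a b₀ ha h₀
  have e1 := S.supercomm U 0 1 a b₁ ha h₁
  simp only [ZMod.val_zero, zero_mul, pow_zero, one_mul] at e0 e1
  rw [mul_add, add_mul, e0, e1]

theorem odd_mul_swap {a b : S.sec U} (ha : a ∈ S.part U 1) (hb : b ∈ S.part U 1) :
    a * b = -(b * a) := by
  have e := S.supercomm U 1 1 a b ha hb
  have h1 : (1 : ZMod 2).val = 1 := rfl
  rwa [h1, mul_one, pow_one, neg_one_mul] at e

variable (S) in
/-- The even nilpotent superfunctions. -/
def evenNil (U : Opens X) : Submodule 𝕜 (S.sec U) :=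
  S.part U 0 ⊓ LinearMap.ker (S.red U).toLinearMap

theorem mem_evenNil {a : S.sec U} : a ∈ S.evenNil U ↔ a ∈ S.part U 0 ∧ S.red U a = 0 := Iff.rfl

theorem res_evenNil (h : W ≤ U) {a : S.sec U} (ha : a ∈ S.evenNil U) : S.res h a ∈ S.evenNil W :=
  ⟨S.res_mem h ha.1, show S.red W (S.res h a) = 0 by rw [red_res, show S.red U a = 0 from ha.2, map_zero]⟩

theorem odd_mul_odd_evenNil {a b : S.sec U} (ha : a ∈ S.part U 1) (hb : b ∈ S.part U 1) :
    a * b ∈ S.evenNil U :=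
  mem_evenNil.2 ⟨odd_mul_odd ha hb, by rw [map_mul, S.red_odd U a ha, zero_mul]⟩

/-- The parity of a section is a local condition. -/
theorem mem_part_of_locally (i : ZMod 2) (a : S.sec U)
    (loc : ∀ x ∈ U, ∃ (W : Opens X) (h : W ≤ U), x ∈ W ∧ S.res h a ∈ S.part W i) :
    a ∈ S.part U i := by
  obtain ⟨a₀, h₀, a₁, h₁, rfl⟩ := S.exists_parts a
  fin_cases i
  -- The component of the wrong parity vanishes locally, hence globally.
  · have : a₁ = 0 := S.isSheafRes.sep U _ _ fun x hx => by
      obtain ⟨W, h, hxW, hW⟩ := loc x hx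
      refine ⟨W, h, hxW, ?_⟩
      rw [map_zero]
      refine eq_zero_of_even_of_odd ?_ (S.res_mem h h₁)
      rw [map_add] at hW
      exact (Submodule.add_mem_iff_right _ (S.res_mem h h₀)).1 hW
    rw [this, add_zero]
    exact h₀
  · have : a₀ = 0 := S.isSheafRes.sep U _ _ fun x hx => by
      obtain ⟨W, h, hxW, hW⟩ := loc x hx
      refine ⟨W, h, hxW, ?_⟩
      rw [map_zero]
      refine eq_zero_of_even_of_odd (S.res_mem h h₀) ?_
      rw [map_add] at hW
      exact (Submodule.add_mem_iff_left _ (S.res_mem h h₁)).1 hW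
    rw [this, zero_add]
    exact h₁

theorem isSheafRes_odd (S : SuperSheaf O) :
    IsSheafRes (fun U => S.part U 1) fun _ _ h a => ⟨S.res h a.1, S.res_mem h a.2⟩ :=
  S.isSheafRes.subtype (fun U a => a ∈ S.part U 1) (fun _ _ h _ ha => S.res_mem h ha)
    fun _ a loc => mem_part_of_locally 1 a loc

theorem mem_evenNil_of_locally (a : S.sec U)
    (loc : ∀ x ∈ U, ∃ (W : Opens X) (h : W ≤ U), x ∈ W ∧ S.res h a ∈ S.evenNil W) :
    a ∈ S.evenNil U :=
  mem_evenNil.2 ⟨mem_part_of_locally 0 a fun x hx => by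
      obtain ⟨W, h, hxW, hW⟩ := loc x hx
      exact ⟨W, h, hxW, hW.1⟩, O.isSheafRes.sep U _ _ fun x hx => by
      obtain ⟨W, h, hxW, hW⟩ := loc x hx
      exact ⟨W, h, hxW, by rw [← red_res, (mem_evenNil.1 hW).2, map_zero]⟩⟩

theorem isSheafRes_evenNil (S : SuperSheaf O) :
    IsSheafRes (fun U => S.evenNil U) fun _ _ h a => ⟨S.res h a.1, res_evenNil h a.2⟩ :=
  S.isSheafRes.subtype (fun U a => a ∈ S.evenNil U) (fun _ _ h _ ha => res_evenNil h ha)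
    fun _ a loc => mem_evenNil_of_locally a loc

end Parity

/-! ### Normal forms of superfunctions in odd dimension two -/

section NormalForm

variable {S : SuperSheaf O} {U W : Opens X}

/-- Superfunctions on `W` are uniquely of the form `a + bs + ct + dst` with functions `a`, `b`,
`c`, `d`, embedded by `i`, and odd coordinates `s`, `t`. -/
structure NormalForm (S : SuperSheaf O) (W : Opens X) (i : O.sec W →+* S.sec W)
    (s t : S.sec W) : Prop where
  even : ∀ f, i f ∈ S.part W 0
  red : ∀ f, S.red W (i f) = f
  odd_left : s ∈ S.part W 1
  odd_right : t ∈ S.part W 1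
  sq_left : s * s = 0
  sq_right : t * t = 0
  bijective : Function.Bijective (combination i s t)

theorem OddCoordinates.normalForm (χ : S.OddCoordinates 2 U) (h : W ≤ U) :
    S.NormalForm W (χ.emb W h : O.sec W →+* S.sec W) (S.res h (χ.θ 0)) (S.res h (χ.θ 1)) := by
  obtain ⟨Φ, h0, h1⟩ := χ.isExterior W h
  have sq : ∀ j, S.res h (χ.θ j) * S.res h (χ.θ j) = 0 := fun j => by
    rw [← h1, ← map_mul, ExteriorAlgebra.ι_sq_zero, map_zero]
  refine ⟨χ.emb_even W h, χ.red_emb W h, S.res_mem h (χ.odd 0), S.res_mem h (χ.odd 1), sq 0, sq 1,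
    ?_⟩
  have := Φ.bijective.comp
    (exterior_combination_bijective (Pi.basisFun (O.sec W) (Fin 2)))
  convert this using 1
  funext p
  simp only [combination, Function.comp, map_add, map_mul, h0, h1, Pi.basisFun_apply]
  rfl

variable (S) in
/-- Superfunctions on `W` have a normal form. -/
def IsNormal (W : Opens X) : Prop := ∃ i s t, S.NormalForm W i s t

theorem IsSupermanifold.exists_isNormal (hS : S.IsSupermanifold 2) {x : X} (hx : x ∈ U) :
    ∃ (W : Opens X) (_ : W ≤ U), x ∈ W ∧ ∀ Z ≤ W, S.IsNormal Z := by
  obtain ⟨W, hW, ⟨χ⟩⟩ := hS x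
  exact ⟨U ⊓ W, inf_le_left, ⟨hx, hW⟩, fun Z hZ =>
    ⟨_, _, _, χ.normalForm (hZ.trans inf_le_right)⟩⟩

namespace NormalForm

variable {i : O.sec W →+* S.sec W} {s t : S.sec W} (N : S.NormalForm W i s t)

include N

theorem exists_of_even {a : S.sec W} (ha : a ∈ S.part W 0) : ∃ f g, a = i f + i g * (s * t) := by
  obtain ⟨⟨x, y, z, w⟩, h⟩ := N.bijective.2 a
  refine ⟨x, w, ?_⟩
  -- In the normal form of an even element the part linear in `s, t` is odd, so uniqueness of the
  -- decomposition by parity removes it.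
  refine (parts_unique (b₁ := i y * s + i z * t) ha (zero_mem _) ?_ ?_ ?_).1
  · exact add_mem (N.even x) (even_mul_even (N.even w) (odd_mul_odd N.odd_left N.odd_right))
  · exact add_mem (even_mul_odd (N.even y) N.odd_left) (even_mul_odd (N.even z) N.odd_right)
  · rw [add_zero, ← h]
    simp only [combination]
    abel

theorem exists_of_odd {a : S.sec W} (ha : a ∈ S.part W 1) : ∃ f g, a = i f * s + i g * t := by
  obtain ⟨⟨x, y, z, w⟩, h⟩ := N.bijective.2 a
  refine ⟨y, z, ?_⟩
  refine (parts_unique (b₀ := i x + i w * (s * t)) (zero_mem _) ha ?_ ?_ ?_).2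
  · exact add_mem (N.even x) (even_mul_even (N.even w) (odd_mul_odd N.odd_left N.odd_right))
  · exact add_mem (even_mul_odd (N.even y) N.odd_left) (even_mul_odd (N.even z) N.odd_right)
  · rw [zero_add, ← h]
    simp only [combination]
    abel

theorem exists_of_evenNil {a : S.sec W} (ha : a ∈ S.evenNil W) : ∃ g, a = i g * (s * t) := by
  obtain ⟨f, g, rfl⟩ := N.exists_of_even ha.1
  have h := (mem_evenNil.1 ha).2
  rw [map_add, N.red, map_mul, map_mul, S.red_odd W s N.odd_left, zero_mul, mul_zero,
    add_zero] at h
  exact ⟨g, by rw [h, map_zero, zero_add]⟩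

theorem prod_mul_odd {a : S.sec W} (ha : a ∈ S.part W 1) : s * t * a = 0 := by
  obtain ⟨f, g, rfl⟩ := N.exists_of_odd ha
  have e1 : s * t * s = 0 := by
    rw [mul_assoc, odd_mul_swap N.odd_right N.odd_left, mul_neg, ← mul_assoc, N.sq_left, zero_mul,
      neg_zero]
  have e2 : s * t * t = 0 := by rw [mul_assoc, N.sq_right, mul_zero]
  rw [mul_add, even_mul_comm (N.even f), even_mul_comm (N.even g), ← mul_assoc, ← mul_assoc,
    e1, e2, zero_mul, zero_mul, add_zero]

/-- This is `J²·J = 0`: an even nilpotent element is a multiple of `st`, which kills odd elements,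
and therefore also every other multiple of `st`. -/
theorem evenNil_mul {a b : S.sec W} (ha : a ∈ S.evenNil W) (hb : S.red W b = 0) : a * b = 0 := by
  obtain ⟨g, rfl⟩ := N.exists_of_evenNil ha
  obtain ⟨b₀, h₀, b₁, h₁, rfl⟩ := S.exists_parts b
  rw [map_add, S.red_odd W b₁ h₁, add_zero] at hb
  obtain ⟨f, rfl⟩ := N.exists_of_evenNil (mem_evenNil.2 ⟨h₀, hb⟩)
  rw [mul_assoc, mul_add, N.prod_mul_odd h₁, ← mul_assoc (i f), ← mul_assoc (s * t),
    N.prod_mul_odd (even_mul_odd (N.even f) N.odd_left), zero_mul, add_zero, mul_zero]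

theorem odd_sq {a : S.sec W} (ha : a ∈ S.part W 1) : a * a = 0 := by
  obtain ⟨f, g, rfl⟩ := N.exists_of_odd ha
  rw [linear_mul_linear i (fun r => even_mul_comm (N.even r)) N.sq_left N.sq_right
    (odd_mul_swap N.odd_right N.odd_left), mul_comm, sub_self, map_zero, zero_mul]

/-- The even part of such an element is `g·st = (gs)·t`, which lies in the ideal generated by the
odd functions, as does the odd part. -/
theorem mem_of_red_eq_zero {a : S.sec W} (ha : S.red W a = 0) :
    a ∈ (⊤ : Submodule 𝕜 (S.sec W)) * S.part W 1 := by
  obtain ⟨a₀, h₀, a₁, h₁, rfl⟩ := S.exists_parts a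
  rw [map_add, S.red_odd W a₁ h₁, add_zero] at ha
  obtain ⟨g, rfl⟩ := N.exists_of_evenNil (mem_evenNil.2 ⟨h₀, ha⟩)
  refine add_mem ?_ ?_
  · rw [← mul_assoc]
    exact Submodule.mul_mem_mul trivial N.odd_right
  · rw [← one_mul a₁]
    exact Submodule.mul_mem_mul trivial h₁

theorem mem_of_evenNil {a : S.sec W} (ha : a ∈ S.evenNil W) :
    a ∈ ((⊤ : Submodule 𝕜 (S.sec W)) * S.part W 1) ^ 2 := by
  obtain ⟨g, rfl⟩ := N.exists_of_evenNil ha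
  rw [← mul_assoc, pow_two, ← one_mul t]
  exact Submodule.mul_mem_mul (Submodule.mul_mem_mul trivial N.odd_left)
    (Submodule.mul_mem_mul trivial N.odd_right)

/-- Even nilpotent parts annihilate nilpotents, so only the product of the two odd parts is left. -/
theorem mul_mem_evenNil {a b : S.sec W} (ha : S.red W a = 0) (hb : S.red W b = 0) :
    a * b ∈ S.evenNil W := by
  obtain ⟨a₀, h₀, a₁, h₁, rfl⟩ := S.exists_parts a
  obtain ⟨b₀, k₀, b₁, k₁, rfl⟩ := S.exists_parts b
  have ha' := ha
  have hb' := hb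
  rw [map_add, S.red_odd W a₁ h₁, add_zero] at ha'
  rw [map_add, S.red_odd W b₁ k₁, add_zero] at hb'
  have e : (a₀ + a₁) * (b₀ + b₁) = a₁ * b₁ := by
    rw [add_mul, N.evenNil_mul (mem_evenNil.2 ⟨h₀, ha'⟩) hb, zero_add, mul_add,
      ← even_mul_comm k₀, N.evenNil_mul (mem_evenNil.2 ⟨k₀, hb'⟩) (S.red_odd W a₁ h₁), zero_add]
  rw [e]
  exact odd_mul_odd_evenNil h₁ k₁

end NormalForm

theorem red_eq_zero_of_mem {a : S.sec W} (ha : a ∈ (⊤ : Submodule 𝕜 (S.sec W)) * S.part W 1) :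
    S.red W a = 0 := by
  refine Submodule.mul_induction_on ha (fun m _ n hn => ?_) fun x y hx hy => ?_
  · rw [map_mul, S.red_odd W n hn, mul_zero]
  · rw [map_add, hx, hy, add_zero]

theorem NormalForm.evenNil_of_mem {i : O.sec W →+* S.sec W} {s t : S.sec W}
    (N : S.NormalForm W i s t) {a : S.sec W}
    (ha : a ∈ ((⊤ : Submodule 𝕜 (S.sec W)) * S.part W 1) ^ 2) : a ∈ S.evenNil W := by
  rw [pow_two] at ha
  exact Submodule.mul_induction_on ha
    (fun m hm n hn => N.mul_mem_evenNil (red_eq_zero_of_mem hm) (red_eq_zero_of_mem hn))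
    fun x y hx hy => add_mem hx hy

theorem NormalForm.eq_zero_of_mem {i : O.sec W →+* S.sec W} {s t : S.sec W}
    (N : S.NormalForm W i s t) {a : S.sec W}
    (ha : a ∈ ((⊤ : Submodule 𝕜 (S.sec W)) * S.part W 1) ^ 3) : a = 0 := by
  rw [pow_succ] at ha
  exact Submodule.mul_induction_on ha
    (fun m hm n hn => N.evenNil_mul (N.evenNil_of_mem hm) (red_eq_zero_of_mem hn))
    fun x y hx hy => by rw [hx, hy, add_zero]

namespace IsSupermanifold

variable (hS : S.IsSupermanifold 2)

include hS

theorem evenNil_mul {a b : S.sec U} (ha : a ∈ S.evenNil U) (hb : S.red U b = 0) : a * b = 0 := by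
  refine S.isSheafRes.sep U _ _ fun x hx => ?_
  obtain ⟨W, h, hxW, hW⟩ := hS.exists_isNormal hx
  obtain ⟨i, s, t, N⟩ := hW W le_rfl
  exact ⟨W, h, hxW, by
    rw [map_mul, map_zero, N.evenNil_mul (res_evenNil h ha) (by rw [red_res, hb, map_zero])]⟩

theorem odd_sq {a : S.sec U} (ha : a ∈ S.part U 1) : a * a = 0 := by
  refine S.isSheafRes.sep U _ _ fun x hx => ?_
  obtain ⟨W, h, hxW, hW⟩ := hS.exists_isNormal hx
  obtain ⟨i, s, t, N⟩ := hW W le_rfl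
  exact ⟨W, h, hxW, by rw [map_mul, map_zero, N.odd_sq (S.res_mem h ha)]⟩

/-- The filtration is made explicit here and in `mem_J_two` and `eq_zero_of_mem_J_three`: it is the
kernel of reduction, then its even part, then zero. Since the powers of `J` are defined by local
membership, the statements follow from those about normal forms near each point. -/
theorem mem_J_one {a : S.sec U} : a ∈ S.J 1 U ↔ S.red U a = 0 := by
  constructor
  · intro ha
    refine O.isSheafRes.sep U _ _ fun x hx => ?_
    obtain ⟨W, h, hxW, hW⟩ := ha x hx
    rw [pow_one] at hW
    exact ⟨W, h, hxW, by rw [← red_res, red_eq_zero_of_mem hW, map_zero]⟩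
  · intro ha x hx
    obtain ⟨W, h, hxW, hW⟩ := hS.exists_isNormal hx
    obtain ⟨i, s, t, N⟩ := hW W le_rfl
    refine ⟨W, h, hxW, ?_⟩
    rw [pow_one]
    exact N.mem_of_red_eq_zero (by rw [red_res, ha, map_zero])

/-- Algebraic membership in the power of the ideal survives shrinking, so it can be had on a
neighbourhood where normal forms exist. -/
theorem exists_normal_of_mem_J {k : ℕ} {a : S.sec U} (ha : a ∈ S.J k U) {x : X} (hx : x ∈ U) :
    ∃ (W : Opens X) (h : W ≤ U), x ∈ W ∧ S.IsNormal W ∧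
      S.res h a ∈ ((⊤ : Submodule 𝕜 (S.sec W)) * S.part W 1) ^ k := by
  obtain ⟨W, h, hxW, hW⟩ := ha x hx
  obtain ⟨Z, hZ, hxZ, hn⟩ := hS.exists_isNormal hxW
  refine ⟨Z, hZ.trans h, hxZ, hn Z le_rfl, ?_⟩
  rw [← S.res_res h hZ]
  refine (?_ : Submodule.map (S.res hZ).toLinearMap _ ≤ _) ⟨_, hW, rfl⟩
  rw [Submodule.map_pow, Submodule.map_mul]
  refine pow_le_pow_left' (mul_le_mul' le_top ?_) k
  rintro _ ⟨b, hb, rfl⟩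
  exact S.res_mem hZ hb

theorem mem_J_two {a : S.sec U} : a ∈ S.J 2 U ↔ a ∈ S.evenNil U := by
  constructor
  · intro ha
    refine mem_evenNil_of_locally a fun x hx => ?_
    obtain ⟨W, h, hxW, ⟨i, s, t, N⟩, hW⟩ := hS.exists_normal_of_mem_J ha hx
    exact ⟨W, h, hxW, N.evenNil_of_mem hW⟩
  · intro ha x hx
    obtain ⟨W, h, hxW, hW⟩ := hS.exists_isNormal hx
    obtain ⟨i, s, t, N⟩ := hW W le_rfl
    exact ⟨W, h, hxW, N.mem_of_evenNil (res_evenNil h ha)⟩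

theorem eq_zero_of_mem_J_three {a : S.sec U} (ha : a ∈ S.J 3 U) : a = 0 := by
  refine S.isSheafRes.sep U _ _ fun x hx => ?_
  obtain ⟨W, h, hxW, ⟨i, s, t, N⟩, hW⟩ := hS.exists_normal_of_mem_J ha hx
  exact ⟨W, h, hxW, by rw [N.eq_zero_of_mem hW, map_zero]⟩

end IsSupermanifold

end NormalForm

end SuperSheaf

end SuperGeometry

end


noncomputable section

namespace SuperGeometry

variable {𝕜 : Type} [Field 𝕜] {X : TopCat.{u}} {O : FunctionSheaf 𝕜 X}

namespace ModuleSheaf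

variable (V : ModuleSheaf O) {U W Z : Opens X}

/-! ### Linear and alternating forms -/

instance (U : Opens X) : AddCommGroup (V.dual U) := AddSubgroup.toAddCommGroup _

instance (U : Opens X) : AddCommMonoid (V.dual U) := AddCommGroup.toAddCommMonoid

variable {V} in
theorem dual_ext {φ ψ : V.dual U}
    (h : ∀ (W : Opens X) (h : W ≤ U) (v : V.sec W), V.ev h φ v = V.ev h ψ v) : φ = ψ :=
  Subtype.ext (funext fun W => LinearMap.ext (h W.1 W.2))

section Evaluation

variable (h : W ≤ U) (φ ψ : V.dual U) (v w : V.sec W) (f : O.sec U) (g : O.sec W)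

theorem res_ev (h' : Z ≤ W) :
    O.res h' (V.ev h φ v) = V.ev (h'.trans h) φ (V.res h' v) :=
  φ.2 ⟨W, h⟩ ⟨Z, h'.trans h⟩ h' v

theorem ev_dualRes (h' : Z ≤ W) (v : V.sec Z) :
    V.ev h' (V.dualRes h φ) v = V.ev (h'.trans h) φ v := rfl

theorem ev_add : V.ev h (φ + ψ) v = V.ev h φ v + V.ev h ψ v := rfl

theorem ev_smul : V.ev h (f • φ) v = O.res h f * V.ev h φ v := rfl

theorem ev_map_add : V.ev h φ (v + w) = V.ev h φ v + V.ev h φ w := map_add _ _ _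

theorem ev_map_smul : V.ev h φ (g • v) = g * V.ev h φ v := map_smul _ _ _

theorem dualRes_smul : V.dualRes h (f • φ) = O.res h f • V.dualRes h φ := by
  refine dual_ext fun Z hZ v => ?_
  rw [ev_dualRes, ev_smul, ev_smul, O.res_res, ev_dualRes]

end Evaluation

/-- Morphisms of sheaves of sets `V → O` form a sheaf, and linearity is an identity between sections
of `O`, hence a local condition. -/
theorem isSheafRes_dual : IsSheafRes (fun U => V.dual U) fun _ _ h => V.dualRes h := by
  refine (IsSheafRes.hom (F := V.sec) (r := fun _ _ h => V.res h) O.isSheafRes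
    fun _ _ _ h h' v => V.res_res h h' v).of_injective
    (fun U φ => ⟨fun W => φ.1 W, φ.2⟩) (fun U φ ψ e => dual_ext fun W h v =>
      congrFun (congrFun (congrArg Subtype.val e) ⟨W, h⟩) v) (fun _ _ _ _ => rfl) fun U a loc => ?_
  -- Near each point the map is given by a linear one, which is all that the local verification of
  -- linearity uses.
  have loc' : ∀ (W : Set.Iic U), ∀ x ∈ W.1, ∃ (Z : Opens X) (h : Z ≤ W.1), x ∈ Z ∧
      ∃ b : V.sec Z →ₗ[O.sec Z] O.sec Z, ∀ v, O.res h (a.1 W v) = b (V.res h v) := by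
    intro W x hx
    obtain ⟨Z, h, hxZ, b, hb⟩ := loc x (W.2 hx)
    refine ⟨W.1 ⊓ Z, inf_le_left, ⟨hx, hxZ⟩, b.1 ⟨W.1 ⊓ Z, Set.mem_Iic.2 inf_le_right⟩,
      fun v => ?_⟩
    rw [a.2 W ⟨W.1 ⊓ Z, Set.mem_Iic.2 (inf_le_left.trans W.2)⟩ inf_le_left v]
    exact (congrFun (congrFun (congrArg Subtype.val hb)
      ⟨W.1 ⊓ Z, Set.mem_Iic.2 inf_le_right⟩) _).symm
  refine ⟨⟨fun W => { toFun := a.1 W, map_add' := fun v w => ?_, map_smul' := fun f v => ?_ },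
    a.2⟩, rfl⟩
  · refine O.isSheafRes.sep _ _ _ fun x hx => ?_
    obtain ⟨Z, h, hxZ, b, hb⟩ := loc' W x hx
    exact ⟨Z, h, hxZ, by simp only [map_add, hb]⟩
  · refine O.isSheafRes.sep _ _ _ fun x hx => ?_
    obtain ⟨Z, h, hxZ, b, hb⟩ := loc' W x hx
    exact ⟨Z, h, hxZ, by simp only [hb, res_smul, map_smul, smul_eq_mul, map_mul, RingHom.id_apply]⟩

/-- The compatible families of alternating bilinear forms on `V`. -/
def altSubgroup (U : Opens X) :
    AddSubgroup (∀ W : Set.Iic U, V.sec W.1 [⋀^Fin 2]→ₗ[O.sec W.1] O.sec W.1) where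
  carrier := {β | ∀ (W W' : Set.Iic U) (h : W'.1 ≤ W.1) (v : Fin 2 → V.sec W.1),
    O.res h (β W v) = β W' (fun i => V.res h (v i))}
  zero_mem' := by intro W W' h v; exact map_zero _
  add_mem' := by
    intro a b ha hb W W' h v
    simp only [Pi.add_apply, AlternatingMap.add_apply, map_add, ha W W' h v, hb W W' h v]
  neg_mem' := by
    intro a ha W W' h v
    simp only [Pi.neg_apply, AlternatingMap.neg_apply, map_neg, ha W W' h v]

/-- Sections over `U` of the sheaf of alternating bilinear forms on `V`. -/
def alt (U : Opens X) : Type u := V.altSubgroup U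

instance (U : Opens X) : AddCommGroup (V.alt U) := AddSubgroup.toAddCommGroup (V.altSubgroup U)

/-- Restriction of alternating forms. -/
def altRes (h : W ≤ U) : V.alt U →+ V.alt W where
  toFun β := ⟨fun Z => β.1 ⟨Z.1, Z.2.trans h⟩, fun Z Z' hZ v => β.2 ⟨Z.1, _⟩ ⟨Z'.1, _⟩ hZ v⟩
  map_zero' := rfl
  map_add' _ _ := rfl

theorem altRes_res (h : W ≤ U) (h' : Z ≤ W) (β : V.alt U) :
    V.altRes h' (V.altRes h β) = V.altRes (h'.trans h) β := rfl

/-- Evaluation of an alternating form. -/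
def altEv (h : W ≤ U) (β : V.alt U) (v : Fin 2 → V.sec W) : O.sec W := β.1 ⟨W, h⟩ v

variable {V} in
theorem alt_ext {α β : V.alt U} (h : ∀ (W : Opens X) (h : W ≤ U) (v : Fin 2 → V.sec W),
    V.altEv h α v = V.altEv h β v) : α = β :=
  Subtype.ext (funext fun W => AlternatingMap.ext (h W.1 W.2))

instance (U : Opens X) : SMul (O.sec U) (V.alt U) where
  smul f β := ⟨fun W => O.res W.2 f • β.1 W, by
    intro W W' h v
    simp only [AlternatingMap.smul_apply, smul_eq_mul, map_mul, β.2 W W' h v]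
    exact congrArg (· * _) (O.res_res _ _ f)⟩

theorem alt_smul_val (f : O.sec U) (β : V.alt U) (W : Set.Iic U) :
    (f • β).1 W = O.res W.2 f • β.1 W := rfl

theorem alt_add_val (α β : V.alt U) (W : Set.Iic U) : (α + β).1 W = α.1 W + β.1 W := rfl

instance (U : Opens X) : Module (O.sec U) (V.alt U) where
  one_smul β := Subtype.ext (funext fun W => by rw [alt_smul_val, map_one, one_smul])
  mul_smul f g β := Subtype.ext (funext fun W => by
    rw [alt_smul_val, alt_smul_val, alt_smul_val, map_mul, mul_smul])
  smul_zero f := Subtype.ext (funext fun W => smul_zero _)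
  smul_add f α β := Subtype.ext (funext fun W => smul_add _ _ _)
  add_smul f g β := Subtype.ext (funext fun W => by
    rw [alt_add_val, alt_smul_val, alt_smul_val, alt_smul_val, map_add, add_smul])
  zero_smul β := Subtype.ext (funext fun W => by
    rw [alt_smul_val, map_zero, zero_smul]; rfl)

section AltEvaluation

variable (h : W ≤ U) (α β : V.alt U) (v : Fin 2 → V.sec W) (f : O.sec U)

theorem res_altEv (h' : Z ≤ W) :
    O.res h' (V.altEv h β v) = V.altEv (h'.trans h) β (fun i => V.res h' (v i)) :=
  β.2 ⟨W, h⟩ ⟨Z, h'.trans h⟩ h' v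

theorem altEv_altRes (h' : Z ≤ W) (v : Fin 2 → V.sec Z) :
    V.altEv h' (V.altRes h β) v = V.altEv (h'.trans h) β v := rfl

theorem altEv_add : V.altEv h (α + β) v = V.altEv h α v + V.altEv h β v := rfl

theorem altEv_neg : V.altEv h (-β) v = -V.altEv h β v := rfl

theorem altEv_smul : V.altEv h (f • β) v = O.res h f * V.altEv h β v := rfl

theorem altRes_smul : V.altRes h (f • β) = O.res h f • V.altRes h β := by
  refine alt_ext fun Z hZ v => ?_
  rw [altEv_altRes, altEv_smul, altEv_smul, O.res_res, altEv_altRes]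

end AltEvaluation

/-- As for the dual sheaf: inside the sheaf of maps `V × V → O`, being bilinear and alternating is a
local condition. -/
theorem isSheafRes_alt : IsSheafRes (fun U => V.alt U) fun _ _ h => V.altRes h := by
  refine (IsSheafRes.hom (F := fun U => Fin 2 → V.sec U) (r := fun _ _ h v i => V.res h (v i))
    O.isSheafRes fun _ _ _ h h' v => funext fun i => V.res_res h h' (v i)).of_injective
    (fun U φ => ⟨fun W => φ.1 W, φ.2⟩) (fun U φ ψ e => alt_ext fun W h v =>
      congrFun (congrFun (congrArg Subtype.val e) ⟨W, h⟩) v) (fun _ _ _ _ => rfl) fun U a loc => ?_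
  have loc' : ∀ (W : Set.Iic U), ∀ x ∈ W.1, ∃ (Z : Opens X) (h : Z ≤ W.1), x ∈ Z ∧
      ∃ b : V.sec Z [⋀^Fin 2]→ₗ[O.sec Z] O.sec Z, ∀ v : Fin 2 → V.sec W.1,
        O.res h (a.1 W v) = b (fun i => V.res h (v i)) := by
    intro W x hx
    obtain ⟨Z, h, hxZ, b, hb⟩ := loc x (W.2 hx)
    refine ⟨W.1 ⊓ Z, inf_le_left, ⟨hx, hxZ⟩, b.1 ⟨W.1 ⊓ Z, Set.mem_Iic.2 inf_le_right⟩,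
      fun v => ?_⟩
    rw [a.2 W ⟨W.1 ⊓ Z, Set.mem_Iic.2 (inf_le_left.trans W.2)⟩ inf_le_left v]
    exact (congrFun (congrFun (congrArg Subtype.val hb)
      ⟨W.1 ⊓ Z, Set.mem_Iic.2 inf_le_right⟩) _).symm
  have upd : ∀ {W Z : Opens X} (h : Z ≤ W) [DecidableEq (Fin 2)] (v : Fin 2 → V.sec W) (i : Fin 2)
      (w : V.sec W), (fun j => V.res h (Function.update v i w j)) =
        Function.update (fun j => V.res h (v j)) i (V.res h w) := by
    intro W Z h _ v i w
    funext j
    by_cases hj : j = i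
    · subst hj
      rw [Function.update_self, Function.update_self]
    · rw [Function.update_of_ne hj, Function.update_of_ne hj]
  refine ⟨⟨fun W => { toFun := a.1 W, map_update_add' := fun v i w w' => ?_,
                      map_update_smul' := fun v i f w => ?_,
                      map_eq_zero_of_eq' := fun v i j hv hij => ?_ }, a.2⟩, rfl⟩
  · refine O.isSheafRes.sep _ _ _ fun x hx => ?_
    obtain ⟨Z, h, hxZ, b, hb⟩ := loc' W x hx
    exact ⟨Z, h, hxZ, by simp only [map_add, hb, upd, b.map_update_add]⟩
  · refine O.isSheafRes.sep _ _ _ fun x hx => ?_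
    obtain ⟨Z, h, hxZ, b, hb⟩ := loc' W x hx
    exact ⟨Z, h, hxZ, by simp only [hb, upd, res_smul, b.map_update_smul, smul_eq_mul, map_mul]⟩
  · refine O.isSheafRes.sep _ _ _ fun x hx => ?_
    obtain ⟨Z, h, hxZ, b, hb⟩ := loc' W x hx
    refine ⟨Z, h, hxZ, ?_⟩
    rw [hb, map_zero]
    exact b.map_eq_zero_of_eq _ (by rw [hv]) hij

/-- The exterior product of two linear forms on a module. -/
def wedgeForm {R M : Type*} [CommRing R] [AddCommGroup M] [Module R M] (φ ψ : M →ₗ[R] R) :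
    M [⋀^Fin 2]→ₗ[R] R where
  toFun v := φ (v 0) * ψ (v 1) - φ (v 1) * ψ (v 0)
  map_update_add' v i x y := by
    fin_cases i <;> simp <;> ring
  map_update_smul' v i c x := by
    fin_cases i <;> simp <;> ring
  map_eq_zero_of_eq' v i j hv hij := by
    fin_cases i <;> fin_cases j <;> simp_all

theorem wedgeForm_apply {R M : Type*} [CommRing R] [AddCommGroup M] [Module R M]
    (φ ψ : M →ₗ[R] R) (v : Fin 2 → M) :
    wedgeForm φ ψ v = φ (v 0) * ψ (v 1) - φ (v 1) * ψ (v 0) := rfl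

/-- The exterior product of two sections of the dual bundle, as a function. -/
def wedgeFun (φ ψ : V.dual U) : V.alt U :=
  ⟨fun W => wedgeForm (φ.1 W) (ψ.1 W), fun W W' h v => by
    simp only [wedgeForm_apply, map_sub, map_mul, φ.2 W W' h, ψ.2 W W' h]⟩

theorem altEv_wedgeFun (h : W ≤ U) (φ ψ : V.dual U) (v : Fin 2 → V.sec W) :
    V.altEv h (V.wedgeFun φ ψ) v =
      V.ev h φ (v 0) * V.ev h ψ (v 1) - V.ev h φ (v 1) * V.ev h ψ (v 0) := rfl

/-- The exterior product of two sections of the dual bundle. -/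
def wedge (U : Opens X) : V.dual U →ₗ[O.sec U] V.dual U →ₗ[O.sec U] V.alt U :=
  LinearMap.mk₂ (O.sec U) V.wedgeFun
    (fun φ φ' ψ => alt_ext fun W h v => by
      simp only [altEv_wedgeFun, altEv_add, ev_add]
      ring)
    (fun f φ ψ => alt_ext fun W h v => by
      simp only [altEv_wedgeFun, altEv_smul, ev_smul]
      ring)
    (fun φ ψ ψ' => alt_ext fun W h v => by
      simp only [altEv_wedgeFun, altEv_add, ev_add]
      ring)
    (fun f φ ψ => alt_ext fun W h v => by
      simp only [altEv_wedgeFun, altEv_smul, ev_smul]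
      ring)

theorem altEv_wedge (h : W ≤ U) (φ ψ : V.dual U) (v : Fin 2 → V.sec W) :
    V.altEv h (V.wedge U φ ψ) v =
      V.ev h φ (v 0) * V.ev h ψ (v 1) - V.ev h φ (v 1) * V.ev h ψ (v 0) := rfl

theorem wedge_self (φ : V.dual U) : V.wedge U φ φ = 0 :=
  alt_ext fun W h v => by
    rw [altEv_wedge, mul_comm, sub_self]; rfl

theorem wedge_swap (φ ψ : V.dual U) : V.wedge U φ ψ = -V.wedge U ψ φ :=
  alt_ext fun W h v => by
    rw [altEv_neg, altEv_wedge, altEv_wedge]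
    ring

theorem altRes_wedge (h : W ≤ U) (φ ψ : V.dual U) :
    V.altRes h (V.wedge U φ ψ) = V.wedge W (V.dualRes h φ) (V.dualRes h ψ) := rfl

/-! ### Frames of rank two -/

variable {V} {e : Fin 2 → V.sec U}

namespace IsFrame

theorem res (he : V.IsFrame e) (h : W ≤ U) : V.IsFrame fun i => V.res h (e i) := by
  intro Z hZ
  simpa only [V.res_res] using he Z (hZ.trans h)

/-- The basis of sections defined by a frame. -/
def basis (he : V.IsFrame e) (W : Opens X) (h : W ≤ U) :
    Module.Basis (Fin 2) (O.sec W) (V.sec W) :=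
  Module.Basis.ofEquivFun (LinearEquiv.ofBijective
    ({ toFun := fun c => ∑ i, c i • V.res h (e i)
       map_add' := fun c c' => by simp only [Pi.add_apply, add_smul, Finset.sum_add_distrib]
       map_smul' := fun a c => by
        simp only [Pi.smul_apply, smul_eq_mul, mul_smul, Finset.smul_sum, RingHom.id_apply] } :
      (Fin 2 → O.sec W) →ₗ[O.sec W] V.sec W) (he W h)).symm

theorem basis_apply (he : V.IsFrame e) (h : W ≤ U) (i : Fin 2) :
    he.basis W h i = V.res h (e i) := by
  rw [basis, Module.Basis.coe_ofEquivFun, LinearEquiv.symm_symm]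
  change ∑ j, (Pi.single i (1 : O.sec W) : Fin 2 → O.sec W) j • V.res h (e j) = _
  rw [Finset.sum_eq_single i]
  · rw [Pi.single_eq_same, one_smul]
  · intro j _ hj
    rw [Pi.single_eq_of_ne hj, zero_smul]
  · simp

theorem coord_res (he : V.IsFrame e) (h : W ≤ U) (h' : Z ≤ W) (i : Fin 2) (v : V.sec W) :
    O.res h' ((he.basis W h).coord i v) = (he.basis Z (h'.trans h)).coord i (V.res h' v) := by
  conv_rhs => rw [← (he.basis W h).sum_repr v]
  simp only [map_sum, res_smul, he.basis_apply, V.res_res, map_smul]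
  simp only [← he.basis_apply (h'.trans h), Module.Basis.coord_apply, Module.Basis.repr_self,
    smul_eq_mul]
  rw [Finset.sum_eq_single i]
  · simp
  · intro j _ hj
    simp [hj]
  · simp

/-- The coordinate functions of a frame. -/
def dualFrame (he : V.IsFrame e) (i : Fin 2) : V.dual U :=
  ⟨fun W => (he.basis W.1 W.2).coord i, fun W _ h v => he.coord_res W.2 h i v⟩

theorem ev_dualFrame (he : V.IsFrame e) (i : Fin 2) (h : W ≤ U) (v : V.sec W) :
    V.ev h (he.dualFrame i) v = (he.basis W h).coord i v := rfl

theorem basis_res (he : V.IsFrame e) (h : W ≤ U) (h' : Z ≤ W) :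
    (he.res h).basis Z h' = he.basis Z (h'.trans h) :=
  Module.Basis.eq_of_apply_eq fun j => by rw [basis_apply, basis_apply, V.res_res]

theorem dualFrame_res (he : V.IsFrame e) (h : W ≤ U) (i : Fin 2) :
    (he.res h).dualFrame i = V.dualRes h (he.dualFrame i) := by
  refine dual_ext fun Z h' v => ?_
  rw [ev_dualRes, ev_dualFrame, ev_dualFrame, basis_res]

theorem ev_dualFrame_frame (he : V.IsFrame e) (i j : Fin 2) :
    V.ev le_rfl (he.dualFrame i) (e j) = if i = j then 1 else 0 := by
  have := he.basis_apply le_rfl j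
  rw [V.res_self] at this
  rw [ev_dualFrame, ← this, Module.Basis.coord_apply, Module.Basis.repr_self,
    Finsupp.single_apply]
  simp only [eq_comm]

theorem dual_eq (he : V.IsFrame e) (φ : V.dual U) :
    φ = V.ev le_rfl φ (e 0) • he.dualFrame 0 + V.ev le_rfl φ (e 1) • he.dualFrame 1 := by
  refine dual_ext fun W h v => ?_
  rw [ev_add, ev_smul, ev_smul, res_ev, res_ev, ev_dualFrame, ev_dualFrame]
  conv_lhs => rw [← (he.basis W h).sum_repr v]
  rw [Fin.sum_univ_two, ev_map_add, ev_map_smul, ev_map_smul, basis_apply, basis_apply,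
    mul_comm, mul_comm ((he.basis W h).repr v 1)]
  rfl

theorem ev_combination (he : V.IsFrame e) (a b : O.sec U) (i : Fin 2) :
    V.ev le_rfl (a • he.dualFrame 0 + b • he.dualFrame 1) (e i) = ![a, b] i := by
  rw [ev_add, ev_smul, ev_smul, ev_dualFrame_frame, ev_dualFrame_frame, O.res_self, O.res_self]
  fin_cases i <;> simp

/-- The basis of linear forms dual to a frame. -/
def dualBasis (he : V.IsFrame e) : Module.Basis (Fin 2) (O.sec U) (V.dual U) :=
  Module.Basis.ofEquivFun
    { toFun := fun φ i => V.ev le_rfl φ (e i)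
      invFun := fun c => c 0 • he.dualFrame 0 + c 1 • he.dualFrame 1
      map_add' := fun _ _ => rfl
      map_smul' := fun f φ => funext fun i => by
        rw [ev_smul, O.res_self]; rfl
      left_inv := fun φ => (he.dual_eq φ).symm
      right_inv := fun c => funext fun i => by
        refine (he.ev_combination (c 0) (c 1) i).trans ?_
        fin_cases i <;> rfl }

theorem dualBasis_apply (he : V.IsFrame e) (i : Fin 2) : he.dualBasis i = he.dualFrame i := by
  rw [dualBasis, Module.Basis.coe_ofEquivFun]
  change (Pi.single i (1 : O.sec U) : Fin 2 → O.sec U) 0 • he.dualFrame 0 +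
    (Pi.single i (1 : O.sec U) : Fin 2 → O.sec U) 1 • he.dualFrame 1 = _
  refine dual_ext fun W h v => ?_
  rw [ev_add, ev_smul, ev_smul]
  fin_cases i
  · change O.res h 1 * _ + O.res h 0 * _ = _
    rw [map_one, map_zero, one_mul, zero_mul, add_zero]
    rfl
  · change O.res h 0 * _ + O.res h 1 * _ = _
    rw [map_one, map_zero, one_mul, zero_mul, zero_add]
    rfl

/-- In rank two an alternating form has a single coefficient, its value on the frame. -/
theorem alt_ext (he : V.IsFrame e) {α β : V.alt U}
    (h : V.altEv le_rfl α e = V.altEv le_rfl β e) : α = β := by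
  refine ModuleSheaf.alt_ext fun W hW v => ?_
  have key : ∀ γ : V.alt U, V.altEv hW γ (he.basis W hW) =
      O.res hW (V.altEv le_rfl γ e) := by
    intro γ
    rw [res_altEv]
    exact congrArg _ (funext fun i => he.basis_apply hW i)
  refine congrFun (congrArg DFunLike.coe (?_ : α.1 ⟨W, hW⟩ = β.1 ⟨W, hW⟩)) v
  -- An injective choice of two basis indices is a permutation, which changes both values by the
  -- same sign.
  refine Module.Basis.ext_alternating (he.basis W hW) fun v hv => ?_
  have hb : Function.Bijective v := Finite.injective_iff_bijective.1 hv
  have e1 := (α.1 ⟨W, hW⟩).map_perm (he.basis W hW) (Equiv.ofBijective v hb)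
  have e2 := (β.1 ⟨W, hW⟩).map_perm (he.basis W hW) (Equiv.ofBijective v hb)
  refine e1.trans (Eq.trans (congrArg _ ?_) e2.symm)
  exact (key α).trans ((congrArg _ h).trans (key β).symm)

/-- Over a frame every form is decomposable. The coefficient is absorbed in the first factor so that
the form is literally a `wedge`, as needed to define `topSec` from products of odd functions. -/
theorem alt_eq (he : V.IsFrame e) (β : V.alt U) :
    β = V.wedge U (V.altEv le_rfl β e • he.dualFrame 0) (he.dualFrame 1) := by
  refine he.alt_ext ?_
  rw [altEv_wedge, ev_smul, ev_smul, O.res_self]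
  simp only [ev_dualFrame_frame]
  simp

end IsFrame

theorem IsVectorBundle.exists_frame {n : ℕ} (hV : V.IsVectorBundle n) {x : X} (hx : x ∈ U) :
    ∃ (W : Opens X) (_ : W ≤ U), x ∈ W ∧ ∃ e : Fin n → V.sec W, V.IsFrame e := by
  obtain ⟨W, hW, e, he⟩ := hV x
  refine ⟨U ⊓ W, inf_le_left, ⟨hx, hW⟩, fun i => V.res inf_le_right (e i), fun Z hZ => ?_⟩
  simpa only [V.res_res] using he Z (hZ.trans inf_le_right)

end ModuleSheaf

end SuperGeometry

end


noncomputable section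

namespace SuperGeometry

variable {𝕜 : Type} [Field 𝕜] {X : TopCat.{u}} {O : FunctionSheaf 𝕜 X}

namespace SuperSheaf

variable {S : SuperSheaf O} {V : ModuleSheaf O} {U W : Opens X}

/-! ### Odd functions as linear forms -/

namespace OddTangentIso

variable (hS : S.IsSupermanifold 2) (ρ : S.OddTangentIso V)

include hS in
theorem odd_mem_J {a : S.sec U} (ha : a ∈ S.part U 1) : a ∈ S.J 1 U :=
  hS.mem_J_one.2 (S.red_odd U a ha)

/-- The linear form defined by an odd function. -/
def oddToDual (U : Opens X) : S.part U 1 →+ V.dual U where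
  toFun a := ρ.toDual U ⟨a.1, odd_mem_J hS a.2⟩
  map_zero' := (ρ.toDual U).map_zero
  map_add' a b := (ρ.toDual U).map_add ⟨a.1, odd_mem_J hS a.2⟩ ⟨b.1, odd_mem_J hS b.2⟩

theorem oddToDual_res (h : W ≤ U) (a : S.part U 1) :
    ρ.oddToDual hS W ⟨S.res h a.1, S.res_mem h a.2⟩ = V.dualRes h (ρ.oddToDual hS U a) :=
  ρ.toDual_res h _ _ rfl

/-- The kernel of `J → V^∨` is `J²`, which consists of even functions and so contains no odd
function except zero. -/
theorem oddToDual_injective (U : Opens X) : Function.Injective (ρ.oddToDual hS U) := by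
  refine (injective_iff_map_eq_zero _).2 fun a ha => Subtype.ext ?_
  have h := hS.mem_J_two.1 ((ρ.toDual_eq_zero U _).1 ha)
  exact eq_zero_of_even_of_odd h.1 a.2

/-- The linear form defined by a nilpotent function is that of its odd part. -/
theorem toDual_eq (a : S.J 1 U) (a₁ : S.part U 1) (h : (a : S.sec U) - a₁ ∈ S.part U 0) :
    ρ.toDual U a = ρ.oddToDual hS U a₁ := by
  have e : ρ.toDual U (a - ⟨a₁.1, odd_mem_J hS a₁.2⟩) = 0 := by
    refine (ρ.toDual_eq_zero U _).2 (hS.mem_J_two.2 (mem_evenNil.2 ⟨h, ?_⟩))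
    change S.red U (a.1 - a₁.1) = 0
    rw [map_sub, hS.mem_J_one.1 a.2, S.red_odd U _ a₁.2, sub_zero]
  rw [map_sub, sub_eq_zero] at e
  exact e

/-- `ρ` is only known to be locally surjective on `J`. Replacing local preimages by their odd parts
makes them unique, and odd functions form a sheaf, so the preimages glue. Thus the odd part of `O_S`
is canonically `V^∨`. -/
theorem oddToDual_bijective (U : Opens X) : Function.Bijective (ρ.oddToDual hS U) := by
  refine ⟨ρ.oddToDual_injective hS U, fun φ => ?_⟩
  refine S.isSheafRes_odd.surjective_of_locally V.isSheafRes_dual (fun U => ρ.oddToDual hS U)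
    (fun _ _ h a => ρ.oddToDual_res hS h a) U (fun W _ => ρ.oddToDual_injective hS W) φ
    fun x hx => ?_
  obtain ⟨W, h, hxW, a, ha⟩ := ρ.toDual_surj U φ x hx
  obtain ⟨a₀, h₀, a₁, h₁, e⟩ := S.exists_parts a.1
  refine ⟨W, h, hxW, ⟨a₁, h₁⟩, ?_⟩
  rw [← ha]
  refine (ρ.toDual_eq hS a ⟨a₁, h₁⟩ ?_).symm
  rwa [← e, add_sub_cancel_right]

/-- The odd function that corresponds to a linear form. -/
def oddSec (U : Opens X) : V.dual U →+ S.sec U :=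
  (S.part U 1).subtype.toAddMonoidHom.comp
    (AddEquiv.ofBijective _ (ρ.oddToDual_bijective hS U)).symm.toAddMonoidHom

theorem oddSec_oddToDual (a : S.part U 1) : ρ.oddSec hS U (ρ.oddToDual hS U a) = a :=
  congrArg Subtype.val ((AddEquiv.ofBijective _ (ρ.oddToDual_bijective hS U)).symm_apply_apply a)

theorem oddSec_odd (φ : V.dual U) : ρ.oddSec hS U φ ∈ S.part U 1 :=
  ((AddEquiv.ofBijective _ (ρ.oddToDual_bijective hS U)).symm φ).2

theorem oddToDual_oddSec (φ : V.dual U) :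
    ρ.oddToDual hS U ⟨ρ.oddSec hS U φ, ρ.oddSec_odd hS φ⟩ = φ :=
  (AddEquiv.ofBijective _ (ρ.oddToDual_bijective hS U)).apply_symm_apply φ

theorem oddSec_injective (U : Opens X) : Function.Injective (ρ.oddSec hS U) := fun φ ψ h => by
  rw [← ρ.oddToDual_oddSec hS φ, ← ρ.oddToDual_oddSec hS ψ]
  exact congrArg _ (Subtype.ext h)

theorem exists_oddSec {a : S.sec U} (ha : a ∈ S.part U 1) : ∃ φ, ρ.oddSec hS U φ = a :=
  ⟨_, ρ.oddSec_oddToDual hS ⟨a, ha⟩⟩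

theorem red_oddSec (φ : V.dual U) : S.red U (ρ.oddSec hS U φ) = 0 :=
  S.red_odd U _ (ρ.oddSec_odd hS φ)

theorem res_oddSec (h : W ≤ U) (φ : V.dual U) :
    S.res h (ρ.oddSec hS U φ) = ρ.oddSec hS W (V.dualRes h φ) := by
  have e := ρ.oddToDual_res hS h ⟨_, ρ.oddSec_odd hS φ⟩
  rw [oddToDual_oddSec] at e
  rw [← e, oddSec_oddToDual]

/-- Multiplication of odd functions by an even function depends only on its reduction. Hence every
projection induces the same `O`-module structure on odd functions. -/
theorem even_mul_oddSec {a : S.sec U} (ha : a ∈ S.part U 0) (φ : V.dual U) :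
    a * ρ.oddSec hS U φ = ρ.oddSec hS U (S.red U a • φ) := by
  have h := even_mul_odd ha (ρ.oddSec_odd hS φ)
  have e := ρ.toDual_mul U a ⟨_, odd_mem_J hS (ρ.oddSec_odd hS φ)⟩ ⟨_, odd_mem_J hS h⟩ rfl
  change ρ.oddToDual hS U ⟨_, h⟩ = S.red U a • ρ.oddToDual hS U ⟨_, ρ.oddSec_odd hS φ⟩ at e
  rw [oddToDual_oddSec] at e
  rw [← e, oddSec_oddToDual]

theorem oddSec_sq (φ : V.dual U) : ρ.oddSec hS U φ * ρ.oddSec hS U φ = 0 :=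
  hS.odd_sq (ρ.oddSec_odd hS φ)

/-! ### Even nilpotent functions as alternating forms -/

include hS in
theorem exists_frame_normal (hV : V.IsVectorBundle 2) {x : X} (hx : x ∈ U) :
    ∃ (W : Opens X) (_ : W ≤ U), x ∈ W ∧ (∀ Z ≤ W, S.IsNormal Z) ∧
      ∃ e : Fin 2 → V.sec W, V.IsFrame e := by
  obtain ⟨W, h, hxW, hW⟩ := hS.exists_isNormal hx
  obtain ⟨Z, h', hxZ, e, he⟩ := hV.exists_frame hxW
  exact ⟨Z, h'.trans h, hxZ, fun Y hY => hW Y (hY.trans h'), e, he⟩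

section Frame

variable {e : Fin 2 → V.sec U} (he : V.IsFrame e)

/-- The even nilpotent function `g t₀ t₁` for the odd coordinates `t₀`, `t₁` of a frame. -/
def topFrame (g : O.sec U) : S.sec U :=
  ρ.oddSec hS U (g • he.dualFrame 0) * ρ.oddSec hS U (he.dualFrame 1)

theorem even_mul_topFrame {a : S.sec U} (ha : a ∈ S.part U 0) (g : O.sec U) :
    a * ρ.topFrame hS he g = ρ.topFrame hS he (S.red U a * g) := by
  rw [topFrame, topFrame, ← mul_assoc, ρ.even_mul_oddSec hS ha, mul_smul]

theorem topFrame_add (f g : O.sec U) :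
    ρ.topFrame hS he (f + g) = ρ.topFrame hS he f + ρ.topFrame hS he g := by
  rw [topFrame, topFrame, topFrame, add_smul, map_add, add_mul]

/-- Expanding both factors in the dual frame leaves the determinant of their coefficients, which is
the value of `φ ∧ ψ` on the frame. -/
theorem oddSec_mul_oddSec (hn : S.IsNormal U) (φ ψ : V.dual U) :
    ρ.oddSec hS U φ * ρ.oddSec hS U ψ =
      ρ.topFrame hS he (V.altEv le_rfl (V.wedge U φ ψ) e) := by
  obtain ⟨i, s, t, N⟩ := hn
  have lin : ∀ φ : V.dual U, ρ.oddSec hS U φ =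
      i (V.ev le_rfl φ (e 0)) * ρ.oddSec hS U (he.dualFrame 0) +
        i (V.ev le_rfl φ (e 1)) * ρ.oddSec hS U (he.dualFrame 1) := by
    intro φ
    rw [ρ.even_mul_oddSec hS (N.even _), ρ.even_mul_oddSec hS (N.even _), N.red, N.red, ← map_add,
      ← he.dual_eq φ]
  rw [lin φ, lin ψ, linear_mul_linear i (fun r => even_mul_comm (N.even r)) (ρ.oddSec_sq hS _)
    (ρ.oddSec_sq hS _) (odd_mul_swap (ρ.oddSec_odd hS _) (ρ.oddSec_odd hS _)), topFrame,
    ← N.red (V.altEv le_rfl (V.wedge U φ ψ) e), ← ρ.even_mul_oddSec hS (N.even _), mul_assoc]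
  rfl

/-- Even nilpotent functions are uniquely of the form `g t₀ t₁`. -/
theorem topFrame_bijective (hn : S.IsNormal U) :
    Function.Injective (ρ.topFrame hS he) ∧
      ∀ k ∈ S.evenNil U, ∃ g, ρ.topFrame hS he g = k := by
  have mul := ρ.oddSec_mul_oddSec hS he hn
  obtain ⟨i, s, t, N⟩ := hn
  have top : ∀ f g, i f * ρ.topFrame hS he g = ρ.topFrame hS he (f * g) := by
    intro f g
    rw [ρ.even_mul_topFrame hS he (N.even f), N.red]
  -- The odd coordinates `s, t` of the normal form are unrelated to the frame of `V`. The functions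
  -- `m` and `n` express `st` and `t₀t₁` in terms of each other.
  obtain ⟨m, hm⟩ : ∃ m, ρ.topFrame hS he m = s * t := by
    obtain ⟨φ, rfl⟩ := ρ.exists_oddSec hS N.odd_left
    obtain ⟨ψ, rfl⟩ := ρ.exists_oddSec hS N.odd_right
    exact ⟨_, (mul φ ψ).symm⟩
  obtain ⟨n, hn⟩ : ∃ n, ρ.topFrame hS he 1 = i n * (s * t) :=
    N.exists_of_evenNil (odd_mul_odd_evenNil (ρ.oddSec_odd hS _) (ρ.oddSec_odd hS _))
  have form : ∀ g, ρ.topFrame hS he g = i (g * n) * (s * t) := by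
    intro g
    rw [map_mul, mul_assoc, ← hn, top, mul_one]
  have inj : ∀ f g, i f * (s * t) = i g * (s * t) → f = g := by
    intro f g h
    have : combination i s t (0, 0, 0, f) = combination i s t (0, 0, 0, g) := by
      simp [combination, h]
    simpa using N.bijective.1 this
  -- Both sides are the coefficient of `st` in `st`. Hence `n` is a unit, and uniqueness of the
  -- coefficient passes from `st` to `t₀t₁`.
  have hnm : m * n = 1 := inj _ _ (by rw [← form, hm, map_one, one_mul])
  refine ⟨fun f g h => ?_, fun k hk => ?_⟩
  · rw [form, form] at h
    have := congrArg (· * m) (inj _ _ h)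
    simpa only [mul_assoc, mul_comm n m, hnm, mul_one] using this
  · obtain ⟨g, rfl⟩ := N.exists_of_evenNil hk
    exact ⟨g * m, by rw [← hm, top]⟩

end Frame

variable (hV : V.IsVectorBundle 2)

-- This makes `φ ∧ ψ ↦ φψ` well defined. The equality is checked locally on a frame, where the
-- product depends only on the value of the form.
include hV in
theorem oddSec_mul_eq_of_wedge_eq {φ ψ φ' ψ' : V.dual U}
    (h : V.wedge U φ ψ = V.wedge U φ' ψ') :
    ρ.oddSec hS U φ * ρ.oddSec hS U ψ = ρ.oddSec hS U φ' * ρ.oddSec hS U ψ' := by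
  refine S.isSheafRes.sep U _ _ fun x hx => ?_
  obtain ⟨W, hW, hxW, hn, e, he⟩ := exists_frame_normal hS hV hx
  refine ⟨W, hW, hxW, ?_⟩
  simp only [map_mul, res_oddSec]
  rw [ρ.oddSec_mul_oddSec hS he (hn W le_rfl), ρ.oddSec_mul_oddSec hS he (hn W le_rfl),
    ← ModuleSheaf.altRes_wedge, ← ModuleSheaf.altRes_wedge, h]

-- A form is decomposable near each point; the corresponding products of odd functions do not depend
-- on the decomposition and therefore glue.
include hV in
theorem exists_topSec (β : V.alt U) : ∃ k : S.sec U, ∀ (W : Opens X) (h : W ≤ U)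
    (φ ψ : V.dual W), V.altRes h β = V.wedge W φ ψ →
      S.res h k = ρ.oddSec hS W φ * ρ.oddSec hS W ψ := by
  obtain ⟨k, hk⟩ := S.isSheafRes.glue U (fun W t => ∃ (h : W ≤ U) (φ ψ : V.dual W),
      V.altRes h β = V.wedge W φ ψ ∧ t = ρ.oddSec hS W φ * ρ.oddSec hS W ψ)
    (fun x hx => by
      obtain ⟨W, hW, hxW, -, e, he⟩ := exists_frame_normal hS hV hx
      exact ⟨W, hW, hxW, _, hW, _, _, he.alt_eq _, rfl⟩)
    (by
      rintro W Z h _ ⟨hW, φ, ψ, e, rfl⟩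
      refine ⟨h.trans hW, V.dualRes h φ, V.dualRes h ψ, ?_, ?_⟩
      · rw [← ModuleSheaf.altRes_wedge, ← e, ModuleSheaf.altRes_res]
      · rw [map_mul, res_oddSec, res_oddSec])
    (by
      rintro W _ _ - ⟨hW, φ, ψ, e, rfl⟩ ⟨_, φ', ψ', e', rfl⟩
      exact ρ.oddSec_mul_eq_of_wedge_eq hS hV (e.symm.trans e'))
  exact ⟨k, fun W h φ ψ e => hk W h _ ⟨h, φ, ψ, e, rfl⟩⟩

/-- The even nilpotent function that corresponds to an alternating form, as a function. -/
def topFun (β : V.alt U) : S.sec U := (ρ.exists_topSec hS hV β).choose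

theorem res_topFun (β : V.alt U) (h : W ≤ U) {φ ψ : V.dual W} (e : V.altRes h β = V.wedge W φ ψ) :
    S.res h (ρ.topFun hS hV β) = ρ.oddSec hS W φ * ρ.oddSec hS W ψ :=
  (ρ.exists_topSec hS hV β).choose_spec W h φ ψ e

theorem res_topFun_frame (β : V.alt U) (h : W ≤ U) {e : Fin 2 → V.sec W} (he : V.IsFrame e) :
    S.res h (ρ.topFun hS hV β) = ρ.topFrame hS he (V.altEv h β e) :=
  ρ.res_topFun hS hV β h (he.alt_eq (V.altRes h β))

/-- The even nilpotent function that corresponds to an alternating form. -/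
def topSec (U : Opens X) : V.alt U →+ S.sec U :=
  AddMonoidHom.mk' (ρ.topFun hS hV) fun α β => S.isSheafRes.sep U _ _ fun x hx => by
    obtain ⟨W, hW, hxW, -, e, he⟩ := exists_frame_normal hS hV hx
    refine ⟨W, hW, hxW, ?_⟩
    simp only [map_add, ρ.res_topFun_frame hS hV _ hW he, ModuleSheaf.altEv_add, topFrame_add]

theorem res_topSec_frame (β : V.alt U) (h : W ≤ U) {e : Fin 2 → V.sec W} (he : V.IsFrame e) :
    S.res h (ρ.topSec hS hV U β) = ρ.topFrame hS he (V.altEv h β e) :=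
  ρ.res_topFun_frame hS hV β h he

theorem topSec_frame (β : V.alt U) {e : Fin 2 → V.sec U} (he : V.IsFrame e) :
    ρ.topSec hS hV U β = ρ.topFrame hS he (V.altEv le_rfl β e) := by
  rw [← ρ.res_topSec_frame hS hV β le_rfl he, res_self]

theorem topSec_wedge (φ ψ : V.dual U) :
    ρ.topSec hS hV U (V.wedge U φ ψ) = ρ.oddSec hS U φ * ρ.oddSec hS U ψ := by
  have := ρ.res_topFun hS hV (V.wedge U φ ψ) le_rfl rfl
  rwa [res_self] at this

theorem res_topSec (h : W ≤ U) (β : V.alt U) :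
    S.res h (ρ.topSec hS hV U β) = ρ.topSec hS hV W (V.altRes h β) := by
  refine S.isSheafRes.sep W _ _ fun x hx => ?_
  obtain ⟨Z, hZ, hxZ, -, e, he⟩ := exists_frame_normal hS hV hx
  refine ⟨Z, hZ, hxZ, ?_⟩
  rw [res_res, ρ.res_topSec_frame hS hV _ _ he, ρ.res_topSec_frame hS hV _ _ he]
  rfl

theorem topSec_mem (β : V.alt U) : ρ.topSec hS hV U β ∈ S.evenNil U := by
  refine mem_evenNil_of_locally _ fun x hx => ?_
  obtain ⟨W, hW, hxW, -, e, he⟩ := exists_frame_normal hS hV hx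
  refine ⟨W, hW, hxW, ?_⟩
  rw [ρ.res_topSec_frame hS hV β hW he]
  exact odd_mul_odd_evenNil (ρ.oddSec_odd hS _) (ρ.oddSec_odd hS _)

theorem even_mul_topSec {a : S.sec U} (ha : a ∈ S.part U 0) (β : V.alt U) :
    a * ρ.topSec hS hV U β = ρ.topSec hS hV U (S.red U a • β) := by
  refine S.isSheafRes.sep U _ _ fun x hx => ?_
  obtain ⟨W, hW, hxW, -, e, he⟩ := exists_frame_normal hS hV hx
  refine ⟨W, hW, hxW, ?_⟩
  rw [map_mul, ρ.res_topSec_frame hS hV _ _ he, ρ.res_topSec_frame hS hV _ _ he,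
    ρ.even_mul_topFrame hS he (S.res_mem hW ha), ModuleSheaf.altEv_smul, red_res]

/-- On small sets with a frame both sides are copies of `O`, by the value on the frame and by the
coefficient of `t₀t₁`. The general case follows because both sides are sheaves. This is the
isomorphism `∧²V^∨ ≅ J²`. -/
theorem topSec_bijective (U : Opens X) : Function.Bijective
    fun β : V.alt U => (⟨ρ.topSec hS hV U β, ρ.topSec_mem hS hV β⟩ : S.evenNil U) := by
  refine V.isSheafRes_alt.bijective_of_locally S.isSheafRes_evenNil
    (fun U β => ⟨ρ.topSec hS hV U β, ρ.topSec_mem hS hV β⟩)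
    (fun _ _ h β => Subtype.ext (ρ.res_topSec hS hV h β).symm) U fun x hx => ?_
  obtain ⟨W, hW, hxW, hn, e, he⟩ := exists_frame_normal hS hV hx
  refine ⟨W, hW, hxW, fun Z hZ => ?_⟩
  have heZ := he.res hZ
  obtain ⟨inj, surj⟩ := ρ.topFrame_bijective hS heZ (hn Z hZ)
  constructor
  · intro α β h
    have h' := congrArg Subtype.val h
    simp only [ρ.topSec_frame hS hV _ heZ] at h'
    exact heZ.alt_ext (inj h')
  · rintro ⟨k, hk⟩
    obtain ⟨g, rfl⟩ := surj k hk
    exact ⟨_, Subtype.ext (ρ.topSec_wedge hS hV _ _)⟩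

theorem topSec_injective (U : Opens X) : Function.Injective (ρ.topSec hS hV U) :=
  fun _ _ h => (ρ.topSec_bijective hS hV U).1 (Subtype.ext h)

theorem exists_topSec_eq {k : S.sec U} (hk : k ∈ S.evenNil U) :
    ∃ β, ρ.topSec hS hV U β = k := by
  obtain ⟨β, hβ⟩ := (ρ.topSec_bijective hS hV U).2 ⟨k, hk⟩
  exact ⟨β, congrArg Subtype.val hβ⟩

theorem combination_eq (i : O.sec U →+* S.sec U) (even : ∀ f, i f ∈ S.part U 0)
    (red : ∀ f, S.red U (i f) = f) {e : Fin 2 → V.sec U} (he : V.IsFrame e)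
    (p : O.sec U × O.sec U × O.sec U × O.sec U) :
    combination i (ρ.oddSec hS U (he.dualFrame 0)) (ρ.oddSec hS U (he.dualFrame 1)) p =
      (i p.1 + ρ.topFrame hS he p.2.2.2) +
        ρ.oddSec hS U (p.2.1 • he.dualFrame 0 + p.2.2.1 • he.dualFrame 1) := by
  have lin : ∀ f φ, i f * ρ.oddSec hS U φ = ρ.oddSec hS U (f • φ) := fun f φ => by
    rw [ρ.even_mul_oddSec hS (even f), red]
  rw [combination, lin p.2.1, lin p.2.2.1, ← mul_assoc (i p.2.2.2), lin p.2.2.2, topFrame, map_add]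
  abel

/-- Any even lift `i` of functions can be combined with the canonical odd functions to give a normal
form. This is why a projection alone yields a splitting. -/
theorem combination_bijective (i : O.sec U →+* S.sec U) (even : ∀ f, i f ∈ S.part U 0)
    (red : ∀ f, S.red U (i f) = f) (hn : S.IsNormal U) {e : Fin 2 → V.sec U} (he : V.IsFrame e) :
    Function.Bijective (combination i (ρ.oddSec hS U (he.dualBasis 0))
      (ρ.oddSec hS U (he.dualBasis 1))) := by
  rw [he.dualBasis_apply, he.dualBasis_apply]
  have form := ρ.combination_eq hS i even red he
  obtain ⟨inj, surj⟩ := ρ.topFrame_bijective hS he hn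
  have top : ∀ g, ρ.topFrame hS he g ∈ S.evenNil U := fun g =>
    odd_mul_odd_evenNil (ρ.oddSec_odd hS _) (ρ.oddSec_odd hS _)
  constructor
  · rintro ⟨a, b, c, d⟩ ⟨a', b', c', d'⟩ h
    rw [form, form] at h
    -- Parity separates the linear coefficients from the others; reduction then separates the
    -- function from the top coefficient.
    obtain ⟨h0, h1⟩ := parts_unique (add_mem (even a) (top d).1) (ρ.oddSec_odd hS _)
      (add_mem (even a') (top d').1) (ρ.oddSec_odd hS _) h
    have hf : a = a' := by
      have hf := congrArg (S.red U) h0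
      rwa [map_add, map_add, red a, red a', (mem_evenNil.1 (top d)).2,
        (mem_evenNil.1 (top d')).2, add_zero, add_zero] at hf
    subst hf
    have hb := ρ.oddSec_injective hS U h1
    have hb0 : b = b' := by
      have := congrArg (fun φ => V.ev le_rfl φ (e 0)) hb
      exact (he.ev_combination b c 0).symm.trans (this.trans (he.ev_combination b' c' 0))
    have hb1 : c = c' := by
      have := congrArg (fun φ => V.ev le_rfl φ (e 1)) hb
      exact (he.ev_combination b c 1).symm.trans (this.trans (he.ev_combination b' c' 1))
    rw [hb0, hb1, inj (add_left_cancel h0)]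
  · intro a
    obtain ⟨a₀, h₀, a₁, h₁, rfl⟩ := S.exists_parts a
    obtain ⟨φ, rfl⟩ := ρ.exists_oddSec hS h₁
    -- The even part minus the lift of its reduction is even and nilpotent, so it is a multiple of
    -- `t₀t₁`.
    obtain ⟨g, hg⟩ := surj (a₀ - i (S.red U a₀))
      (mem_evenNil.2 ⟨sub_mem h₀ (even _), by rw [map_sub, red, sub_self]⟩)
    refine ⟨(S.red U a₀, V.ev le_rfl φ (e 0), V.ev le_rfl φ (e 1), g), ?_⟩
    rw [form, hg, ← he.dual_eq φ, add_sub_cancel]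

end OddTangentIso

/-! ### Projections and splittings -/

/-- The splitting defined by a projection. -/
def Projection.splitting (hS : S.IsSupermanifold 2) (hV : V.IsVectorBundle 2)
    (ρ : S.OddTangentIso V) (π : S.Projection U) : S.Splitting V U where
  toProjection := π
  -- The odd coordinates are forced by `ρ` and do not depend on the projection, because odd
  -- functions inject into `J/J²`.
  coord W _ := ρ.oddSec hS W
  coord_res _ h' φ := ρ.res_oddSec hS h' φ
  coord_smul W h f φ := by rw [ρ.even_mul_oddSec hS (π.emb_even W h f), π.red_emb]
  coord_odd W _ φ := ρ.oddSec_odd hS φ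
  isExterior x hx := by
    obtain ⟨Z, hZ, hxZ, hn, e, he⟩ := OddTangentIso.exists_frame_normal hS hV hx
    refine ⟨Z, hxZ, hZ, fun W hW h => ?_⟩
    exact exists_exterior_ringEquiv (he.res hW).dualBasis (π.emb W h : O.sec W →+* S.sec W)
      (ρ.oddSec hS W) (fun f a => even_mul_comm (π.emb_even W h f) a)
      (fun f φ => by
        change _ = π.emb W h f * _
        rw [ρ.even_mul_oddSec hS (π.emb_even W h f), π.red_emb])
      (ρ.oddSec_sq hS)
      (ρ.combination_bijective hS _ (π.emb_even W h) (π.red_emb W h) (hn W hW) (he.res hW))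

theorem Projection.splitting_induces (hS : S.IsSupermanifold 2) (hV : V.IsVectorBundle 2)
    (ρ : S.OddTangentIso V) (π : S.Projection U) : (π.splitting hS hV ρ).Induces ρ := by
  intro W h φ a ha
  rw [ρ.toDual_eq hS a ⟨_, ρ.oddSec_odd hS φ⟩, ρ.oddToDual_oddSec]
  have : (a : S.sec W) = ρ.oddSec hS W φ := ha
  rw [this, sub_self]
  exact zero_mem _

/-- An odd function is determined by its linear form. So a splitting inducing `ρ` is determined by
its underlying projection. -/
theorem Splitting.coord_eq (hS : S.IsSupermanifold 2) {ρ : S.OddTangentIso V}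
    {σ : S.Splitting V U} (hσ : σ.Induces ρ) (h : W ≤ U) (φ : V.dual W) :
    σ.coord W h φ = ρ.oddSec hS W φ := by
  have hodd := σ.coord_odd W h φ
  have e : ρ.oddToDual hS W ⟨_, hodd⟩ = φ := hσ W h φ _ rfl
  conv_rhs => rw [← e]
  rw [ρ.oddSec_oddToDual]

end SuperSheaf

end SuperGeometry

end


noncomputable section

namespace SuperGeometry

/-! ### Comparison of classes of cocycles -/

namespace Cech

variable {X : TopCat.{u}}

/-- A common refinement of two covers. -/
def Cover.inf (𝒰 𝒲 : Cover X) : Cover X where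
  nhd x := 𝒰.nhd x ⊓ 𝒲.nhd x
  mem x := ⟨𝒰.mem x, 𝒲.mem x⟩

theorem Cover.le_inf_left (𝒰 𝒲 : Cover X) : 𝒰 ≤ 𝒰.inf 𝒲 := fun _ => inf_le_left

theorem Cover.le_inf_right (𝒰 𝒲 : Cover X) : 𝒲 ≤ 𝒰.inf 𝒲 := fun _ => inf_le_right

instance : IsDirectedOrder (Cover X) :=
  ⟨fun 𝒰 𝒲 => ⟨𝒰.inf 𝒲, 𝒰.le_inf_left 𝒲, 𝒰.le_inf_right 𝒲⟩⟩

instance : Nonempty (Cover X) := ⟨⟨fun _ => ⊤, fun _ => trivial⟩⟩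

variable (F : TopCat.Presheaf AddCommGrpCat.{u} X)

theorem res_self {U : Opens X} (s : F.obj (op U)) : res F le_rfl s = s := by
  change (F.map (𝟙 _)).hom s = s
  rw [F.map_id]
  rfl

instance : DirectedSystem (H1Cover F) fun 𝒰 𝒲 h => refine F 𝒰 𝒲 h where
  map_self 𝒰 c := by
    obtain ⟨c, rfl⟩ := QuotientAddGroup.mk_surjective c
    exact congrArg _ (Subtype.ext (funext fun x => funext fun y => res_self F _))
  map_map 𝒰 𝒲 𝒵 h h' c := by
    obtain ⟨c, rfl⟩ := QuotientAddGroup.mk_surjective c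
    exact congrArg _ (Subtype.ext (funext fun x => funext fun y => res_res F _ _ _))

open scoped Classical in
theorem classOf_refine {𝒰 𝒲 : Cover X} (h : 𝒰 ≤ 𝒲) (c : cocycles F 𝒰) :
    classOf F 𝒲 (refineCocycle F 𝒰 𝒲 h c) = classOf F 𝒰 c :=
  AddCommGroup.DirectLimit.of_f (f := refine F) h (QuotientAddGroup.mk c)

theorem exists_classOf (ω : H1 F) : ∃ (𝒰 : Cover X) (c : cocycles F 𝒰), classOf F 𝒰 c = ω := by
  classical
  induction ω using AddCommGroup.DirectLimit.induction_on with
  | ih 𝒰 c =>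
    obtain ⟨c, rfl⟩ := QuotientAddGroup.mk_surjective c
    exact ⟨𝒰, c, rfl⟩

/-- Two cocycles on covers `𝒰`, `𝒰'` are cohomologous on a common refinement `𝒲`. -/
def Cohomologous {𝒰 𝒰' : Cover X} (c : cocycles F 𝒰) (c' : cocycles F 𝒰') (𝒲 : Cover X)
    (h : 𝒰 ≤ 𝒲) (h' : 𝒰' ≤ 𝒲) (b : ∀ x, F.obj (op (𝒲.nhd x))) : Prop :=
  ∀ x y, res F (inf_le_inf (h' x) (h' y)) (c'.1 x y) - res F (inf_le_inf (h x) (h y)) (c.1 x y) =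
    res F inf_le_right (b y) - res F inf_le_left (b x)

-- Covers are directed under refinement, so a class that vanishes in the direct limit already
-- vanishes on some finer cover. Applied to the difference of the two cocycles on a common
-- refinement, this produces the cochain `b`.
open scoped Classical in
theorem classOf_eq_iff {𝒰 𝒰' : Cover X} (c : cocycles F 𝒰) (c' : cocycles F 𝒰') :
    classOf F 𝒰 c = classOf F 𝒰' c' ↔ ∃ 𝒲 h h' b, Cohomologous F c c' 𝒲 h h' b := by
  constructor
  · intro e
    rw [← classOf_refine F (𝒰.le_inf_left 𝒰') c, ← classOf_refine F (𝒰.le_inf_right 𝒰') c'] at e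
    have e' := sub_eq_zero.2 e.symm
    obtain ⟨𝒲, h, e''⟩ := AddCommGroup.DirectLimit.of.zero_exact (f := refine F) _ _
      ((map_sub (AddCommGroup.DirectLimit.of (H1Cover F) (refine F) _) _ _).trans e')
    rw [← QuotientAddGroup.mk_sub] at e''
    obtain ⟨b, hb⟩ := (QuotientAddGroup.eq_zero_iff _).1 e''
    refine ⟨𝒲, (𝒰.le_inf_left 𝒰').trans h, (𝒰.le_inf_right 𝒰').trans h, b, fun x y => ?_⟩
    have := congrFun (congrFun (congrArg Subtype.val hb) x) y
    refine Eq.trans ?_ this.symm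
    change _ = res F _ (res F _ (c'.1 x y) - res F _ (c.1 x y))
    rw [map_sub, res_res, res_res]
  · rintro ⟨𝒲, h, h', b, hb⟩
    rw [← classOf_refine F h c, ← classOf_refine F h' c']
    refine congrArg (AddCommGroup.DirectLimit.of (H1Cover F) (refine F) 𝒲)
      ((QuotientAddGroup.eq).2 (AddMonoidHom.mem_range.2
      ⟨b, Subtype.ext (funext fun x => funext fun y => ?_)⟩))
    change res F _ (b y) - res F _ (b x) = -(res F _ (c.1 x y)) + res F _ (c'.1 x y)
    rw [← hb x y]
    abel

end Cech

variable {𝕜 : Type} [Field 𝕜] {X : TopCat.{u}} {O : FunctionSheaf 𝕜 X}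

/-! ### Sections of `Hom(∧²V, T)` as derivations with values in alternating forms -/

namespace ModuleSheaf

variable {V : ModuleSheaf O} {U W Z : Opens X}

/-- The derivation `O → ∧²V^∨` defined by a section of `Hom(∧²V, T)`. -/
def contract (z : V.altTangent U) (h : W ≤ U) (f : O.sec W) : V.alt W :=
  ⟨fun Z =>
    { toFun := fun v => z.1 ⟨Z.1, Z.2.trans h⟩ v (O.res Z.2 f)
      map_update_add' := fun v i x y => by
        rw [(z.1 ⟨Z.1, Z.2.trans h⟩).map_update_add]; rfl
      map_update_smul' := fun v i c x => by
        rw [(z.1 ⟨Z.1, Z.2.trans h⟩).map_update_smul]; rfl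
      map_eq_zero_of_eq' := fun v i j hv hij => by
        rw [(z.1 ⟨Z.1, Z.2.trans h⟩).map_eq_zero_of_eq v hv hij]; rfl },
    fun Z Z' hZ v => by
      refine (z.2 ⟨Z.1, Z.2.trans h⟩ ⟨Z'.1, Z'.2.trans h⟩ hZ v (O.res Z.2 f)).trans ?_
      exact congrArg _ (O.res_res _ _ f)⟩

/-- Evaluation of a section of `Hom(∧²V, T)`. -/
def tangentEv (z : V.altTangent U) (h : W ≤ U) (v : Fin 2 → V.sec W) (f : O.sec W) : O.sec W :=
  z.1 ⟨W, h⟩ v f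

theorem altEv_contract (z : V.altTangent U) (h : W ≤ U) (f : O.sec W) (h' : Z ≤ W)
    (v : Fin 2 → V.sec Z) :
    V.altEv h' (contract z h f) v = tangentEv z (h'.trans h) v (O.res h' f) := rfl

theorem altRes_contract (z : V.altTangent U) (h : W ≤ U) (f : O.sec W) (h' : Z ≤ W) :
    V.altRes h' (contract z h f) = contract z (h'.trans h) (O.res h' f) := by
  refine alt_ext fun Y hY v => ?_
  rw [altEv_altRes, altEv_contract, altEv_contract, O.res_res]

theorem contract_res (z : V.altTangent U) (h : W ≤ U) (h' : Z ≤ W) (f : O.sec Z) :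
    contract (V.altTangentRes h z) h' f = contract z (h'.trans h) f := rfl

theorem contract_add (z z' : V.altTangent U) (h : W ≤ U) (f : O.sec W) :
    contract (z + z') h f = contract z h f + contract z' h f := rfl

theorem contract_sub (z z' : V.altTangent U) (h : W ≤ U) (f : O.sec W) :
    contract (z - z') h f = contract z h f - contract z' h f :=
  eq_sub_of_add_eq (by rw [← contract_add, sub_add_cancel])

theorem contract_map_add (z : V.altTangent U) (h : W ≤ U) (f g : O.sec W) :
    contract z h (f + g) = contract z h f + contract z h g := by
  refine alt_ext fun Y hY v => ?_
  rw [altEv_add, altEv_contract, altEv_contract, altEv_contract, map_add]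
  exact map_add (z.1 ⟨Y, hY.trans h⟩ v) _ _

theorem contract_mul (z : V.altTangent U) (h : W ≤ U) (f g : O.sec W) :
    contract z h (f * g) = f • contract z h g + g • contract z h f := by
  refine alt_ext fun Y hY v => ?_
  rw [altEv_add, altEv_smul, altEv_smul, altEv_contract, altEv_contract, altEv_contract, map_mul]
  exact Derivation.leibniz (z.1 ⟨Y, hY.trans h⟩ v) _ _

theorem contract_algebraMap (z : V.altTangent U) (h : W ≤ U) (c : 𝕜) :
    contract z h (algebraMap 𝕜 (O.sec W) c) = 0 := by
  refine alt_ext fun Y hY v => ?_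
  rw [altEv_contract, AlgHom.commutes]
  exact Derivation.map_algebraMap (z.1 ⟨Y, hY.trans h⟩ v) c

/-- This moves identities in `Hom(∧²V, T)` to `∧²V^∨`, where `topSec` can compare them with
superfunctions. -/
theorem altTangent_ext {z z' : V.altTangent U} (h : ∀ (W : Opens X) (h : W ≤ U) (f : O.sec W),
    contract z h f = contract z' h f) : z = z' := by
  have key : ∀ (W : Opens X) (h : W ≤ U) (v : Fin 2 → V.sec W) (f : O.sec W),
      tangentEv z h v f = tangentEv z' h v f := by
    intro W hW v f
    have e : V.altEv le_rfl (contract z hW f) v = V.altEv le_rfl (contract z' hW f) v :=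
      congrArg (fun β => V.altEv le_rfl β v) (h W hW f)
    rwa [altEv_contract, altEv_contract, O.res_self] at e
  exact Subtype.ext (funext fun W => AlternatingMap.ext fun v => Derivation.ext fun f =>
    key W.1 W.2 v f)

/-- The alternating map defined by a derivation with values in alternating forms. -/
def altOfDerivation (D : O.sec W → V.alt W) (add : ∀ f g, D (f + g) = D f + D g)
    (mul : ∀ f g, D (f * g) = f • D g + g • D f)
    (const : ∀ c, D (algebraMap 𝕜 (O.sec W) c) = 0) :
    V.sec W [⋀^Fin 2]→ₗ[O.sec W] Derivation 𝕜 (O.sec W) (O.sec W) where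
  toFun v := Derivation.mk'
    { toFun := fun f => V.altEv le_rfl (D f) v
      map_add' := fun f g => by rw [add, altEv_add]
      map_smul' := fun c f => by
        rw [Algebra.smul_def, mul, const, smul_zero, add_zero, altEv_smul, O.res_self,
          RingHom.id_apply, Algebra.smul_def] }
    fun f g => by
      change V.altEv le_rfl (D (f * g)) v = f * V.altEv le_rfl (D g) v + g * V.altEv le_rfl (D f) v
      rw [mul, altEv_add, altEv_smul, altEv_smul, O.res_self, O.res_self]
  map_update_add' v i x y := Derivation.ext fun f =>
    ((D f).1 ⟨W, Set.mem_Iic.2 le_rfl⟩).map_update_add v i x y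
  map_update_smul' v i c x := Derivation.ext fun f =>
    ((D f).1 ⟨W, Set.mem_Iic.2 le_rfl⟩).map_update_smul v i c x
  map_eq_zero_of_eq' v i j hv hij := Derivation.ext fun f =>
    ((D f).1 ⟨W, Set.mem_Iic.2 le_rfl⟩).map_eq_zero_of_eq v hv hij

/-- The section of `Hom(∧²V, T)` defined by a derivation of `O` with values in alternating
forms. -/
def tangentOf (D : ∀ W : Opens X, W ≤ U → O.sec W → V.alt W)
    (add : ∀ W h f g, D W h (f + g) = D W h f + D W h g)
    (mul : ∀ W h f g, D W h (f * g) = f • D W h g + g • D W h f)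
    (const : ∀ W h c, D W h (algebraMap 𝕜 (O.sec W) c) = 0)
    (res : ∀ W h Z (h' : Z ≤ W) f, V.altRes h' (D W h f) = D Z (h'.trans h) (O.res h' f)) :
    V.altTangent U :=
  ⟨fun W => altOfDerivation (D W.1 W.2) (add W.1 W.2) (mul W.1 W.2) (const W.1 W.2),
    fun W W' h v f => by
      have e := V.res_altEv le_rfl (D W.1 W.2 f) v h
      refine e.trans ?_
      exact congrArg (fun β => V.altEv le_rfl β fun i => V.res h (v i)) (res W.1 W.2 W'.1 h f)⟩

theorem contract_tangentOf (D : ∀ W : Opens X, W ≤ U → O.sec W → V.alt W) (add mul const res)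
    (h : W ≤ U) (f : O.sec W) : contract (tangentOf D add mul const res) h f = D W h f := by
  refine alt_ext fun Z hZ v => ?_
  rw [altEv_contract]
  change V.altEv le_rfl (D Z (hZ.trans h) (O.res hZ f)) v = _
  rw [← res W h Z hZ f]
  rfl

theorem altEv_sum {ι : Type*} (s : Finset ι) (h : W ≤ U) (β : ι → V.alt U) (v : Fin 2 → V.sec W) :
    V.altEv h (∑ k ∈ s, β k) v = ∑ k ∈ s, V.altEv h (β k) v :=
  map_sum (AddMonoidHom.mk' (fun β => V.altEv h β v) fun _ _ => rfl) β s

end ModuleSheaf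

end SuperGeometry

end


/-! ### Cocycles and coboundaries in terms of contraction -/

noncomputable section

namespace SuperGeometry

variable {𝕜 : Type} [Field 𝕜] {X : TopCat.{u}} {O : FunctionSheaf 𝕜 X}

namespace ModuleSheaf

variable {V : ModuleSheaf O} {U W Z : Opens X}

theorem mem_cocycles_iff (𝒰 : Cech.Cover X)
    (z : ∀ x y, V.altTangent (𝒰.nhd x ⊓ 𝒰.nhd y)) :
    (fun x y => z x y : ∀ x y, V.homExtSqTangent.obj (op (𝒰.nhd x ⊓ 𝒰.nhd y))) ∈
      Cech.cocycles V.homExtSqTangent 𝒰 ↔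
    ∀ (x x' x'' : X) (W : Opens X) (h : W ≤ 𝒰.nhd x) (h' : W ≤ 𝒰.nhd x') (h'' : W ≤ 𝒰.nhd x'')
      (f : O.sec W), contract (z x x') (le_inf h h') f + contract (z x' x'') (le_inf h' h'') f =
        contract (z x x'') (le_inf h h'') f := by
  constructor
  · intro hz x x' x'' W h h' h'' f
    exact congrArg (fun t : V.altTangent W => contract t le_rfl f) (hz x x' x'' W h h' h'')
  · intro hz x x' x'' W h h' h''
    refine altTangent_ext (z := V.altTangentRes (le_inf h h') (z x x') +
      V.altTangentRes (le_inf h' h'') (z x' x'')) (z' := V.altTangentRes (le_inf h h'') (z x x''))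
      fun Z hZ f => ?_
    rw [contract_add, contract_res, contract_res, contract_res]
    exact hz x x' x'' Z (hZ.trans h) (hZ.trans h') (hZ.trans h'') f

/-- The component of a cocycle, as a section of `Hom(∧²V, T)`. -/
def component {𝒰 : Cech.Cover X} (z : Cech.cocycles V.homExtSqTangent 𝒰) (x y : X) :
    V.altTangent (𝒰.nhd x ⊓ 𝒰.nhd y) := z.1 x y

theorem contract_component_add {𝒰 : Cech.Cover X} (z : Cech.cocycles V.homExtSqTangent 𝒰)
    (x x' x'' : X) (h : W ≤ 𝒰.nhd x) (h' : W ≤ 𝒰.nhd x') (h'' : W ≤ 𝒰.nhd x'') (f : O.sec W) :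
    contract (component z x x') (le_inf h h') f + contract (component z x' x'') (le_inf h' h'') f =
      contract (component z x x'') (le_inf h h'') f :=
  (mem_cocycles_iff 𝒰 (component z)).1 z.2 x x' x'' W h h' h'' f

/-- The condition on `U x ∩ U y` is tested on functions over all smaller open sets, the form in
which differences of projections are known. -/
theorem cohomologous_iff {𝒰 𝒰' : Cech.Cover X} (z : Cech.cocycles V.homExtSqTangent 𝒰)
    (z' : Cech.cocycles V.homExtSqTangent 𝒰') (𝒲 : Cech.Cover X) (h : 𝒰 ≤ 𝒲) (h' : 𝒰' ≤ 𝒲)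
    (b : ∀ x, V.altTangent (𝒲.nhd x)) :
    Cech.Cohomologous V.homExtSqTangent z z' 𝒲 h h' b ↔
    ∀ (x y : X) (W : Opens X) (hx : W ≤ 𝒲.nhd x) (hy : W ≤ 𝒲.nhd y) (f : O.sec W),
      contract (component z' x y) (le_inf (hx.trans (h' x)) (hy.trans (h' y))) f -
        contract (component z x y) (le_inf (hx.trans (h x)) (hy.trans (h y))) f =
      contract (b y) hy f - contract (b x) hx f := by
  have key : ∀ (x y : X) (W : Opens X) (hW : W ≤ 𝒲.nhd x ⊓ 𝒲.nhd y) (f : O.sec W),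
      contract (V.altTangentRes (inf_le_inf (h' x) (h' y)) (component z' x y) -
        V.altTangentRes (inf_le_inf (h x) (h y)) (component z x y)) hW f =
      contract (component z' x y) (hW.trans (inf_le_inf (h' x) (h' y))) f -
        contract (component z x y) (hW.trans (inf_le_inf (h x) (h y))) f := by
    intro x y W hW f
    rw [contract_sub, contract_res, contract_res]
  have key' : ∀ (x y : X) (W : Opens X) (hW : W ≤ 𝒲.nhd x ⊓ 𝒲.nhd y) (f : O.sec W),
      contract (V.altTangentRes inf_le_right (b y) - V.altTangentRes inf_le_left (b x)) hW f =
      contract (b y) (hW.trans inf_le_right) f - contract (b x) (hW.trans inf_le_left) f := by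
    intro x y W hW f
    rw [contract_sub, contract_res, contract_res]
  constructor
  · intro hb x y W hx hy f
    refine (key x y W (le_inf hx hy) f).symm.trans (Eq.trans ?_ (key' x y W (le_inf hx hy) f))
    exact congrArg (fun t : V.altTangent (𝒲.nhd x ⊓ 𝒲.nhd y) => contract t (le_inf hx hy) f)
      (hb x y)
  · intro hb x y
    refine altTangent_ext (z := V.altTangentRes (inf_le_inf (h' x) (h' y)) (component z' x y) -
      V.altTangentRes (inf_le_inf (h x) (h y)) (component z x y))
      (z' := V.altTangentRes inf_le_right (b y) - V.altTangentRes inf_le_left (b x))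
      fun W hW f => ?_
    refine (key x y W hW f).trans (Eq.trans ?_ (key' x y W hW f).symm)
    exact hb x y W (hW.trans inf_le_left) (hW.trans inf_le_right) f

end ModuleSheaf

namespace SuperSheaf

open ModuleSheaf

variable {S : SuperSheaf O} {V : ModuleSheaf O} {U U' W Z : Opens X}

/-! ### Differences of projections -/

theorem Projection.sub_mem (π : S.Projection U) (π' : S.Projection U') (h : W ≤ U) (h' : W ≤ U')
    (f : O.sec W) : π'.emb W h' f - π.emb W h f ∈ S.evenNil W :=
  mem_evenNil.2 ⟨_root_.sub_mem (π'.emb_even W h' f) (π.emb_even W h f), by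
    rw [map_sub, π.red_emb, π'.red_emb, sub_self]⟩

/-- The restriction of a projection. -/
def Projection.restrict (π : S.Projection U) (h : W ≤ U) : S.Projection W where
  emb Z hZ := π.emb Z (hZ.trans h)
  emb_res hZ h' f := π.emb_res (hZ.trans h) h' f
  emb_even Z hZ f := π.emb_even Z (hZ.trans h) f
  red_emb Z hZ f := π.red_emb Z (hZ.trans h) f

namespace OddTangentIso

variable (hS : S.IsSupermanifold 2) (hV : V.IsVectorBundle 2) (ρ : S.OddTangentIso V)

/-- The difference of two projections is the derivation defined by `z`. -/
def IsDifference (π : S.Projection U) (π' : S.Projection U') (z : V.altTangent (U ⊓ U')) : Prop :=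
  ∀ (W : Opens X) (h : W ≤ U) (h' : W ≤ U') (f : O.sec W),
    ρ.topSec hS hV W (contract z (le_inf h h') f) = π'.emb W h' f - π.emb W h f

/-- Both projections lift the identity, so their difference takes values in `J² ≅ ∧²V^∨`. It is
additive, kills constants and obeys the Leibniz rule, because `J²` is acted on by even functions
only through their reductions. -/
theorem exists_isDifference (π : S.Projection U) (π' : S.Projection U') :
    ∃ z, ρ.IsDifference hS hV π π' z := by
  choose D hD using fun (W : Opens X) (h : W ≤ U ⊓ U') (f : O.sec W) =>
    ρ.exists_topSec_eq hS hV
      (π.sub_mem π' (h.trans inf_le_left) (h.trans inf_le_right) f)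
  refine ⟨tangentOf D (fun W h f g => ρ.topSec_injective hS hV W ?_)
    (fun W h f g => ρ.topSec_injective hS hV W ?_) (fun W h c => ρ.topSec_injective hS hV W ?_)
    fun W h Z h' f => ρ.topSec_injective hS hV Z ?_, fun W h h' f => ?_⟩
  · rw [map_add, hD, hD, hD, map_add, map_add]
    abel
  -- Leibniz rule: `π'(fg) - π(fg) = π'(f)(π'(g) - π(g)) + π(g)(π'(f) - π(f))`, where `π'(f)` and
  -- `π(g)` act on `J²` as `f` and `g`.
  · have e1 := ρ.even_mul_topSec hS hV (π'.emb_even W (h.trans inf_le_right) f) (D W h g)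
    have e2 := ρ.even_mul_topSec hS hV (π.emb_even W (h.trans inf_le_left) g) (D W h f)
    rw [π'.red_emb] at e1
    rw [π.red_emb] at e2
    rw [map_add, ← e1, ← e2, hD, hD, hD, map_mul, map_mul, mul_sub, mul_sub,
      even_mul_comm (π.emb_even W _ g), even_mul_comm (π.emb_even W _ g) (π.emb W _ f)]
    abel
  · rw [hD, map_zero, AlgHom.commutes, AlgHom.commutes, sub_self]
  · rw [← res_topSec, hD, hD, map_sub, π.emb_res, π'.emb_res]
  · rw [contract_tangentOf, hD]

/-- The transition between two splittings is the difference of their projections. -/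
theorem isTransition_iff {σ : S.Splitting V U} {τ : S.Splitting V U'} (hσ : σ.Induces ρ)
    (z : V.altTangent (U ⊓ U')) :
    IsTransition σ τ z ↔ ρ.IsDifference hS hV σ.toProjection τ.toProjection z := by
  constructor
  · intro H W h h' f
    refine S.isSheafRes.sep W _ _ fun x hx => ?_
    obtain ⟨Z, hZ, hxZ, r, φ, ψ, hJ, hz⟩ := H W h h' f x hx
    refine ⟨Z, hZ, hxZ, ?_⟩
    -- Since `J³ = 0`, the congruence in the definition of a transition is an equality.
    have e1 := sub_eq_zero.1 (hS.eq_zero_of_mem_J_three hJ)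
    rw [map_sub, e1, res_topSec, altRes_contract]
    have e2 : contract z (hZ.trans (le_inf h h')) (O.res hZ f) =
        ∑ k, V.wedge Z (φ k) (ψ k) := by
      refine alt_ext fun Y hY v => ?_
      have hv : v = ![v 0, v 1] := by
        funext i
        fin_cases i <;> rfl
      rw [altEv_contract, altEv_sum, O.res_res, hv]
      exact hz Y hY (v 0) (v 1)
    rw [e2, map_sum]
    refine Finset.sum_congr rfl fun k _ => ?_
    rw [σ.coord_eq hS hσ, σ.coord_eq hS hσ, topSec_wedge]
  · intro H W h h' f x hx
    obtain ⟨Z, hZ, hxZ, e, he⟩ := hV.exists_frame hx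
    -- Over a frame a form is a single exterior product, so one summand suffices.
    refine ⟨Z, hZ, hxZ, 1, fun _ => V.altEv le_rfl (contract z (hZ.trans (le_inf h h'))
      (O.res hZ f)) e • he.dualFrame 0, fun _ => he.dualFrame 1, ?_, fun Y hY v w => ?_⟩
    · rw [Fin.sum_univ_one, σ.coord_eq hS hσ, σ.coord_eq hS hσ, ← ρ.topSec_wedge hS hV,
        ← he.alt_eq, H Z (hZ.trans h) (hZ.trans h') (O.res hZ f)]
      rw [← τ.emb_res h' hZ, ← σ.emb_res h hZ, sub_self]
      exact zero_mem _
    · rw [Fin.sum_univ_one]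
      have e3 := congrArg (fun β => V.altEv hY β ![v, w])
        (he.alt_eq (contract z (hZ.trans (le_inf h h')) (O.res hZ f)))
      refine Eq.trans ?_ e3
      rw [altEv_contract, O.res_res]
      rfl

/-- `z` is the cocycle of differences of local projections. -/
def IsDifferenceCocycle (𝒰 : Cech.Cover X) (π : ∀ x, S.Projection (𝒰.nhd x))
    (z : Cech.cocycles V.homExtSqTangent 𝒰) : Prop :=
  ∀ x y, ρ.IsDifference hS hV (π x) (π y) (component z x y)

/-- Splittings that induce `ρ` may be replaced by their projections, as each projection extends to
such a splitting. From here on only projections matter. -/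
theorem isFirstObstruction_iff (ω : Cech.H1 V.homExtSqTangent) :
    S.IsFirstObstruction ρ ω ↔ ∃ (𝒰 : Cech.Cover X) (π : ∀ x, S.Projection (𝒰.nhd x))
      (z : Cech.cocycles V.homExtSqTangent 𝒰), ρ.IsDifferenceCocycle hS hV 𝒰 π z ∧
        Cech.classOf V.homExtSqTangent 𝒰 z = ω := by
  constructor
  · rintro ⟨𝒰, σ, z, hσ, hz, rfl⟩
    exact ⟨𝒰, fun x => (σ x).toProjection, z,
      fun x y => (ρ.isTransition_iff hS hV (hσ x) _).1 (hz x y), rfl⟩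
  · rintro ⟨𝒰, π, z, hz, rfl⟩
    exact ⟨𝒰, fun x => (π x).splitting hS hV ρ, z, fun x => (π x).splitting_induces hS hV ρ,
      fun x y => (ρ.isTransition_iff hS hV ((π x).splitting_induces hS hV ρ) _).2 (hz x y), rfl⟩

/-- The cocycle identity is the telescoping of differences of projections, transported through the
injective map `topSec`. -/
theorem exists_isDifferenceCocycle (𝒰 : Cech.Cover X) (π : ∀ x, S.Projection (𝒰.nhd x)) :
    ∃ z, ρ.IsDifferenceCocycle hS hV 𝒰 π z := by
  choose z hz using fun x y => ρ.exists_isDifference hS hV (π x) (π y)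
  refine ⟨⟨z, (mem_cocycles_iff 𝒰 z).2 fun x x' x'' W h h' h'' f =>
    ρ.topSec_injective hS hV W ?_⟩, hz⟩
  rw [map_add, hz x x' W h h' f, hz x' x'' W h' h'' f, hz x x'' W h h'' f]
  abel

include hS hV in
theorem exists_isFirstObstruction : ∃ ω, S.IsFirstObstruction ρ ω := by
  -- The cover consists of domains of odd coordinates, each of which contains a projection.
  choose U hU hc using hS
  obtain ⟨z, hz⟩ := ρ.exists_isDifferenceCocycle (fun x => ⟨U x, hU x, hc x⟩) hV ⟨U, hU⟩
    fun x => (hc x).some.toProjection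
  exact ⟨_, (ρ.isFirstObstruction_iff _ hV _).2 ⟨_, _, z, hz, rfl⟩⟩

/-- With `b x` the difference `π'_x - π_x`, both `z' - z` and the coboundary of `b` equal `(π'_y -
π'_x) - (π_y - π_x)`. -/
theorem cohomologous_of_isDifferenceCocycle {𝒰 𝒰' : Cech.Cover X}
    {π : ∀ x, S.Projection (𝒰.nhd x)} {π' : ∀ x, S.Projection (𝒰'.nhd x)}
    {z : Cech.cocycles V.homExtSqTangent 𝒰} {z' : Cech.cocycles V.homExtSqTangent 𝒰'}
    (hz : ρ.IsDifferenceCocycle hS hV 𝒰 π z) (hz' : ρ.IsDifferenceCocycle hS hV 𝒰' π' z')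
    (𝒲 : Cech.Cover X) (h : 𝒰 ≤ 𝒲) (h' : 𝒰' ≤ 𝒲) (b : ∀ x, V.altTangent (𝒲.nhd x))
    (hb : ∀ (x : X) (W : Opens X) (hx : W ≤ 𝒲.nhd x) (f : O.sec W),
      ρ.topSec hS hV W (contract (b x) hx f) =
        (π' x).emb W (hx.trans (h' x)) f - (π x).emb W (hx.trans (h x)) f) :
    Cech.Cohomologous V.homExtSqTangent z z' 𝒲 h h' b := by
  refine (cohomologous_iff z z' 𝒲 h h' b).2 fun x y W hx hy f => ρ.topSec_injective hS hV W ?_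
  rw [map_sub, map_sub, hb, hb, hz x y W (hx.trans (h x)) (hy.trans (h y)) f,
    hz' x y W (hx.trans (h' x)) (hy.trans (h' y)) f]
  abel

theorem exists_difference (π : S.Projection U) (π' : S.Projection U') (hZ : Z ≤ U)
    (hZ' : Z ≤ U') : ∃ b : V.altTangent Z, ∀ (W : Opens X) (h : W ≤ Z) (f : O.sec W),
      ρ.topSec hS hV W (contract b h f) = π'.emb W (h.trans hZ') f - π.emb W (h.trans hZ) f := by
  obtain ⟨z, hz⟩ := ρ.exists_isDifference hS hV π π'
  refine ⟨V.altTangentRes (le_inf hZ hZ') z, fun W h f => ?_⟩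
  rw [contract_res]
  exact hz W (h.trans hZ) (h.trans hZ') f

theorem classOf_eq_of_isDifferenceCocycle {𝒰 𝒰' : Cech.Cover X}
    {π : ∀ x, S.Projection (𝒰.nhd x)} {π' : ∀ x, S.Projection (𝒰'.nhd x)}
    {z : Cech.cocycles V.homExtSqTangent 𝒰} {z' : Cech.cocycles V.homExtSqTangent 𝒰'}
    (hz : ρ.IsDifferenceCocycle hS hV 𝒰 π z) (hz' : ρ.IsDifferenceCocycle hS hV 𝒰' π' z') :
    Cech.classOf V.homExtSqTangent 𝒰 z = Cech.classOf V.homExtSqTangent 𝒰' z' := by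
  choose b hb using fun x => ρ.exists_difference hS hV (π x) (π' x)
    (𝒰.le_inf_left 𝒰' x) (𝒰.le_inf_right 𝒰' x)
  exact (Cech.classOf_eq_iff _ z z').2 ⟨𝒰.inf 𝒰', 𝒰.le_inf_left 𝒰', 𝒰.le_inf_right 𝒰', b,
    ρ.cohomologous_of_isDifferenceCocycle hS hV hz hz' _ _ _ b hb⟩

include hS hV in
theorem existsUnique_isFirstObstruction : ∃! ω, S.IsFirstObstruction ρ ω := by
  obtain ⟨ω, hω⟩ := ρ.exists_isFirstObstruction hS hV
  refine ⟨ω, hω, fun ω' hω' => ?_⟩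
  obtain ⟨𝒰, π, z, hz, rfl⟩ := (ρ.isFirstObstruction_iff hS hV ω).1 hω
  obtain ⟨𝒰', π', z', hz', rfl⟩ := (ρ.isFirstObstruction_iff hS hV ω').1 hω'
  exact ρ.classOf_eq_of_isDifferenceCocycle hS hV hz' hz

end OddTangentIso

end SuperSheaf

end SuperGeometry

end


noncomputable section

namespace SuperGeometry

variable {𝕜 : Type} [Field 𝕜] {X : TopCat.{u}} {O : FunctionSheaf 𝕜 X}

/-! ### The algebra defined by a cocycle -/

namespace ModuleSheaf

variable (V : ModuleSheaf O) (𝒰 : Cech.Cover X) {U W Z : Opens X}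

/-- Families of alternating forms on the members of a cover. -/
def AltFamily (U : Opens X) : Type u := ∀ x : X, V.alt (U ⊓ 𝒰.nhd x)

instance (U : Opens X) : AddCommGroup (V.AltFamily 𝒰 U) := Pi.addCommGroup

instance (U : Opens X) : AddCommMonoid (V.AltFamily 𝒰 U) :=
  (inferInstance : AddCommGroup (V.AltFamily 𝒰 U)).toAddCommMonoid

instance (U : Opens X) : Module (O.sec U) (V.AltFamily 𝒰 U) :=
  letI (x : X) : Module (O.sec U) (V.alt (U ⊓ 𝒰.nhd x)) :=
    Module.compHom (V.alt (U ⊓ 𝒰.nhd x))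
      (O.res (inf_le_left : U ⊓ 𝒰.nhd x ≤ U)).toRingHom
  Pi.module X (fun x => V.alt (U ⊓ 𝒰.nhd x)) (O.sec U)

/-- The exterior product, with values in families of alternating forms. -/
def wedgeFamily (U : Opens X) : V.dual U →ₗ[O.sec U] V.dual U →ₗ[O.sec U] V.AltFamily 𝒰 U :=
  (V.wedge U).compr₂
    { toFun := fun β _ => V.altRes inf_le_left β
      map_add' := fun _ _ => rfl
      map_smul' := fun f β => funext fun _ => V.altRes_smul inf_le_left β f }

/-- The algebra of triples of a function, a linear form, and a family of alternating forms. -/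
def Triple (U : Opens X) : Type u := PairingAlgebra (V.wedgeFamily 𝒰 U)

instance (U : Opens X) : Ring (V.Triple 𝒰 U) := inferInstanceAs (Ring (PairingAlgebra _))

instance (U : Opens X) : Algebra 𝕜 (V.Triple 𝒰 U) := inferInstanceAs (Algebra 𝕜 (PairingAlgebra _))

variable {V 𝒰}

theorem altRes_combination (h : W ≤ U) (h' : Z ≤ W) (f g : O.sec U) (α β : V.alt W)
    (γ : V.alt U) : V.altRes h' (O.res h f • α + O.res h g • β + V.altRes h γ) =
      O.res (h'.trans h) f • V.altRes h' α + O.res (h'.trans h) g • V.altRes h' β +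
        V.altRes (h'.trans h) γ := by
  rw [map_add (V.altRes h') (O.res h f • α + O.res h g • β),
    map_add (V.altRes h') (O.res h f • α), altRes_smul, altRes_smul, O.res_res h h' f,
    O.res_res h h' g, altRes_res V h h' γ]

namespace Triple

/-- The triple with given components. -/
def mk (f : O.sec U) (φ : V.dual U) (α : ∀ x : X, V.alt (U ⊓ 𝒰.nhd x)) : V.Triple 𝒰 U :=
  PairingAlgebra.mk f φ α

/-- The function in a triple. -/
def fn (a : V.Triple 𝒰 U) : O.sec U := PairingAlgebra.fn a

/-- The linear form in a triple. -/
def lin (a : V.Triple 𝒰 U) : V.dual U := PairingAlgebra.lin a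

/-- The alternating form of index `x` in a triple. -/
def top (a : V.Triple 𝒰 U) (x : X) (h : W ≤ U) (hx : W ≤ 𝒰.nhd x) : V.alt W :=
  V.altRes (le_inf h hx) (PairingAlgebra.top a x)

variable (a b : V.Triple 𝒰 U) (f : O.sec U) (φ : V.dual U) (α : ∀ x : X, V.alt (U ⊓ 𝒰.nhd x))
  (c : 𝕜) (x : X) (h : W ≤ U) (hx : W ≤ 𝒰.nhd x)

theorem fn_mk : (mk f φ α).fn = f := rfl

theorem lin_mk : (mk f φ α).lin = φ := rfl

theorem top_mk : (mk f φ α).top x h hx = V.altRes (le_inf h hx) (α x) := rfl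

theorem fn_add : (a + b).fn = a.fn + b.fn := rfl

theorem lin_add : (a + b).lin = a.lin + b.lin := rfl

theorem top_add : (a + b).top x h hx = a.top x h hx + b.top x h hx := rfl

theorem fn_mul : (a * b).fn = a.fn * b.fn := rfl

theorem lin_mul : (a * b).lin = a.fn • b.lin + b.fn • a.lin := rfl

theorem top_mul : (a * b).top x h hx = O.res h a.fn • b.top x h hx +
    O.res h b.fn • a.top x h hx + V.wedge W (V.dualRes h a.lin) (V.dualRes h b.lin) := by
  have e : PairingAlgebra.top (a * b) x =
      O.res (inf_le_left : U ⊓ 𝒰.nhd x ≤ U) a.fn • PairingAlgebra.top b x +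
      O.res (inf_le_left : U ⊓ 𝒰.nhd x ≤ U) b.fn • PairingAlgebra.top a x +
      V.altRes (inf_le_left : U ⊓ 𝒰.nhd x ≤ U) (V.wedge U a.lin b.lin) := rfl
  refine (congrArg (V.altRes (le_inf h hx)) e).trans ?_
  rw [altRes_combination, altRes_wedge]
  rfl

theorem algebraMap_eq : algebraMap 𝕜 (V.Triple 𝒰 U) c = mk (algebraMap 𝕜 (O.sec U) c) 0 0 := rfl

/-- The restriction of a triple. -/
def res (h : W ≤ U) (a : V.Triple 𝒰 U) : V.Triple 𝒰 W :=
  mk (O.res h a.fn) (V.dualRes h a.lin) fun x => a.top x (inf_le_left.trans h) inf_le_right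

theorem fn_res : (a.res h).fn = O.res h a.fn := rfl

theorem lin_res : (a.res h).lin = V.dualRes h a.lin := rfl

theorem top_res (h' : Z ≤ W) (hx : Z ≤ 𝒰.nhd x) :
    (a.res h).top x h' hx = a.top x (h'.trans h) hx := rfl

theorem altRes_top (h' : Z ≤ W) :
    V.altRes h' (a.top x h hx) = a.top x (h'.trans h) (h'.trans hx) := rfl

variable {a b} in
@[ext]
theorem ext (h₁ : a.fn = b.fn) (h₂ : a.lin = b.lin)
    (h₃ : ∀ x, a.top x inf_le_left inf_le_right = b.top x inf_le_left inf_le_right) : a = b :=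
  PairingAlgebra.ext h₁ h₂ (funext fun x => h₃ x)

end Triple

theorem smul_combination_sub {R M : Type*} [Ring R] [AddCommGroup M] [Module R M] (f g : R)
    (p q r s t : M) :
    f • p + g • q + t - (f • r + g • s + t) = f • (p - r) + g • (q - s) := by
  rw [smul_sub, smul_sub]
  abel

/-- The algebra of sections over `U` of the supermanifold defined by a cocycle. -/
def twistedAlgebra (z : Cech.cocycles V.homExtSqTangent 𝒰) (U : Opens X) :
    Subalgebra 𝕜 (V.Triple 𝒰 U) where
  -- The component `α_x` is meant relative to a projection `π_x`: if `π_x(f) + φ + α_x = π_y(f) + φ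
  -- + α_y`, then `α_x - α_y = π_y(f) - π_x(f) = z_xy(f)`.
  carrier := {a | ∀ (x y : X) (W : Opens X) (h : W ≤ U) (hx : W ≤ 𝒰.nhd x) (hy : W ≤ 𝒰.nhd y),
    a.top x h hx - a.top y h hy = contract (component z x y) (le_inf hx hy) (O.res h a.fn)}
  -- The wedge of the linear parts does not depend on the index and cancels; what remains is the
  -- Leibniz rule for `z_xy`.
  mul_mem' {a b} ha hb x y W h hx hy := by
    rw [Triple.top_mul, Triple.top_mul, Triple.fn_mul, map_mul (O.res h) a.fn b.fn, contract_mul]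
    exact (smul_combination_sub _ _ _ _ _ _ _).trans (congrArg₂
      (fun α β => O.res h a.fn • α + O.res h b.fn • β) (hb x y W h hx hy) (ha x y W h hx hy))
  add_mem' {a b} ha hb x y W h hx hy := by
    rw [Triple.top_add, Triple.top_add, Triple.fn_add, map_add (O.res h) a.fn b.fn,
      contract_map_add]
    refine Eq.trans ?_ (congrArg₂ (· + ·) (ha x y W h hx hy) (hb x y W h hx hy))
    exact add_sub_add_comm _ _ _ _
  algebraMap_mem' c := by
    intro x y W h hx hy
    rw [Triple.algebraMap_eq, Triple.fn_mk, AlgHom.commutes (O.res h) c, contract_algebraMap]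
    exact sub_self (0 : V.alt W)

theorem mem_twistedAlgebra {z : Cech.cocycles V.homExtSqTangent 𝒰} {a : V.Triple 𝒰 U} :
    a ∈ twistedAlgebra z U ↔ ∀ (x y : X) (W : Opens X) (h : W ≤ U) (hx : W ≤ 𝒰.nhd x)
      (hy : W ≤ 𝒰.nhd y), a.top x h hx - a.top y h hy =
        contract (component z x y) (le_inf hx hy) (O.res h a.fn) := Iff.rfl

end ModuleSheaf

namespace SuperSheaf

open ModuleSheaf

variable {S S' : SuperSheaf O} {V : ModuleSheaf O} {U U' W Z : Opens X}

theorem map_add_add {A B : Type*} [AddCommGroup A] [AddCommGroup B] (F : A →+ B) (a b c : A) :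
    F (a + b + c) = F a + F b + F c := by
  rw [map_add, map_add]

theorem add_add_eq {A : Type*} [AddCommGroup A] {a b c d e : A} (h : a - b = c - d) :
    d + e + a = c + e + b := by
  rw [sub_eq_sub_iff_add_eq_add] at h
  rw [add_right_comm, add_right_comm c, add_comm d, h]

theorem sub_eq_of_add_add_eq {A : Type*} [AddCommGroup A] {a b c d e : A}
    (h : d + e + a = c + e + b) : a - b = c - d := by
  rw [sub_eq_sub_iff_add_eq_add]
  rw [add_right_comm, add_right_comm c] at h
  rw [add_comm, add_right_cancel h]

theorem parts_mul {R : Type*} [Ring R] (e e' o o' t t' : R) (h₁ : o * e' = e' * o)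
    (h₂ : t * e' = e' * t) (h₃ : t * o' = 0) (h₄ : o * t' = 0) (h₅ : t * t' = 0) :
    (e + o + t) * (e' + o' + t') =
      e * e' + (e * o' + e' * o) + (e * t' + e' * t + o * o') := by
  rw [add_mul, add_mul, mul_add, mul_add, mul_add, mul_add, mul_add, mul_add, h₁, h₂, h₃, h₄, h₅]
  abel

/-! ### Superfunctions as triples relative to local projections -/

namespace OddTangentIso

variable (hS : S.IsSupermanifold 2) (hV : V.IsVectorBundle 2) (ρ : S.OddTangentIso V)
  {𝒰 : Cech.Cover X} (π : ∀ x, S.Projection (𝒰.nhd x))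

/-- The superfunction `s` is represented by the triple `a` with respect to local projections. -/
def Represents (s : S.sec U) (a : V.Triple 𝒰 U) : Prop :=
  ∀ (x : X) (W : Opens X) (h : W ≤ U) (hx : W ≤ 𝒰.nhd x),
    S.res h s = (π x).emb W hx (O.res h a.fn) + ρ.oddSec hS W (V.dualRes h a.lin) +
      ρ.topSec hS hV W (a.top x h hx)

variable {hS hV ρ π} {s t : S.sec U} {a b : V.Triple 𝒰 U}

theorem Represents.unique_left (hs : ρ.Represents hS hV π s a) (ht : ρ.Represents hS hV π t a) :
    s = t :=
  S.isSheafRes.sep U _ _ fun x hx => ⟨U ⊓ 𝒰.nhd x, inf_le_left, ⟨hx, 𝒰.mem x⟩, by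
    rw [hs x _ inf_le_left inf_le_right, ht x _ inf_le_left inf_le_right]⟩

theorem Represents.add (hs : ρ.Represents hS hV π s a) (ht : ρ.Represents hS hV π t b) :
    ρ.Represents hS hV π (s + t) (a + b) := by
  intro x W h hx
  rw [map_add, hs x W h hx, ht x W h hx, Triple.top_add, Triple.fn_add, Triple.lin_add]
  simp only [map_add]
  abel

/-- The product of triples mirrors that of superfunctions: top parts annihilate nilpotents, and two
odd functions multiply to the image of the wedge of their linear forms. -/
theorem Represents.mul (hs : ρ.Represents hS hV π s a) (ht : ρ.Represents hS hV π t b) :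
    ρ.Represents hS hV π (s * t) (a * b) := by
  intro x W h hx
  have emb : ∀ f φ, ρ.oddSec hS W (f • φ) = (π x).emb W hx f * ρ.oddSec hS W φ := fun f φ => by
    rw [ρ.even_mul_oddSec hS ((π x).emb_even W hx f), (π x).red_emb]
  have emb' : ∀ f β, ρ.topSec hS hV W (f • β) = (π x).emb W hx f * ρ.topSec hS hV W β :=
    fun f β => by rw [ρ.even_mul_topSec hS hV ((π x).emb_even W hx f), (π x).red_emb]
  have top : ∀ β c, S.red W c = 0 → ρ.topSec hS hV W β * c = 0 :=
    fun β c hc => hS.evenNil_mul (ρ.topSec_mem hS hV β) hc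
  have comm : ∀ f c, c * (π x).emb W hx f = (π x).emb W hx f * c :=
    fun f c => (even_mul_comm ((π x).emb_even W hx f) c).symm
  have comm' : ∀ β c, c * ρ.topSec hS hV W β = ρ.topSec hS hV W β * c :=
    fun β c => (even_mul_comm (ρ.topSec_mem hS hV β).1 c).symm
  have red := fun φ => ρ.red_oddSec hS (U := W) φ
  have e1 : (π x).emb W hx (O.res h (a * b).fn) =
      (π x).emb W hx (O.res h a.fn) * (π x).emb W hx (O.res h b.fn) := by
    rw [Triple.fn_mul, map_mul (O.res h) a.fn b.fn, map_mul ((π x).emb W hx)]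
  have e2 : ρ.oddSec hS W (V.dualRes h (a * b).lin) =
      (π x).emb W hx (O.res h a.fn) * ρ.oddSec hS W (V.dualRes h b.lin) +
        (π x).emb W hx (O.res h b.fn) * ρ.oddSec hS W (V.dualRes h a.lin) :=
    (congrArg (fun φ => ρ.oddSec hS W (V.dualRes h φ)) (Triple.lin_mul a b)).trans
      ((map_add ((ρ.oddSec hS W).comp (V.dualRes h)) _ _).trans (congrArg₂ (· + ·)
        ((congrArg (ρ.oddSec hS W) (V.dualRes_smul h _ _)).trans (emb _ _))
        ((congrArg (ρ.oddSec hS W) (V.dualRes_smul h _ _)).trans (emb _ _))))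
  have e3 : ρ.topSec hS hV W ((a * b).top x h hx) =
      (π x).emb W hx (O.res h a.fn) * ρ.topSec hS hV W (b.top x h hx) +
        (π x).emb W hx (O.res h b.fn) * ρ.topSec hS hV W (a.top x h hx) +
        ρ.oddSec hS W (V.dualRes h a.lin) * ρ.oddSec hS W (V.dualRes h b.lin) :=
    (congrArg (ρ.topSec hS hV W) (Triple.top_mul a b x h hx)).trans
      ((map_add_add (ρ.topSec hS hV W) _ _ _).trans (congrArg₂ (· + ·)
        (congrArg₂ (· + ·) (emb' _ _) (emb' _ _)) (ρ.topSec_wedge hS hV _ _)))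
  rw [map_mul (S.res h), hs x W h hx, ht x W h hx, e1, e2, e3]
  exact parts_mul _ _ _ _ _ _ (comm _ _) (comm _ _) (top _ _ (red _))
    ((comm' _ _).trans (top _ _ (red _)))
    (top _ _ (mem_evenNil.1 (ρ.topSec_mem hS hV (U := W) _)).2)

theorem Represents.algebraMap (c : 𝕜) : ρ.Represents hS hV π (algebraMap 𝕜 (S.sec U) c)
    (algebraMap 𝕜 (V.Triple 𝒰 U) c) := by
  intro x W h hx
  rw [AlgHom.commutes, Triple.algebraMap_eq, Triple.fn_mk,
    Triple.lin_mk, Triple.top_mk, Pi.zero_apply, map_zero, AlgHom.commutes, AlgHom.commutes, map_zero, map_zero,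
    map_zero, add_zero, add_zero]

theorem Represents.red (hs : ρ.Represents hS hV π s a) : S.red U s = a.fn :=
  O.isSheafRes.sep U _ _ fun x hx => ⟨U ⊓ 𝒰.nhd x, inf_le_left, ⟨hx, 𝒰.mem x⟩, by
    rw [← red_res, hs x _ inf_le_left inf_le_right, map_add, map_add, (π x).red_emb, red_oddSec,
      (mem_evenNil.1 (ρ.topSec_mem hS hV _)).2, add_zero, add_zero]⟩

theorem Represents.sub_even (hs : ρ.Represents hS hV π s a) :
    s - ρ.oddSec hS U a.lin ∈ S.part U 0 :=
  mem_part_of_locally 0 _ fun x hx => ⟨U ⊓ 𝒰.nhd x, inf_le_left, ⟨hx, 𝒰.mem x⟩, by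
    rw [map_sub, hs x _ inf_le_left inf_le_right, res_oddSec, add_right_comm, add_sub_cancel_right]
    exact add_mem ((π x).emb_even _ _ _) (ρ.topSec_mem hS hV _).1⟩

/-- The linear form of a triple is that of the odd part of the superfunction, so it does not depend
on the projections. -/
theorem Represents.eq_lin (hs : ρ.Represents hS hV π s a) {φ : V.dual U}
    (h : s - ρ.oddSec hS U φ ∈ S.part U 0) : a.lin = φ := by
  have h' := sub_mem h hs.sub_even
  rw [sub_sub_sub_cancel_left, ← map_sub] at h'
  have := eq_zero_of_even_of_odd h' (ρ.oddSec_odd hS _)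
  exact sub_eq_zero.1 (ρ.oddSec_injective hS U (this.trans (map_zero _).symm))

theorem Represents.unique_right (hs : ρ.Represents hS hV π s a)
    (ht : ρ.Represents hS hV π s b) : a = b := by
  have h1 : a.fn = b.fn := hs.red.symm.trans ht.red
  have h2 : a.lin = b.lin := hs.eq_lin ht.sub_even
  refine Triple.ext h1 h2 (fun x => ρ.topSec_injective hS hV _ ?_)
  have := (hs x _ inf_le_left inf_le_right).symm.trans (ht x _ inf_le_left inf_le_right)
  rw [h1, h2] at this
  exact add_left_cancel this

theorem Represents.res (hs : ρ.Represents hS hV π s a) (h : W ≤ U) :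
    ρ.Represents hS hV π (S.res h s) (a.res h) := by
  intro x Z hZ hx
  rw [res_res, hs x Z (hZ.trans h) hx, Triple.fn_res, Triple.lin_res, O.res_res, Triple.top_res]
  rfl

theorem represents_oddSec (φ : V.dual U) :
    ρ.Represents hS hV π (ρ.oddSec hS U φ) (Triple.mk 0 φ 0 : V.Triple 𝒰 U) := by
  intro x W h hx
  have : Triple.top (Triple.mk 0 φ 0 : V.Triple 𝒰 U) x h hx = 0 := rfl
  rw [this, map_zero (ρ.topSec hS hV W), add_zero, res_oddSec, Triple.fn_mk, Triple.lin_mk,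
    map_zero (O.res h), map_zero ((π x).emb W hx), zero_add]

theorem add_eq_add_add_sub {A : Type*} [AddCommGroup A] (a b c : A) : a + b = c + b + (a - c) := by
  abel

theorem exists_represents (s : S.sec U) : ∃ a : V.Triple 𝒰 U, ρ.Represents hS hV π s a := by
  obtain ⟨s₀, h₀, s₁, h₁, rfl⟩ := S.exists_parts s
  obtain ⟨φ, rfl⟩ := ρ.exists_oddSec hS h₁
  -- `α_x` is the form of the even part minus the lift by `π_x` of its reduction.
  choose α hα using fun x => ρ.exists_topSec_eq hS hV (U := U ⊓ 𝒰.nhd x)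
    (k := S.res inf_le_left s₀ - (π x).emb _ inf_le_right (O.res inf_le_left (S.red U s₀)))
    (mem_evenNil.2 ⟨sub_mem (S.res_mem _ h₀) ((π x).emb_even _ _ _), by
      rw [map_sub, (π x).red_emb, red_res, sub_self]⟩)
  refine ⟨Triple.mk (S.red U s₀) φ α, fun x W h hx => ?_⟩
  have e := congrArg (S.res (le_inf h hx)) (hα x)
  rw [res_topSec, map_sub, res_res, (π x).emb_res, O.res_res] at e
  change _ = _ + _ + ρ.topSec hS hV W (V.altRes (le_inf h hx) (α x))
  rw [e, Triple.fn_mk, Triple.lin_mk, map_add (S.res h), res_oddSec]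
  exact add_eq_add_add_sub _ _ _

variable {z : Cech.cocycles V.homExtSqTangent 𝒰} (hz : ρ.IsDifferenceCocycle hS hV 𝒰 π z)

include hz

/-- Equating the expressions relative to `π_x` and `π_y` cancels the odd part and leaves the
defining condition of `twistedAlgebra`. -/
theorem Represents.mem (hs : ρ.Represents hS hV π s a) : a ∈ twistedAlgebra z U := by
  refine mem_twistedAlgebra.2 fun x y W h hx hy => ρ.topSec_injective hS hV W ?_
  have e := (hs x W h hx).symm.trans (hs y W h hy)
  rw [map_sub (ρ.topSec hS hV W), hz x y W hx hy (O.res h a.fn)]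
  exact sub_eq_of_add_add_eq e

theorem represented_compatible (ha : a ∈ twistedAlgebra z U) (x y : X) (h : W ≤ U)
    (hx : W ≤ 𝒰.nhd x) (hy : W ≤ 𝒰.nhd y) :
    (π x).emb W hx (O.res h a.fn) + ρ.oddSec hS W (V.dualRes h a.lin) +
      ρ.topSec hS hV W (a.top x h hx) =
    (π y).emb W hy (O.res h a.fn) + ρ.oddSec hS W (V.dualRes h a.lin) +
      ρ.topSec hS hV W (a.top y h hy) := by
  have e := congrArg (ρ.topSec hS hV W) (mem_twistedAlgebra.1 ha x y W h hx hy)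
  rw [hz x y W hx hy (O.res h a.fn), map_sub (ρ.topSec hS hV W)] at e
  exact add_add_eq e

/-- The defining condition of `twistedAlgebra` says precisely that the local expressions agree on
overlaps, so they glue. Hence the sections of `S` are identified with an algebra depending only on
`z`. -/
theorem exists_represented (ha : a ∈ twistedAlgebra z U) :
    ∃ s, ρ.Represents hS hV π s a := by
  obtain ⟨s, hs⟩ := S.isSheafRes.glue U (fun W t => ∃ (x : X) (h : W ≤ U) (hx : W ≤ 𝒰.nhd x),
      t = (π x).emb W hx (O.res h a.fn) + ρ.oddSec hS W (V.dualRes h a.lin) +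
        ρ.topSec hS hV W (a.top x h hx))
    (fun x hx => ⟨U ⊓ 𝒰.nhd x, inf_le_left, ⟨hx, 𝒰.mem x⟩, _, x, inf_le_left, inf_le_right, rfl⟩)
    (by
      rintro W Z h _ ⟨x, hW, hx, rfl⟩
      refine ⟨x, h.trans hW, h.trans hx, (map_add_add (S.res h : S.sec W →+ S.sec Z) _ _ _).trans
        (congrArg₂ (· + ·) (congrArg₂ (· + ·) ?_ ?_) ?_)⟩
      · exact ((π x).emb_res hx h _).trans (congrArg _ (O.res_res hW h a.fn))
      · exact (ρ.res_oddSec hS h _)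
      · exact (ρ.res_topSec hS hV h _))
    (by
      rintro W _ _ - ⟨x, h, hx, rfl⟩ ⟨y, _, hy, rfl⟩
      exact represented_compatible hz ha x y h hx hy)
  exact ⟨s, fun x W h hx => hs W h _ ⟨x, h, hx, rfl⟩⟩

end OddTangentIso

end SuperSheaf

end SuperGeometry

end


noncomputable section

namespace SuperGeometry

/-- A relation that is compatible with the operations and is the graph of a bijection defines an
isomorphism of algebras. -/
theorem exists_algEquiv_of_rel {k A B : Type*} [CommSemiring k] [Semiring A] [Algebra k A]
    [Semiring B] [Algebra k B] (R : A → B → Prop) (total : ∀ a, ∃ b, R a b)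
    (total' : ∀ b, ∃ a, R a b) (right : ∀ {a b b'}, R a b → R a b' → b = b')
    (left : ∀ {a a' b}, R a b → R a' b → a = a')
    (add : ∀ {a b a' b'}, R a b → R a' b' → R (a + a') (b + b'))
    (mul : ∀ {a b a' b'}, R a b → R a' b' → R (a * a') (b * b'))
    (alg : ∀ c : k, R (algebraMap k A c) (algebraMap k B c)) :
    ∃ e : A ≃ₐ[k] B, ∀ a, R a (e a) := by
  choose e he using total
  let e' : A →ₐ[k] B :=
    { toFun := e
      map_one' := right (he 1) (by simpa only [map_one] using alg 1)
      map_mul' := fun a b => right (he _) (mul (he a) (he b))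
      map_zero' := right (he 0) (by simpa only [map_zero] using alg 0)
      map_add' := fun a b => right (he _) (add (he a) (he b))
      commutes' := fun c => right (he _) (alg c) }
  refine ⟨AlgEquiv.ofBijective e' ⟨fun a a' h => left (he a) ?_, fun b => ?_⟩, he⟩
  · have h' : e a = e a' := h
    rw [h']
    exact he a'
  · obtain ⟨a, ha⟩ := total' b
    exact ⟨a, right (he a) ha⟩

variable {𝕜 : Type} [Field 𝕜] {X : TopCat.{u}} {O : FunctionSheaf 𝕜 X}

/-! ### Classification by the first obstruction -/

namespace SuperSheaf

open ModuleSheaf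

variable {S S' : SuperSheaf O} {V : ModuleSheaf O} {U U' W Z : Opens X}

/-- The modification of a projection by a section of `Hom(∧²V, T)`. -/
def Projection.twist (hS : S.IsSupermanifold 2) (hV : V.IsVectorBundle 2) (ρ : S.OddTangentIso V)
    (π : S.Projection U) (b : V.altTangent U) : S.Projection U where
  emb W h :=
    { toFun := fun f => π.emb W h f - ρ.topSec hS hV W (contract b h f)
      map_one' := by
        have e := contract_algebraMap b h 1
        rw [map_one (algebraMap 𝕜 (O.sec W))] at e
        rw [e, map_one, map_zero, sub_zero]
      map_mul' := fun f g => by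
        have e : ∀ f β, π.emb W h f * ρ.topSec hS hV W β = ρ.topSec hS hV W (f • β) :=
          fun f β => by rw [ρ.even_mul_topSec hS hV (π.emb_even W h f), π.red_emb]
        -- In `(π(f) - b(f))(π(g) - b(g))` the product of the two corrections lies in `J²·J = 0`;
        -- the mixed terms are the Leibniz rule for `b`.
        rw [contract_mul, map_add (ρ.topSec hS hV W), ← e, ← e, map_mul (π.emb W h), mul_sub,
          sub_mul, sub_mul, hS.evenNil_mul (ρ.topSec_mem hS hV _)
            (mem_evenNil.1 (ρ.topSec_mem hS hV _)).2,
          even_mul_comm (π.emb_even W h g) (ρ.topSec hS hV W (contract b h f))]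
        abel
      map_zero' := by
        have e := contract_algebraMap b h 0
        rw [map_zero (algebraMap 𝕜 (O.sec W))] at e
        rw [e, map_zero, map_zero, sub_zero]
      map_add' := fun f g => by
        rw [contract_map_add, map_add (ρ.topSec hS hV W), map_add (π.emb W h)]
        exact add_sub_add_comm _ _ _ _
      commutes' := fun c => by
        rw [contract_algebraMap, map_zero, sub_zero, AlgHom.commutes] }
  emb_res h h' f := by
    change S.res h' (π.emb _ h f - ρ.topSec hS hV _ (contract b h f)) = _
    rw [map_sub, π.emb_res, ρ.res_topSec, altRes_contract]
    rfl
  emb_even W h f := _root_.sub_mem (π.emb_even W h f) (ρ.topSec_mem hS hV _).1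
  red_emb W h f := by
    change S.red W (π.emb W h f - ρ.topSec hS hV W (contract b h f)) = f
    rw [map_sub, π.red_emb, (mem_evenNil.1 (ρ.topSec_mem hS hV _)).2, sub_zero]

namespace OddTangentIso

variable {hS : S.IsSupermanifold 2} {hS' : S'.IsSupermanifold 2} {hV : V.IsVectorBundle 2}
  {ρ : S.OddTangentIso V} {ρ' : S'.OddTangentIso V} {𝒰 : Cech.Cover X}
  {π : ∀ x, S.Projection (𝒰.nhd x)} {π' : ∀ x, S'.Projection (𝒰.nhd x)}
  {z : Cech.cocycles V.homExtSqTangent 𝒰}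

theorem Represents.toDual {a : V.Triple 𝒰 U} {s : S.J 1 U}
    (h : ρ.Represents hS hV π (s : S.sec U) a) : ρ.toDual U s = a.lin :=
  (ρ.toDual_eq hS s ⟨_, ρ.oddSec_odd hS a.lin⟩ h.sub_even).trans (ρ.oddToDual_oddSec hS a.lin)

/-- Two supermanifolds with local projections that define the same cocycle are isomorphic. -/
theorem nonempty_iso (hz : ρ.IsDifferenceCocycle hS hV 𝒰 π z)
    (hz' : ρ'.IsDifferenceCocycle hS' hV 𝒰 π' z) : Nonempty (Iso ρ ρ') := by
  -- Sections of `S` and `S'` correspond when they are represented by the same triple. The common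
  -- cocycle makes this relation total on both sides.
  choose e he using fun U : Opens X => exists_algEquiv_of_rel (k := 𝕜)
    (fun (s : S.sec U) (s' : S'.sec U) => ∃ a : V.Triple 𝒰 U,
      ρ.Represents hS hV π s a ∧ ρ'.Represents hS' hV π' s' a)
    (fun s => by
      obtain ⟨a, ha⟩ := exists_represents (hS := hS) (hV := hV) (ρ := ρ) (π := π) s
      obtain ⟨s', hs'⟩ := exists_represented hz' (ha.mem hz)
      exact ⟨s', a, ha, hs'⟩)
    (fun s' => by
      obtain ⟨a, ha⟩ := exists_represents (hS := hS') (hV := hV) (ρ := ρ') (π := π') s'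
      obtain ⟨s, hs⟩ := exists_represented hz (ha.mem hz')
      exact ⟨s, a, hs, ha⟩)
    (fun ⟨a, h, h'⟩ ⟨b, g, g'⟩ => by
      rw [← h.unique_right g] at g'
      exact h'.unique_left g')
    (fun ⟨a, h, h'⟩ ⟨b, g, g'⟩ => by
      rw [← h'.unique_right g'] at g
      exact h.unique_left g)
    (fun ⟨a, h, h'⟩ ⟨b, g, g'⟩ => ⟨a + b, h.add g, h'.add g'⟩)
    (fun ⟨a, h, h'⟩ ⟨b, g, g'⟩ => ⟨a * b, h.mul g, h'.mul g'⟩)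
    (fun c => ⟨algebraMap 𝕜 _ c, Represents.algebraMap c, Represents.algebraMap c⟩)
  exact ⟨{
    equiv := e
    equiv_res := fun {U W} h s => by
      obtain ⟨a, ha, ha'⟩ := he U s
      obtain ⟨b, hb, hb'⟩ := he W (S.res h s)
      rw [← (ha.res h).unique_right hb] at hb'
      exact (ha'.res h).unique_left hb'
    equiv_mem := fun U i s hs => by
      obtain ⟨a, ha, ha'⟩ := he U s
      fin_cases i
      · have h0 : a.lin = 0 := ha.eq_lin (by rw [map_zero, sub_zero]; exact hs)
        have h1 := ha'.sub_even
        rwa [h0, map_zero, sub_zero] at h1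
      · obtain ⟨φ, rfl⟩ := ρ.exists_oddSec hS hs
        rw [ha.unique_right (represents_oddSec φ)] at ha'
        rw [ha'.unique_left (represents_oddSec φ)]
        exact ρ'.oddSec_odd hS' φ
    red_equiv := fun U s => by
      obtain ⟨a, ha, ha'⟩ := he U s
      rw [ha.red, ha'.red]
    toDual_equiv := fun U s t h => by
      obtain ⟨a, ha, ha'⟩ := he U s
      rw [h] at ha'
      rw [ha.toDual, ha'.toDual] }⟩

theorem IsDifferenceCocycle.restrict {𝒲 : Cech.Cover X} (h : 𝒰 ≤ 𝒲)
    (hz : ρ.IsDifferenceCocycle hS hV 𝒰 π z) :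
    ρ.IsDifferenceCocycle hS hV 𝒲 (fun x => (π x).restrict (h x))
      (Cech.refineCocycle V.homExtSqTangent 𝒰 𝒲 h z) := fun x y W hx hy f =>
  hz x y W (hx.trans (h x)) (hy.trans (h y)) f

/-- Replacing `π'_x` by `π'_x - b_x` changes the cocycle `z'` into `z'_xy - (b_y - b_x)`, which is
`z` on the refinement. -/
theorem IsDifferenceCocycle.twist {𝒰' 𝒲 : Cech.Cover X} (h : 𝒰 ≤ 𝒲) (h' : 𝒰' ≤ 𝒲)
    {π' : ∀ x, S'.Projection (𝒰'.nhd x)} {z' : Cech.cocycles V.homExtSqTangent 𝒰'}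
    (hz' : ρ'.IsDifferenceCocycle hS' hV 𝒰' π' z') (b : ∀ x, V.altTangent (𝒲.nhd x))
    (hb : Cech.Cohomologous V.homExtSqTangent z z' 𝒲 h h' b) :
    ρ'.IsDifferenceCocycle hS' hV 𝒲
      (fun x => ((π' x).restrict (h' x)).twist hS' hV ρ' (b x))
      (Cech.refineCocycle V.homExtSqTangent 𝒰 𝒲 h z) := by
  intro x y W hx hy f
  have e1 := (cohomologous_iff z z' 𝒲 h h' b).1 hb x y W hx hy f
  have e2 := hz' x y W (hx.trans (h' x)) (hy.trans (h' y)) f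
  have e3 : contract (component (Cech.refineCocycle V.homExtSqTangent 𝒰 𝒲 h z) x y)
      (le_inf hx hy) f =
      contract (component z' x y) (le_inf (hx.trans (h' x)) (hy.trans (h' y))) f -
        (contract (b y) hy f - contract (b x) hx f) := by
    rw [← e1, sub_sub_cancel]
    rfl
  rw [e3, map_sub (ρ'.topSec hS' hV W), map_sub (ρ'.topSec hS' hV W), e2]
  exact sub_sub_sub_comm ((π' y).emb W (hy.trans (h' y)) f) _ _ _

end OddTangentIso

namespace Iso

variable (hS : S.IsSupermanifold 2) (hS' : S'.IsSupermanifold 2) (hV : V.IsVectorBundle 2)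
  {ρ : S.OddTangentIso V} {ρ' : S'.OddTangentIso V} (Θ : Iso ρ ρ')

/-- An isomorphism preserves parity and linear forms, and an odd function is determined by its
linear form. -/
theorem equiv_oddSec (φ : V.dual U) : Θ.equiv U (ρ.oddSec hS U φ) = ρ'.oddSec hS' U φ := by
  have h := Θ.equiv_mem U 1 _ (ρ.oddSec_odd hS φ)
  have e := Θ.toDual_equiv U ⟨_, OddTangentIso.odd_mem_J hS (ρ.oddSec_odd hS φ)⟩
    ⟨_, OddTangentIso.odd_mem_J hS' h⟩ rfl
  have e' : ρ'.oddToDual hS' U ⟨_, h⟩ = φ := e.trans (ρ.oddToDual_oddSec hS φ)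
  rw [← e', ρ'.oddSec_oddToDual hS', e']

theorem equiv_topSec (β : V.alt U) : Θ.equiv U (ρ.topSec hS hV U β) = ρ'.topSec hS' hV U β := by
  refine S'.isSheafRes.sep U _ _ fun x hx => ?_
  obtain ⟨W, hW, hxW, e, he⟩ := hV.exists_frame hx
  refine ⟨W, hW, hxW, ?_⟩
  rw [Θ.equiv_res, ρ.res_topSec_frame hS hV β hW he, ρ'.res_topSec_frame hS' hV β hW he,
    OddTangentIso.topFrame, OddTangentIso.topFrame, map_mul, Θ.equiv_oddSec hS hS',
    Θ.equiv_oddSec hS hS']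

/-- The image of a projection under an isomorphism. -/
def projection (π : S.Projection U) : S'.Projection U where
  emb W h := (Θ.equiv W : S.sec W →ₐ[𝕜] S'.sec W).comp (π.emb W h)
  emb_res h h' f := (Θ.equiv_res h' _).trans (congrArg _ (π.emb_res h h' f))
  emb_even W h f := Θ.equiv_mem W 0 _ (π.emb_even W h f)
  red_emb W h f := (Θ.red_equiv W _).trans (π.red_emb W h f)

-- Local projections of `S` are carried to local projections of `S'`. Since the isomorphism
-- intertwines the two copies of `∧²V^∨`, the cocycle of differences is unchanged.
include hS hS' hV Θ in
theorem isFirstObstruction {ω : Cech.H1 V.homExtSqTangent} (h : S.IsFirstObstruction ρ ω) :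
    S'.IsFirstObstruction ρ' ω := by
  obtain ⟨𝒰, π, z, hz, rfl⟩ := (ρ.isFirstObstruction_iff hS hV _).1 h
  refine (ρ'.isFirstObstruction_iff hS' hV _).2 ⟨𝒰, fun x => Θ.projection (π x), z,
    fun x y W h h' f => ?_, rfl⟩
  rw [← Θ.equiv_topSec hS hS' hV, hz x y W h h' f, map_sub]
  rfl

end Iso

/-- An isomorphism transports the obstruction, which is unique. Conversely, equal classes have
cohomologous cocycles on a common refinement; twisting the projections of `S'` by the cochain gives
both supermanifolds the same cocycle. -/
theorem nonempty_iso_iff (hS : S.IsSupermanifold 2) (hS' : S'.IsSupermanifold 2)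
    (hV : V.IsVectorBundle 2) {ρ : S.OddTangentIso V} {ρ' : S'.OddTangentIso V}
    {ω ω' : Cech.H1 V.homExtSqTangent} (hω : S.IsFirstObstruction ρ ω)
    (hω' : S'.IsFirstObstruction ρ' ω') : Nonempty (Iso ρ ρ') ↔ ω = ω' := by
  constructor
  · rintro ⟨Θ⟩
    exact (ρ'.existsUnique_isFirstObstruction hS' hV).unique
      (Θ.isFirstObstruction hS hS' hV hω) hω'
  · rintro rfl
    obtain ⟨𝒰, π, z, hz, rfl⟩ := (ρ.isFirstObstruction_iff hS hV _).1 hω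
    obtain ⟨𝒰', π', z', hz', e⟩ := (ρ'.isFirstObstruction_iff hS' hV _).1 hω'
    obtain ⟨𝒲, h, h', b, hb⟩ := (Cech.classOf_eq_iff _ z z').1 e.symm
    exact OddTangentIso.nonempty_iso (hz.restrict h) (hz'.twist h h' b hb)

end SuperSheaf

end SuperGeometry

end


noncomputable section

namespace SuperGeometry

variable {𝕜 : Type} [Field 𝕜] {X : TopCat.{u}} {O : FunctionSheaf 𝕜 X}

/-! ### The supermanifold defined by a cocycle -/

namespace ModuleSheaf

variable {V : ModuleSheaf O} {𝒰 : Cech.Cover X} {U W Z : Opens X}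

namespace Triple

/-- The three kinds of components are sections of sheaves and are glued separately. -/
theorem isSheafRes : IsSheafRes (fun U => V.Triple 𝒰 U) fun _ _ h => Triple.res h where
  self U a := Triple.ext (O.res_self _) rfl fun _ => rfl
  comp U W Z h h' a := Triple.ext (O.res_res h h' _) rfl fun _ => rfl
  sep U a b hab := by
    refine Triple.ext (O.isSheafRes.sep U _ _ fun x hx => ?_)
      (V.isSheafRes_dual.sep U _ _ fun x hx => ?_)
      fun y => V.isSheafRes_alt.sep (U ⊓ 𝒰.nhd y) _ _ fun x hx => ?_
    · obtain ⟨W, h, hxW, e⟩ := hab x hx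
      exact ⟨W, h, hxW, congrArg fn e⟩
    · obtain ⟨W, h, hxW, e⟩ := hab x hx
      exact ⟨W, h, hxW, congrArg lin e⟩
    · obtain ⟨W, h, hxW, e⟩ := hab x hx.1
      exact ⟨W ⊓ 𝒰.nhd y, inf_le_inf_right _ h, ⟨hxW, hx.2⟩,
        congrArg (fun a => a.top y inf_le_left inf_le_right) e⟩
  glue U P ex st un := by
    obtain ⟨f, hf⟩ := O.isSheafRes.glue U (fun W f => ∃ t : V.Triple 𝒰 W, P W t ∧ f = t.fn)
      (fun x hx => by
        obtain ⟨W, h, hxW, t, ht⟩ := ex x hx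
        exact ⟨W, h, hxW, _, t, ht, rfl⟩)
      (by
        rintro W Z h _ ⟨t, ht, rfl⟩
        exact ⟨_, st W Z h t ht, rfl⟩)
      (by
        rintro W _ _ h ⟨s, hs, rfl⟩ ⟨t, ht, rfl⟩
        rw [un W s t h hs ht])
    obtain ⟨φ, hφ⟩ := V.isSheafRes_dual.glue U (fun W φ => ∃ t : V.Triple 𝒰 W, P W t ∧ φ = t.lin)
      (fun x hx => by
        obtain ⟨W, h, hxW, t, ht⟩ := ex x hx
        exact ⟨W, h, hxW, _, t, ht, rfl⟩)
      (by
        rintro W Z h _ ⟨t, ht, rfl⟩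
        exact ⟨_, st W Z h t ht, rfl⟩)
      (by
        rintro W _ _ h ⟨s, hs, rfl⟩ ⟨t, ht, rfl⟩
        rw [un W s t h hs ht])
    -- The component of index `y` lives only on `U ⊓ 𝒰.nhd y`. The predicate allows restrictions to
    -- any smaller set, so that it is stable.
    choose α hα using fun y => V.isSheafRes_alt.glue (U ⊓ 𝒰.nhd y)
      (fun W β => ∃ (Z : Opens X) (t : V.Triple 𝒰 Z) (h : W ≤ Z) (hy : W ≤ 𝒰.nhd y), P Z t ∧
        β = t.top y h hy)
      (fun x hx => by
        obtain ⟨W, h, hxW, t, ht⟩ := ex x hx.1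
        exact ⟨W ⊓ 𝒰.nhd y, inf_le_inf_right _ h, ⟨hxW, hx.2⟩, _, W, t, inf_le_left,
          inf_le_right, ht, rfl⟩)
      (by
        rintro W Z h _ ⟨Y, t, hY, hy, ht, rfl⟩
        exact ⟨Y, t, h.trans hY, h.trans hy, ht, rfl⟩)
      (by
        rintro W _ _ h ⟨Y, s, hY, hy, hs, rfl⟩ ⟨Y', t, hY', hy', ht, rfl⟩
        have e := un W _ _ (h.trans inf_le_left) (st Y W hY s hs) (st Y' W hY' t ht)
        exact congrArg (fun a => a.top y le_rfl hy) e)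
    refine ⟨mk f φ α, fun W h t ht => Triple.ext (hf W h _ ⟨t, ht, rfl⟩) (hφ W h _ ⟨t, ht, rfl⟩)
      fun y => ?_⟩
    exact hα y (W ⊓ 𝒰.nhd y) (inf_le_inf_right _ h) _ ⟨W, t, inf_le_left, inf_le_right, ht, rfl⟩

theorem res_mul (h : W ≤ U) (a b : V.Triple 𝒰 U) : (a * b).res h = a.res h * b.res h := by
  refine Triple.ext (map_mul (O.res h) _ _) ?_ fun x => ?_
  · refine (map_add (V.dualRes h) (a.fn • b.lin) (b.fn • a.lin)).trans ?_
    exact congrArg₂ (· + ·) (V.dualRes_smul h _ _) (V.dualRes_smul h _ _)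
  · refine (top_mul a b x (inf_le_left.trans h) inf_le_right).trans
      (Eq.trans ?_ (top_mul (a.res h) (b.res h) x inf_le_left inf_le_right).symm)
    exact congrArg₂ (· + ·) (congrArg₂ (· + ·)
      (congrArg (· • b.top x (inf_le_left.trans h) inf_le_right)
        (O.res_res h (inf_le_left : W ⊓ 𝒰.nhd x ≤ W) a.fn).symm)
      (congrArg (· • a.top x (inf_le_left.trans h) inf_le_right)
        (O.res_res h (inf_le_left : W ⊓ 𝒰.nhd x ≤ W) b.fn).symm)) rfl

end Triple

variable (z : Cech.cocycles V.homExtSqTangent 𝒰)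

/-- Restriction of sections of the algebras defined by a cocycle. -/
def twistedRes (h : W ≤ U) : twistedAlgebra z U →ₐ[𝕜] twistedAlgebra z W where
  toFun a := ⟨a.1.res h, fun x y Z hZ hx hy => by
    rw [Triple.top_res, Triple.top_res, Triple.fn_res, O.res_res]
    exact a.2 x y Z (hZ.trans h) hx hy⟩
  map_one' := Subtype.ext (Triple.ext (map_one (O.res h)) rfl fun _ => rfl)
  map_mul' a b := Subtype.ext (Triple.res_mul h a.1 b.1)
  map_zero' := Subtype.ext (Triple.ext (map_zero (O.res h)) rfl fun _ => rfl)
  map_add' a b := Subtype.ext (Triple.ext (map_add (O.res h) _ _) rfl fun _ => rfl)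
  commutes' c := Subtype.ext (Triple.ext (AlgHom.commutes (O.res h) c) rfl fun _ => rfl)

theorem isSheafRes_twistedAlgebra :
    IsSheafRes (fun U => twistedAlgebra z U) fun _ _ h => twistedRes z h :=
  (Triple.isSheafRes (V := V) (𝒰 := 𝒰)).subtype (fun U a => a ∈ twistedAlgebra z U)
    -- The condition relating the components to `z` is an equality of sections of the sheaf of
    -- alternating forms, hence local.
    (fun _ _ h a ha => (twistedRes z h ⟨a, ha⟩).2) fun U a loc x y W h hx hy => by
      refine V.isSheafRes_alt.sep W _ _ fun w hw => ?_
      obtain ⟨Z, hZ, hwZ, ha⟩ := loc w (h hw)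
      refine ⟨W ⊓ Z, inf_le_left, ⟨hw, hwZ⟩, ?_⟩
      have e := ha x y (W ⊓ Z) inf_le_right (inf_le_left.trans hx) (inf_le_left.trans hy)
      rw [Triple.fn_res, O.res_res] at e
      rw [altRes_contract, O.res_res, map_sub (V.altRes _)]
      exact e

/-- The sheaf of algebras defined by a cocycle. -/
def twistedSheaf : X.Sheaf (AlgCat.{u} 𝕜) :=
  ⟨{ obj := fun U => AlgCat.of 𝕜 (twistedAlgebra z U.unop)
     map := fun i => AlgCat.ofHom (twistedRes z i.unop.le)
     map_id := fun _ => AlgCat.hom_ext _ (AlgHom.ext fun a => (isSheafRes_twistedAlgebra z).self _ a)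
     map_comp := fun i j => AlgCat.hom_ext _ (AlgHom.ext fun a =>
      ((isSheafRes_twistedAlgebra z).comp _ _ _ i.unop.le j.unop.le a).symm) },
    IsSheafRes.isSheaf _ (isSheafRes_twistedAlgebra z)⟩

/-- The even and the odd part of the algebra defined by a cocycle. -/
def twistedPart (U : Opens X) : Fin 2 → Submodule 𝕜 (twistedAlgebra z U) :=
  ![{ carrier := {a | a.1.lin = 0}
      add_mem' := fun {a b} ha hb => by
        change (a.1 + b.1).lin = 0
        rw [Triple.lin_add, ha, hb, add_zero]
      zero_mem' := rfl
      smul_mem' := fun c a ha => by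
        change (c • a.1).lin = 0
        rw [Algebra.smul_def, Triple.lin_mul, ha, Triple.algebraMap_eq, Triple.lin_mk, smul_zero,
          smul_zero, add_zero] },
    { carrier := {a | a.1.fn = 0 ∧ ∀ (x : X) (W : Opens X) (h : W ≤ U) (hx : W ≤ 𝒰.nhd x),
        a.1.top x h hx = 0}
      add_mem' := fun {a b} ha hb => by
        refine ⟨?_, fun x W h hx => ?_⟩
        · change (a.1 + b.1).fn = 0
          rw [Triple.fn_add, ha.1, hb.1, add_zero]
        · change (a.1 + b.1).top x h hx = 0
          rw [Triple.top_add, ha.2, hb.2, add_zero]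
      zero_mem' := ⟨rfl, fun _ _ _ _ => rfl⟩
      smul_mem' := fun c a ha => by
        refine ⟨?_, fun x W h hx => ?_⟩
        · change (c • a.1).fn = 0
          rw [Algebra.smul_def, Triple.fn_mul, ha.1, mul_zero]
        · change (c • a.1).top x h hx = 0
          rw [Algebra.smul_def, Triple.top_mul, ha.1, ha.2, Triple.algebraMap_eq, Triple.lin_mk,
            Triple.top_mk]
          rw [map_zero (O.res h), map_zero (V.dualRes h), smul_zero, zero_smul,
            LinearMap.map_zero₂, add_zero, add_zero] }]

variable {z}

theorem mem_twistedPart_zero {a : twistedAlgebra z U} : a ∈ twistedPart z U 0 ↔ a.1.lin = 0 :=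
  Iff.rfl

theorem mem_twistedPart_one {a : twistedAlgebra z U} : a ∈ twistedPart z U 1 ↔ a.1.fn = 0 ∧
    ∀ (x : X) (W : Opens X) (h : W ≤ U) (hx : W ≤ 𝒰.nhd x), a.1.top x h hx = 0 := Iff.rfl

end ModuleSheaf

end SuperGeometry

end


/-! ### Components of sections of the twisted algebra -/

noncomputable section

namespace SuperGeometry

variable {𝕜 : Type} [Field 𝕜] {X : TopCat.{u}} {O : FunctionSheaf 𝕜 X}

namespace ModuleSheaf

variable {V : ModuleSheaf O} {𝒰 : Cech.Cover X} {U W Z : Opens X}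
  {z : Cech.cocycles V.homExtSqTangent 𝒰}

theorem contract_zero (b : V.altTangent U) (h : W ≤ U) : contract b h 0 = 0 := by
  have e := contract_algebraMap b h 0
  rwa [map_zero] at e

theorem contract_one (b : V.altTangent U) (h : W ≤ U) : contract b h 1 = 0 := by
  have e := contract_algebraMap b h 1
  rwa [map_one] at e

theorem twisted_ext {a b : twistedAlgebra z U} (h₁ : a.1.fn = b.1.fn) (h₂ : a.1.lin = b.1.lin)
    (h₃ : ∀ x (W : Opens X) (h : W ≤ U) (hx : W ≤ 𝒰.nhd x), a.1.top x h hx = b.1.top x h hx) :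
    a = b :=
  Subtype.ext (Triple.ext h₁ h₂ fun x => h₃ x _ _ _)

variable (z)

/-- The odd function defined by a linear form. -/
def twistedOdd (U : Opens X) (φ : V.dual U) : twistedAlgebra z U :=
  ⟨Triple.mk 0 φ 0, fun x y W h hx hy => by
    rw [Triple.fn_mk, map_zero, contract_zero]
    exact sub_self (0 : V.alt W)⟩

/-- The even nilpotent function defined by an alternating form. -/
def twistedTop (U : Opens X) (β : V.alt U) : twistedAlgebra z U :=
  ⟨Triple.mk 0 0 fun _ => V.altRes inf_le_left β, fun x y W h hx hy => by
    rw [Triple.fn_mk, map_zero, contract_zero]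
    exact sub_self (V.altRes h β)⟩

theorem top_twistedTop (β : V.alt U) (x : X) (h : W ≤ U) (hx : W ≤ 𝒰.nhd x) :
    (twistedTop z U β).1.top x h hx = V.altRes h β := rfl

/-- The lift of a function to an even function that is defined by the member of index `x` of the
cover. -/
def twistedLift (x : X) (h : U ≤ 𝒰.nhd x) (f : O.sec U) : twistedAlgebra z U :=
  -- The lift should have top component zero relative to `x`; the compatibility condition then
  -- forces the component of index `y` to be `z_yx(f)`.
  ⟨Triple.mk f 0 fun y => contract (component z y x)
    (le_inf inf_le_right (inf_le_left.trans h)) (O.res (inf_le_left : U ⊓ 𝒰.nhd y ≤ U) f),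
    fun y y' W hW hy hy' => by
      rw [Triple.top_mk, Triple.top_mk, altRes_contract, altRes_contract, O.res_res, O.res_res,
        sub_eq_iff_eq_add]
      -- Compatibility of the components is the cocycle identity `z_yy' + z_y'x = z_yx`.
      exact (contract_component_add z y y' x hy hy' (hW.trans h) _).symm⟩

theorem top_twistedLift (x : X) (h : U ≤ 𝒰.nhd x) (f : O.sec U) (y : X) (hW : W ≤ U)
    (hy : W ≤ 𝒰.nhd y) : (twistedLift z x h f).1.top y hW hy =
      contract (component z y x) (le_inf hy (hW.trans h)) (O.res hW f) := by
  refine (altRes_contract (component z y x) (le_inf inf_le_right (inf_le_left.trans h))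
    (O.res (inf_le_left : U ⊓ 𝒰.nhd y ≤ U) f) (le_inf hW hy)).trans ?_
  rw [O.res_res]

theorem twistedLift_mul (x : X) (h : U ≤ 𝒰.nhd x) (f g : O.sec U) :
    twistedLift z x h (f * g) = twistedLift z x h f * twistedLift z x h g := by
  refine twisted_ext rfl ?_ fun y W hW hy => ?_
  · refine Eq.trans ?_ (Triple.lin_mul (twistedLift z x h f).1 (twistedLift z x h g).1).symm
    change (0 : V.dual U) = f • (0 : V.dual U) + g • (0 : V.dual U)
    rw [smul_zero, smul_zero, add_zero]
  · refine Eq.trans ?_ (Triple.top_mul (twistedLift z x h f).1 (twistedLift z x h g).1 y hW hy).symm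
    rw [top_twistedLift, top_twistedLift, top_twistedLift, map_mul (O.res hW) f g, contract_mul]
    have e : V.wedge W (V.dualRes hW (twistedLift z x h f).1.lin)
        (V.dualRes hW (twistedLift z x h g).1.lin) = 0 :=
      LinearMap.map_zero₂ _ _
    rw [e, add_zero]
    rfl

/-- The homomorphism that lifts functions on a member of the cover. -/
def twistedEven (x : X) (U : Opens X) (h : U ≤ 𝒰.nhd x) : O.sec U →ₐ[𝕜] twistedAlgebra z U where
  toFun := twistedLift z x h
  map_one' := twisted_ext rfl rfl fun y W hW hy => by
    rw [top_twistedLift, map_one (O.res hW), contract_one]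
    rfl
  map_mul' := twistedLift_mul z x h
  map_zero' := twisted_ext rfl rfl fun y W hW hy => by
    rw [top_twistedLift, map_zero (O.res hW), contract_zero]
    rfl
  map_add' f g := twisted_ext rfl (add_zero (0 : V.dual U)).symm fun y W hW hy => by
    rw [top_twistedLift, map_add (O.res hW) f g, contract_map_add]
    exact (congrArg₂ (· + ·) (top_twistedLift z x h f y hW hy)
      (top_twistedLift z x h g y hW hy)).symm
  commutes' c := twisted_ext rfl rfl fun y W hW hy => by
    rw [top_twistedLift, AlgHom.commutes (O.res hW) c, contract_algebraMap]
    rfl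

theorem top_twistedEven (x : X) (h : U ≤ 𝒰.nhd x) (f : O.sec U) (y : X) (hW : W ≤ U)
    (hy : W ≤ 𝒰.nhd y) : (twistedEven z x U h f).1.top y hW hy =
      contract (component z y x) (le_inf hy (hW.trans h)) (O.res hW f) :=
  top_twistedLift z x h f y hW hy

theorem twistedRes_twistedEven (x : X) (h : U ≤ 𝒰.nhd x) (hW : W ≤ U) (f : O.sec U) :
    twistedRes z hW (twistedEven z x U h f) = twistedEven z x W (hW.trans h) (O.res hW f) :=
  twisted_ext rfl rfl fun y Z hZ hy => by
    change (twistedEven z x U h f).1.top y (hZ.trans hW) hy = _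
    rw [top_twistedEven, top_twistedEven, O.res_res]

theorem twistedOdd_mul_twistedOdd (φ ψ : V.dual U) :
    twistedOdd z U φ * twistedOdd z U ψ = twistedTop z U (V.wedge U φ ψ) := by
  refine twisted_ext (mul_zero _) ?_ fun x W h hx => ?_
  · change (Triple.mk 0 φ 0 * Triple.mk 0 ψ 0 : V.Triple 𝒰 U).lin = 0
    rw [Triple.lin_mul, Triple.fn_mk, Triple.fn_mk, zero_smul, zero_smul, add_zero]
  · change (Triple.mk 0 φ 0 * Triple.mk 0 ψ 0 : V.Triple 𝒰 U).top x h hx = _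
    rw [Triple.top_mul, Triple.fn_mk, Triple.fn_mk, map_zero (O.res h), zero_smul, zero_smul,
      zero_add, zero_add, top_twistedTop, altRes_wedge]
    rfl

theorem mul_twistedOdd {a : twistedAlgebra z U} (ha : a.1.lin = 0) (φ : V.dual U) :
    a * twistedOdd z U φ = twistedOdd z U (a.1.fn • φ) := by
  refine twisted_ext (mul_zero _) ?_ fun x W h hx => ?_
  · change (a.1 * Triple.mk 0 φ 0).lin = a.1.fn • φ
    rw [Triple.lin_mul, Triple.fn_mk, Triple.lin_mk, zero_smul, add_zero]
  · change (a.1 * Triple.mk 0 φ 0).top x h hx = 0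
    rw [Triple.top_mul, ha, Triple.fn_mk, map_zero (V.dualRes h), LinearMap.map_zero₂,
      map_zero (O.res h), zero_smul, add_zero, add_zero, Triple.top_mk]
    exact (congrArg _ (map_zero (V.altRes _))).trans (smul_zero _)

theorem mul_twistedTop {a : twistedAlgebra z U} (ha : a.1.lin = 0) (β : V.alt U) :
    a * twistedTop z U β = twistedTop z U (a.1.fn • β) := by
  refine twisted_ext (mul_zero _) ?_ fun x W h hx => ?_
  · change (a.1 * Triple.mk 0 0 _).lin = 0
    rw [Triple.lin_mul, Triple.fn_mk, Triple.lin_mk, zero_smul, smul_zero, add_zero]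
  · change (a.1 * (twistedTop z U β).1).top x h hx = _
    rw [Triple.top_mul, ha, top_twistedTop, top_twistedTop, map_zero (V.dualRes h),
      LinearMap.map_zero₂, altRes_smul]
    change _ + O.res h (0 : O.sec U) • _ + _ = _
    rw [map_zero (O.res h), zero_smul, add_zero, add_zero]

variable {z}

/-- The components of a section on a member of the cover. -/
theorem twisted_eq (x : X) (h : U ≤ 𝒰.nhd x) (a : twistedAlgebra z U) :
    a = twistedEven z x U h a.1.fn + twistedOdd z U a.1.lin +
      twistedTop z U (a.1.top x le_rfl h) := by
  refine twisted_ext ?_ ?_ fun y W hW hy => ?_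
  · change a.1.fn = a.1.fn + 0 + 0
    rw [add_zero, add_zero]
  · change a.1.lin = 0 + a.1.lin + 0
    rw [zero_add, add_zero]
  · change _ = (twistedEven z x U h a.1.fn).1.top y hW hy + 0 + V.altRes hW (a.1.top x le_rfl h)
    rw [top_twistedEven, ← mem_twistedAlgebra.1 a.2 y x W hW hy (hW.trans h), add_zero,
      Triple.altRes_top, sub_add_cancel]

/-- The cocycle identity for three equal indices reads `z_xx + z_xx = z_xx`. -/
theorem contract_component_self (x : X) (h : W ≤ 𝒰.nhd x) (f : O.sec W) :
    contract (component z x x) (le_inf h h) f = 0 :=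
  left_eq_add.1 (contract_component_add z x x x h h h f).symm

/-- The function and the linear form are read off directly. The top form is read off at index `x`,
where the lift contributes `z_xx(f) = 0`. -/
theorem components_injective {x : X} (h : U ≤ 𝒰.nhd x) {f f' : O.sec U} {φ φ' : V.dual U}
    {β β' : V.alt U}
    (e : twistedEven z x U h f + twistedOdd z U φ + twistedTop z U β =
      twistedEven z x U h f' + twistedOdd z U φ' + twistedTop z U β') :
    f = f' ∧ φ = φ' ∧ β = β' := by
  have fn : ∀ (f : O.sec U) (φ : V.dual U) (β : V.alt U),
      (twistedEven z x U h f + twistedOdd z U φ + twistedTop z U β).1.fn = f := fun f φ β => by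
    change f + 0 + 0 = f
    rw [add_zero, add_zero]
  have lin : ∀ (f : O.sec U) (φ : V.dual U) (β : V.alt U),
      (twistedEven z x U h f + twistedOdd z U φ + twistedTop z U β).1.lin = φ := fun f φ β => by
    change 0 + φ + 0 = φ
    rw [zero_add, add_zero]
  have top : ∀ (f : O.sec U) (φ : V.dual U) (β : V.alt U),
      (twistedEven z x U h f + twistedOdd z U φ + twistedTop z U β).1.top x le_rfl h = β :=
    fun f φ β => by
      change (twistedEven z x U h f).1.top x le_rfl h + 0 + β = β
      rw [top_twistedEven, contract_component_self x h, zero_add, zero_add]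
  refine ⟨?_, ?_, ?_⟩
  · rw [← fn f φ β, e, fn]
  · rw [← lin f φ β, e, lin]
  · rw [← top f φ β, e, top]

end ModuleSheaf

end SuperGeometry

end


/-! ### The twisted supermanifold and its first obstruction -/

noncomputable section

namespace SuperGeometry

variable {𝕜 : Type} [Field 𝕜] {X : TopCat.{u}} {O : FunctionSheaf 𝕜 X}

namespace ModuleSheaf

variable {V : ModuleSheaf O} {𝒰 : Cech.Cover X} {U W Z : Opens X}
  (z : Cech.cocycles V.homExtSqTangent 𝒰)

theorem twistedPart_mul_mem (i j : Fin 2) {a b : twistedAlgebra z U} (ha : a ∈ twistedPart z U i)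
    (hb : b ∈ twistedPart z U j) : a * b ∈ twistedPart z U (i + j) := by
  have lin : (a * b).1.lin = a.1.fn • b.1.lin + b.1.fn • a.1.lin := Triple.lin_mul a.1 b.1
  have top := fun x W (h : W ≤ U) (hx : W ≤ 𝒰.nhd x) => Triple.top_mul a.1 b.1 x h hx
  fin_cases i <;> fin_cases j
  · have ha := mem_twistedPart_zero.1 ha
    have hb := mem_twistedPart_zero.1 hb
    refine mem_twistedPart_zero.2 ?_
    rw [lin, ha, hb, smul_zero, smul_zero, add_zero]
  · have ha := mem_twistedPart_zero.1 ha
    have hb := mem_twistedPart_one.1 hb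
    refine mem_twistedPart_one.2 ⟨?_, fun x W h hx => (top x W h hx).trans ?_⟩
    · exact (Triple.fn_mul a.1 b.1).trans (by rw [hb.1, mul_zero])
    · rw [ha, hb.1, hb.2, map_zero (V.dualRes h), LinearMap.map_zero₂, map_zero (O.res h),
        smul_zero, zero_smul, add_zero, add_zero]
  · have hb := mem_twistedPart_zero.1 hb
    have ha := mem_twistedPart_one.1 ha
    refine mem_twistedPart_one.2 ⟨?_, fun x W h hx => (top x W h hx).trans ?_⟩
    · exact (Triple.fn_mul a.1 b.1).trans (by rw [ha.1, zero_mul])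
    · rw [hb, ha.1, ha.2, map_zero (V.dualRes h), map_zero (V.wedge W _), map_zero (O.res h),
        smul_zero, zero_smul, add_zero, add_zero]
  · have ha := mem_twistedPart_one.1 ha
    have hb := mem_twistedPart_one.1 hb
    refine mem_twistedPart_zero.2 ?_
    rw [lin, ha.1, hb.1, zero_smul, zero_smul, add_zero]

theorem twistedPart_isCompl (U : Opens X) : IsCompl (twistedPart z U 0) (twistedPart z U 1) := by
  refine IsCompl.of_eq ?_ ?_
  · refine (Submodule.eq_bot_iff _).2 fun a ha => ?_
    have h0 := mem_twistedPart_zero.1 ha.1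
    have h1 := mem_twistedPart_one.1 ha.2
    exact twisted_ext h1.1 h0 h1.2
  · refine (Submodule.eq_top_iff').2 fun a => Submodule.mem_sup.2
      ⟨a + twistedOdd z U (-a.1.lin), ?_, twistedOdd z U a.1.lin, ?_,
        twisted_ext ?_ ?_ fun x W h hx => ?_⟩
    · refine mem_twistedPart_zero.2 ?_
      change a.1.lin + -a.1.lin = 0
      rw [add_neg_cancel]
    · exact mem_twistedPart_one.2 ⟨rfl, fun _ _ _ _ => rfl⟩
    · change a.1.fn + 0 + 0 = a.1.fn
      rw [add_zero, add_zero]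
    · change a.1.lin + -a.1.lin + a.1.lin = a.1.lin
      rw [neg_add_cancel_right]
    · change a.1.top x h hx + 0 + 0 = a.1.top x h hx
      rw [add_zero, add_zero]

theorem twisted_even_comm {a b : twistedAlgebra z U} (h : a.1.lin = 0) : a * b = b * a := by
  refine twisted_ext (mul_comm a.1.fn b.1.fn) (add_comm _ _) fun x W hW hx => ?_
  refine (Triple.top_mul a.1 b.1 x hW hx).trans (Eq.trans ?_
    (Triple.top_mul b.1 a.1 x hW hx).symm)
  rw [h, map_zero (V.dualRes hW), LinearMap.map_zero₂, map_zero (V.wedge W _), add_zero,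
    add_zero, add_comm]

theorem zero_smul_add_zero_smul_add {R M : Type*} [Ring R] [AddCommGroup M] [Module R M]
    (p q r : M) : (0 : R) • p + (0 : R) • q + r = r := by
  rw [zero_smul, zero_smul, add_zero, zero_add]

theorem top_odd_mul_odd {a b : twistedAlgebra z U} (ha : a.1.fn = 0) (hb : b.1.fn = 0) (x : X)
    (h : W ≤ U) (hx : W ≤ 𝒰.nhd x) : (a.1 * b.1).top x h hx =
      V.wedge W (V.dualRes h a.1.lin) (V.dualRes h b.1.lin) := by
  refine (Triple.top_mul a.1 b.1 x h hx).trans ?_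
  rw [ha, hb, map_zero (O.res h)]
  exact zero_smul_add_zero_smul_add _ _ _

theorem twisted_odd_anticomm {a b : twistedAlgebra z U} (ha : a.1.fn = 0) (hb : b.1.fn = 0) :
    a * b = -(b * a) := by
  refine eq_neg_of_add_eq_zero_left (twisted_ext ?_ ?_ fun x W h hx => ?_)
  · change a.1.fn * b.1.fn + b.1.fn * a.1.fn = 0
    rw [ha, hb, mul_zero, add_zero]
  · change a.1.fn • b.1.lin + b.1.fn • a.1.lin + (b.1.fn • a.1.lin + a.1.fn • b.1.lin) = 0
    rw [ha, hb, zero_smul, zero_smul, add_zero, add_zero]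
  · refine (congrArg₂ (· + ·) (top_odd_mul_odd z ha hb x h hx)
      (top_odd_mul_odd z hb ha x h hx)).trans ?_
    rw [wedge_swap]
    exact neg_add_cancel _

theorem twisted_supercomm (i j : Fin 2) {a b : twistedAlgebra z U} (ha : a ∈ twistedPart z U i)
    (hb : b ∈ twistedPart z U j) : a * b = (-1) ^ (i.val * j.val) * (b * a) := by
  fin_cases i <;> fin_cases j
  · refine (twisted_even_comm z (mem_twistedPart_zero.1 ha)).trans ?_
    simp
  · refine (twisted_even_comm z (mem_twistedPart_zero.1 ha)).trans ?_
    simp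
  · refine (twisted_even_comm z (mem_twistedPart_zero.1 hb)).symm.trans ?_
    simp
  · have ha := mem_twistedPart_one.1 ha
    have hb := mem_twistedPart_one.1 hb
    rw [twisted_odd_anticomm z ha.1 hb.1]
    simp

/-- The supermanifold defined by a cocycle. -/
def twisted : SuperSheaf O where
  sheaf := twistedSheaf z
  part := twistedPart z
  gradedMonoid U :=
    { one_mem := mem_twistedPart_zero.2 rfl
      mul_mem := fun {i j} _ _ ha hb => twistedPart_mul_mem z i j ha hb }
  isInternal U := (DirectSum.isInternal_submodule_iff_isCompl (twistedPart z U) (i := 0) (j := 1)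
    (by decide) (Set.eq_univ_of_forall fun i => by
      fin_cases i
      · exact Or.inl rfl
      · exact Or.inr rfl).symm).2 (twistedPart_isCompl z U)
  map_mem {U W} h i a ha := by
    fin_cases i
    · refine mem_twistedPart_zero.2 ?_
      change V.dualRes h a.1.lin = 0
      rw [mem_twistedPart_zero.1 ha, map_zero]
    · have ha := mem_twistedPart_one.1 ha
      refine mem_twistedPart_one.2 ⟨?_, fun x Z hZ hx => ha.2 x Z (hZ.trans h) hx⟩
      change O.res h a.1.fn = 0
      rw [ha.1, map_zero]
  supercomm U i j a b ha hb := twisted_supercomm z i j ha hb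
  red U :=
    { toFun := fun a : twistedAlgebra z U => a.1.fn
      map_one' := rfl
      map_mul' := fun _ _ => rfl
      map_zero' := rfl
      map_add' := fun _ _ => rfl
      commutes' := fun _ => rfl }
  red_map _ _ := rfl
  red_odd U a ha := (mem_twistedPart_one.1 ha).1

/-- The projection defined by a member of the cover. -/
def twistedProjection (x : X) : (twisted z).Projection (𝒰.nhd x) where
  emb W h := twistedEven z x W h
  emb_res h h' f := twistedRes_twistedEven z x h h' f
  emb_even _ _ _ := mem_twistedPart_zero.2 rfl
  red_emb _ _ _ := rfl

theorem twistedEven_combination (x : X) (h : U ≤ 𝒰.nhd x) (φ ψ : V.dual U)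
    (p : O.sec U × O.sec U × O.sec U × O.sec U) :
    combination (twistedEven z x U h) (twistedOdd z U φ) (twistedOdd z U ψ) p =
      twistedEven z x U h p.1 + twistedOdd z U (p.2.1 • φ + p.2.2.1 • ψ) +
        twistedTop z U (p.2.2.2 • V.wedge U φ ψ) := by
  have e : twistedOdd z U (p.2.1 • φ + p.2.2.1 • ψ) =
      twistedOdd z U (p.2.1 • φ) + twistedOdd z U (p.2.2.1 • ψ) :=
    twisted_ext (add_zero (0 : O.sec U)).symm rfl fun y W _ _ => (add_zero (0 : V.alt W)).symm
  rw [combination, mul_twistedOdd z rfl, mul_twistedOdd z rfl, twistedOdd_mul_twistedOdd,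
    mul_twistedTop z rfl, e, add_assoc (twistedEven z x U h p.1)]
  rfl

/-- On `𝒰.nhd x` a section is freely given by its function, its linear form and its top form of
index `x`. A frame turns the last two into two functions and one function. -/
theorem twistedEven_combination_bijective (x : X) (h : U ≤ 𝒰.nhd x) {e : Fin 2 → V.sec U}
    (he : V.IsFrame e) : Function.Bijective (combination (twistedEven z x U h)
      (twistedOdd z U (he.dualFrame 0)) (twistedOdd z U (he.dualFrame 1))) := by
  have coord : ∀ p q : O.sec U, ∀ i, V.ev le_rfl (p • he.dualFrame 0 + q • he.dualFrame 1) (e i) =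
      ![p, q] i := he.ev_combination
  have top : ∀ p : O.sec U, V.altEv le_rfl (p • V.wedge U (he.dualFrame 0) (he.dualFrame 1)) e =
      p := fun p => by
    rw [altEv_smul, altEv_wedge, he.ev_dualFrame_frame, he.ev_dualFrame_frame,
      he.ev_dualFrame_frame, O.res_self]
    simp
  constructor
  · intro p q hpq
    rw [twistedEven_combination, twistedEven_combination] at hpq
    obtain ⟨h1, h2, h3⟩ := components_injective h hpq
    have c0 := congrArg (fun φ => V.ev le_rfl φ (e 0)) h2
    have c1 := congrArg (fun φ => V.ev le_rfl φ (e 1)) h2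
    have c2 := congrArg (fun β => V.altEv le_rfl β e) h3
    simp only [coord, top] at c0 c1 c2
    exact Prod.ext h1 (Prod.ext c0 (Prod.ext c1 c2))
  · intro a
    refine ⟨⟨a.1.fn, V.ev le_rfl a.1.lin (e 0), V.ev le_rfl a.1.lin (e 1),
      V.altEv le_rfl (a.1.top x le_rfl h) e⟩, ?_⟩
    rw [twistedEven_combination]
    refine Eq.trans ?_ (twisted_eq x h a).symm
    refine congrArg₂ (· + ·) (congrArg (twistedEven z x U h a.1.fn + ·)
      (congrArg (twistedOdd z U) (he.dual_eq a.1.lin).symm)) (congrArg (twistedTop z U) ?_)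
    refine he.alt_ext ?_
    rw [top]

/-- Odd coordinates of the supermanifold defined by a cocycle. -/
def twistedCoordinates (x : X) (h : U ≤ 𝒰.nhd x) {e : Fin 2 → V.sec U} (he : V.IsFrame e) :
    (twisted z).OddCoordinates 2 U where
  toProjection := (twistedProjection z x).restrict h
  θ i := twistedOdd z U (he.dualFrame i)
  odd i := mem_twistedPart_one.2 ⟨rfl, fun _ _ _ _ => rfl⟩
  isExterior W hW := by
    have he' := he.res hW
    -- A coordinate vector is sent to the odd function of the linear form with these coordinates in
    -- the dual frame.
    let j : (Fin 2 → O.sec W) →+ twistedAlgebra z W :=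
      AddMonoidHom.mk' (fun c => twistedOdd z W (c 0 • he'.dualFrame 0 + c 1 • he'.dualFrame 1))
        fun c c' => twisted_ext (add_zero (0 : O.sec W)).symm
          (by
            change (c 0 + c' 0) • he'.dualFrame 0 + (c 1 + c' 1) • he'.dualFrame 1 = _ + _
            rw [add_smul, add_smul]
            exact add_add_add_comm _ _ _ _)
          fun y Z _ _ => (add_zero (0 : V.alt Z)).symm
    have hj : ∀ i, j (Pi.single i 1) = twistedOdd z W (he'.dualFrame i) := fun i => by
      refine congrArg (twistedOdd z W) ?_
      fin_cases i
      · change (1 : O.sec W) • he'.dualFrame 0 + (0 : O.sec W) • he'.dualFrame 1 = _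
        rw [one_smul, zero_smul, add_zero]
        rfl
      · change (0 : O.sec W) • he'.dualFrame 0 + (1 : O.sec W) • he'.dualFrame 1 = _
        rw [one_smul, zero_smul, zero_add]
        rfl
    obtain ⟨Φ, h0, h1⟩ := exists_exterior_ringEquiv (Pi.basisFun (O.sec W) (Fin 2))
      (twistedEven z x W (hW.trans h) : O.sec W →+* twistedAlgebra z W) j
      (fun r a => twisted_even_comm z (a := twistedEven z x W (hW.trans h) r) rfl)
      (fun r m => by
        refine Eq.trans ?_ (mul_twistedOdd z (a := twistedEven z x W (hW.trans h) r) rfl _).symm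
        refine congrArg (twistedOdd z W) ?_
        change (r * m 0) • he'.dualFrame 0 + (r * m 1) • he'.dualFrame 1 = r • (_ + _)
        rw [mul_smul, mul_smul, smul_add])
      (fun m => by
        refine (twistedOdd_mul_twistedOdd z _ _).trans ?_
        rw [wedge_self]
        exact twisted_ext rfl rfl fun _ _ _ _ => rfl)
      (by
        rw [Pi.basisFun_apply, Pi.basisFun_apply, hj, hj]
        exact twistedEven_combination_bijective z x (hW.trans h) he')
    refine ⟨Φ, h0, fun i => (h1 _).trans ((hj i).trans ?_)⟩
    rw [he.dualFrame_res hW]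
    exact twisted_ext (map_zero (O.res hW)).symm rfl fun _ _ _ _ => rfl

theorem twisted_isSupermanifold (hV : V.IsVectorBundle 2) : (twisted z).IsSupermanifold 2 := by
  intro x
  obtain ⟨W, h, hxW, e, he⟩ := hV.exists_frame (𝒰.mem x)
  exact ⟨W, hxW, ⟨twistedCoordinates z x h he⟩⟩

/-- The identification of the odd tangent bundle of the supermanifold defined by a cocycle. -/
def twistedOddTangentIso (hV : V.IsVectorBundle 2) : (twisted z).OddTangentIso V where
  toDual U :=
    { toFun := fun a => (a.1 : twistedAlgebra z U).1.lin
      map_zero' := rfl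
      map_add' := fun _ _ => rfl }
  toDual_res h a b e := by
    change (b.1 : twistedAlgebra z _).1.lin = _
    rw [← e]
    rfl
  toDual_mul U a b c e := by
    have hb : (b.1 : twistedAlgebra z U).1.fn = 0 :=
      (twisted_isSupermanifold z hV).mem_J_one.1 b.2
    change (c.1 : twistedAlgebra z U).1.lin = (a : twistedAlgebra z U).1.fn •
      (b.1 : twistedAlgebra z U).1.lin
    rw [e]
    change (a : twistedAlgebra z U).1.fn • (b.1 : twistedAlgebra z U).1.lin +
      (b.1 : twistedAlgebra z U).1.fn • (a : twistedAlgebra z U).1.lin = _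
    rw [hb, zero_smul, add_zero]
  toDual_eq_zero U a := by
    rw [(twisted_isSupermanifold z hV).mem_J_two, SuperSheaf.mem_evenNil]
    exact ⟨fun h => ⟨h, (twisted_isSupermanifold z hV).mem_J_one.1 a.2⟩, fun h => h.1⟩
  toDual_surj U φ x hx := ⟨U, le_rfl, hx, ⟨twistedOdd z U φ,
    (twisted_isSupermanifold z hV).mem_J_one.2 rfl⟩, rfl⟩

theorem oddSec_twisted (hV : V.IsVectorBundle 2) (φ : V.dual U) :
    (twistedOddTangentIso z hV).oddSec (twisted_isSupermanifold z hV) U φ = twistedOdd z U φ :=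
  (twistedOddTangentIso z hV).oddSec_oddToDual (twisted_isSupermanifold z hV)
    ⟨twistedOdd z U φ, mem_twistedPart_one.2 ⟨rfl, fun _ _ _ _ => rfl⟩⟩

/-- Locally the form is a wedge, and odd functions of the twisted algebra multiply by the wedge of
their linear forms. -/
theorem topSec_twisted (hV : V.IsVectorBundle 2) (β : V.alt U) :
    (twistedOddTangentIso z hV).topSec (twisted_isSupermanifold z hV) hV U β =
      twistedTop z U β := by
  refine (twisted z).isSheafRes.sep U _ _ fun x hx => ?_
  obtain ⟨W, hW, hxW, e, he⟩ := hV.exists_frame hx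
  refine ⟨W, hW, hxW, ?_⟩
  have h1 : (twisted z).res hW (twistedTop z U β) = twistedTop z W (V.altRes hW β) :=
    twisted_ext (map_zero (O.res hW)) (map_zero (V.dualRes hW)) fun _ _ _ _ => rfl
  rw [h1, SuperSheaf.OddTangentIso.res_topSec, he.alt_eq (V.altRes hW β),
    SuperSheaf.OddTangentIso.topSec_wedge, oddSec_twisted, oddSec_twisted]
  exact twistedOdd_mul_twistedOdd z _ _

/-- The first obstruction of the supermanifold defined by a cocycle. -/
theorem twisted_isFirstObstruction (hV : V.IsVectorBundle 2) :
    (twisted z).IsFirstObstruction (twistedOddTangentIso z hV)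
      (Cech.classOf V.homExtSqTangent 𝒰 z) := by
  refine (SuperSheaf.OddTangentIso.isFirstObstruction_iff (twisted_isSupermanifold z hV) hV _ _).2
    ⟨𝒰, twistedProjection z, z, fun x y W h h' f => ?_, rfl⟩
  refine (topSec_twisted z hV _).trans (eq_sub_of_add_eq (G := twistedAlgebra z W) ?_)
  refine twisted_ext (zero_add f) (add_zero (0 : V.dual W)) fun w Y hY hw => ?_
  change V.altRes hY (contract (component z x y) (le_inf h h') f) +
    (twistedEven z x W h f).1.top w hY hw = (twistedEven z y W h' f).1.top w hY hw
  rw [top_twistedEven, top_twistedEven, altRes_contract, add_comm]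
  -- At index `w` the identity `π_x(f) + z_xy(f) = π_y(f)` becomes `z_wx + z_xy = z_wy`.
  exact contract_component_add z w x y hw (hY.trans h) (hY.trans h') _

end ModuleSheaf

end SuperGeometry

end


noncomputable section

namespace SuperGeometry

variable {𝕜 : Type} [Field 𝕜] {X : TopCat.{u}} {O : FunctionSheaf 𝕜 X}

namespace SuperSheaf

/-! ### The odd tangent bundle -/

section NormalForm

variable {S : SuperSheaf O} {U W Z : Opens X}

namespace NormalForm

variable {i : O.sec W →+* S.sec W} {s t : S.sec W} (N : S.NormalForm W i s t)

include N in
theorem exists_linear (b : S.sec W) :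
    ∃ (f g : O.sec W) (c : S.sec W), c ∈ S.part W 0 ∧ b = i f * s + i g * t + c := by
  obtain ⟨b₀, h₀, b₁, h₁, rfl⟩ := S.exists_parts b
  obtain ⟨f, g, rfl⟩ := N.exists_of_odd h₁
  exact ⟨f, g, b₀, h₀, add_comm _ _⟩

include N in
theorem linear_unique {f g f' g' : O.sec W} {c c' : S.sec W} (hc : c ∈ S.part W 0)
    (hc' : c' ∈ S.part W 0) (h : i f * s + i g * t + c = i f' * s + i g' * t + c') :
    f = f' ∧ g = g' := by
  obtain ⟨x, w, rfl⟩ := N.exists_of_even hc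
  obtain ⟨x', w', rfl⟩ := N.exists_of_even hc'
  have e : combination i s t (x, f, g, w) = combination i s t (x', f', g', w') := by
    simp only [combination]
    rw [add_comm, add_comm (i f' * s + i g' * t)] at h
    rw [show i x + i f * s + i g * t + i w * (s * t) =
      i x + i w * (s * t) + (i f * s + i g * t) by abel, h]
    abel
  have e' := N.bijective.1 e
  simp only [Prod.mk.injEq] at e'
  exact ⟨e'.2.1, e'.2.2.1⟩

/-- The coefficients of the odd coordinates in a superfunction. -/
def coeff (b : S.sec W) : Fin 2 → O.sec W :=
  ![(N.exists_linear b).choose, (N.exists_linear b).choose_spec.choose]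

theorem coeff_eq {b c : S.sec W} {f g : O.sec W} (hc : c ∈ S.part W 0)
    (h : b = i f * s + i g * t + c) : N.coeff b = ![f, g] := by
  obtain ⟨c', hc', h'⟩ := (N.exists_linear b).choose_spec.choose_spec
  obtain ⟨e, e'⟩ := N.linear_unique hc' hc (h'.symm.trans h)
  exact congrArg₂ (fun x y => ![x, y]) e e'

theorem eq_coeff (b : S.sec W) :
    ∃ c ∈ S.part W 0, b = i (N.coeff b 0) * s + i (N.coeff b 1) * t + c :=
  (N.exists_linear b).choose_spec.choose_spec

theorem coeff_add (a b : S.sec W) : N.coeff (a + b) = N.coeff a + N.coeff b := by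
  obtain ⟨c, hc, h⟩ := N.eq_coeff a
  obtain ⟨c', hc', h'⟩ := N.eq_coeff b
  refine (N.coeff_eq (f := N.coeff a 0 + N.coeff b 0) (g := N.coeff a 1 + N.coeff b 1)
    (add_mem hc hc') ?_).trans ?_
  · conv_lhs => rw [h, h']
    rw [map_add, map_add, add_mul, add_mul]
    abel
  · funext j
    fin_cases j <;> rfl

theorem coeff_even {a : S.sec W} (ha : a ∈ S.part W 0) : N.coeff a = 0 := by
  refine (N.coeff_eq (f := 0) (g := 0) ha ?_).trans ?_
  · rw [map_zero, zero_mul, zero_mul, zero_add, zero_add]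
  · funext j
    fin_cases j <;> rfl

/-- The odd part of `a` contributes an even product and the nilpotent even part kills `b`, so only
the reduction of `a` acts. -/
theorem coeff_mul (a : S.sec W) {b : S.sec W} (hb : b ∈ S.part W 1) :
    N.coeff (a * b) = S.red W a • N.coeff b := by
  obtain ⟨a₀, h₀, a₁, h₁, rfl⟩ := S.exists_parts a
  obtain ⟨x, w, rfl⟩ := N.exists_of_even h₀
  obtain ⟨f, g, rfl⟩ := N.exists_of_odd hb
  have e : S.red W (i x + i w * (s * t) + a₁) = x := by
    rw [map_add, map_add, S.red_odd W a₁ h₁, map_mul, map_mul, S.red_odd W s N.odd_left, N.red,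
      zero_mul, mul_zero, add_zero, add_zero]
  rw [e, N.coeff_eq (b := i f * s + i g * t) (zero_mem _) (add_zero _).symm]
  refine (N.coeff_eq (f := x * f) (g := x * g) (odd_mul_odd h₁ hb) ?_).trans ?_
  · rw [add_mul _ a₁, add_mul (i x), mul_assoc (i w), N.prod_mul_odd hb, mul_zero, add_zero,
      mul_add, ← mul_assoc, ← mul_assoc, ← map_mul, ← map_mul]
  · funext j
    fin_cases j <;> rfl

theorem coeff_left : N.coeff s = ![1, 0] :=
  N.coeff_eq (zero_mem _) (by rw [map_one, map_zero, one_mul, zero_mul, add_zero, add_zero])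

theorem coeff_right : N.coeff t = ![0, 1] :=
  N.coeff_eq (zero_mem _) (by rw [map_one, map_zero, one_mul, zero_mul, zero_add, add_zero])

end NormalForm

theorem OddCoordinates.coeff_res (χ : S.OddCoordinates 2 U) (h : W ≤ U) (h' : Z ≤ W)
    (b : S.sec W) (j : Fin 2) :
    O.res h' ((χ.normalForm h).coeff b j) = (χ.normalForm (h'.trans h)).coeff (S.res h' b) j := by
  obtain ⟨c, hc, e⟩ := (χ.normalForm h).eq_coeff b
  have e' := congrArg (S.res h') e
  rw [map_add, map_add, map_mul, map_mul, S.res_res, S.res_res] at e'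
  have e0 : ∀ f, S.res h' (χ.emb W h f) = χ.emb Z (h'.trans h) (O.res h' f) := χ.emb_res h h'
  refine Eq.trans ?_ (congrFun ((χ.normalForm (h'.trans h)).coeff_eq
    (f := O.res h' ((χ.normalForm h).coeff b 0)) (g := O.res h' ((χ.normalForm h).coeff b 1))
    (S.res_mem h' hc) (e'.trans ?_)) j).symm
  swap
  · exact congrArg₂ (fun x y => x * S.res (h'.trans h) (χ.θ 0) + y * S.res (h'.trans h) (χ.θ 1) +
      S.res h' c) (e0 _) (e0 _)
  · fin_cases j <;> rfl

end NormalForm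

section OddTangent

variable (S : SuperSheaf O) {U W Z : Opens X}

/-- The morphisms of sheaves of `O`-modules `J/J² → O` over `U`, as families of additive maps on
superfunctions. -/
def oddTangentSubgroup (U : Opens X) : AddSubgroup (∀ W : Set.Iic U, S.sec W.1 →+ O.sec W.1) where
  -- `J/J²` is the odd part of `O_S`, because `J²` is the even part of `J`. A morphism `J/J² → O` is
  -- recorded by its extension by zero to all even functions, which avoids quotient sheaves.
  carrier := {v | (∀ (W : Set.Iic U), ∀ a ∈ S.part W.1 0, v W a = 0) ∧
    (∀ (W : Set.Iic U) (a : S.sec W.1), ∀ b ∈ S.part W.1 1, v W (a * b) = S.red W.1 a * v W b) ∧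
    ∀ (W W' : Set.Iic U) (h : W'.1 ≤ W.1) (a : S.sec W.1), O.res h (v W a) = v W' (S.res h a)}
  zero_mem' := ⟨fun _ _ _ => rfl, fun _ _ _ _ => (mul_zero _).symm, fun _ _ h _ => map_zero (O.res h)⟩
  add_mem' := by
    rintro v w ⟨h0, h1, h2⟩ ⟨k0, k1, k2⟩
    refine ⟨fun W a ha => ?_, fun W a b hb => ?_, fun W W' h a => ?_⟩
    · rw [Pi.add_apply, AddMonoidHom.add_apply, h0 W a ha, k0 W a ha, add_zero]
    · rw [Pi.add_apply, AddMonoidHom.add_apply, AddMonoidHom.add_apply, h1 W a b hb, k1 W a b hb,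
        mul_add]
    · rw [Pi.add_apply, Pi.add_apply, AddMonoidHom.add_apply, AddMonoidHom.add_apply, map_add,
        h2 W W' h, k2 W W' h]
  neg_mem' := by
    rintro v ⟨h0, h1, h2⟩
    refine ⟨fun W a ha => ?_, fun W a b hb => ?_, fun W W' h a => ?_⟩
    · rw [Pi.neg_apply, AddMonoidHom.neg_apply, h0 W a ha, neg_zero]
    · rw [Pi.neg_apply, AddMonoidHom.neg_apply, AddMonoidHom.neg_apply, h1 W a b hb, mul_neg]
    · rw [Pi.neg_apply, Pi.neg_apply, AddMonoidHom.neg_apply, AddMonoidHom.neg_apply, map_neg,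
        h2 W W' h]

/-- Sections over `U` of the odd tangent bundle `(J/J²)^∨`. -/
def oddTangent (U : Opens X) : Type u := S.oddTangentSubgroup U

instance (U : Opens X) : AddCommGroup (S.oddTangent U) :=
  AddSubgroup.toAddCommGroup (S.oddTangentSubgroup U)

/-- Restriction of sections of the odd tangent bundle. -/
def oddTangentRes (h : W ≤ U) : S.oddTangent U →+ S.oddTangent W where
  toFun v := ⟨fun Z => v.1 ⟨Z.1, Z.2.trans h⟩, fun Z => v.2.1 ⟨Z.1, _⟩, fun Z => v.2.2.1 ⟨Z.1, _⟩,
    fun Z Z' => v.2.2.2 ⟨Z.1, _⟩ ⟨Z'.1, _⟩⟩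
  map_zero' := rfl
  map_add' _ _ := rfl

/-- The derivative of a superfunction along a section of the odd tangent bundle. -/
def oddEv (h : W ≤ U) (v : S.oddTangent U) : S.sec W →+ O.sec W := v.1 ⟨W, h⟩

variable {S}

theorem oddTangent_ext {v w : S.oddTangent U}
    (h : ∀ (W : Opens X) (h : W ≤ U) (a : S.sec W), S.oddEv h v a = S.oddEv h w a) : v = w :=
  Subtype.ext (funext fun W => AddMonoidHom.ext (h W.1 W.2))

theorem oddEv_even (h : W ≤ U) (v : S.oddTangent U) {a : S.sec W} (ha : a ∈ S.part W 0) :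
    S.oddEv h v a = 0 := v.2.1 ⟨W, h⟩ a ha

theorem oddEv_mul_odd (h : W ≤ U) (v : S.oddTangent U) (a : S.sec W) {b : S.sec W}
    (hb : b ∈ S.part W 1) : S.oddEv h v (a * b) = S.red W a * S.oddEv h v b :=
  v.2.2.1 ⟨W, h⟩ a b hb

theorem res_oddEv (h : W ≤ U) (h' : Z ≤ W) (v : S.oddTangent U) (a : S.sec W) :
    O.res h' (S.oddEv h v a) = S.oddEv (h'.trans h) v (S.res h' a) :=
  v.2.2.2 ⟨W, h⟩ ⟨Z, h'.trans h⟩ h' a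

theorem oddEv_oddTangentRes (h : W ≤ U) (h' : Z ≤ W) (v : S.oddTangent U) :
    S.oddEv h' (S.oddTangentRes h v) = S.oddEv (h'.trans h) v := rfl

theorem oddEv_add (h : W ≤ U) (v w : S.oddTangent U) (a : S.sec W) :
    S.oddEv h (v + w) a = S.oddEv h v a + S.oddEv h w a := rfl

theorem oddEv_zero (h : W ≤ U) (a : S.sec W) : S.oddEv h (0 : S.oddTangent U) a = 0 := rfl

/-- Linearity on `J`, not only on odd functions. The even part of `b` is nilpotent, and its product
with the odd part of `a` is differentiated to a multiple of its reduction, which is zero. -/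
theorem oddEv_mul (h : W ≤ U) (v : S.oddTangent U) (a : S.sec W) {b : S.sec W}
    (hb : S.red W b = 0) : S.oddEv h v (a * b) = S.red W a * S.oddEv h v b := by
  obtain ⟨a₀, h₀, a₁, h₁, rfl⟩ := S.exists_parts a
  obtain ⟨b₀, k₀, b₁, k₁, rfl⟩ := S.exists_parts b
  rw [map_add, S.red_odd W b₁ k₁, add_zero] at hb
  rw [mul_add, map_add, map_add (S.oddEv h v) b₀ b₁, oddEv_even h v k₀, zero_add,
    oddEv_mul_odd h v _ k₁, add_mul, map_add, oddEv_even h v (even_mul_even h₀ k₀), zero_add,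
    ← even_mul_comm k₀, oddEv_mul_odd h v b₀ h₁, hb, zero_mul, zero_add]

instance (U : Opens X) : SMul (O.sec U) (S.oddTangent U) where
  smul f v := ⟨fun W => (AddMonoidHom.mulLeft (O.res W.2 f)).comp (v.1 W), by
    refine ⟨fun W a ha => ?_, fun W a b hb => ?_, fun W W' h a => ?_⟩
    · exact (congrArg _ (v.2.1 W a ha)).trans (mul_zero _)
    · exact (congrArg (O.res W.2 f * ·) (v.2.2.1 W a b hb)).trans (mul_left_comm _ _ _)
    · refine (map_mul (O.res h) _ _).trans (congrArg₂ (· * ·) (O.res_res _ _ f) ?_)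
      exact v.2.2.2 W W' h a⟩

theorem oddEv_smul (h : W ≤ U) (f : O.sec U) (v : S.oddTangent U) (a : S.sec W) :
    S.oddEv h (f • v) a = O.res h f * S.oddEv h v a := rfl

instance (U : Opens X) : Module (O.sec U) (S.oddTangent U) where
  one_smul v := oddTangent_ext fun W h a => by rw [oddEv_smul, map_one, one_mul]
  mul_smul f g v := oddTangent_ext fun W h a => by
    rw [oddEv_smul, oddEv_smul, oddEv_smul, map_mul, mul_assoc]
  smul_zero f := oddTangent_ext fun W h a => by rw [oddEv_smul, oddEv_zero, mul_zero]
  smul_add f v w := oddTangent_ext fun W h a => by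
    rw [oddEv_smul, oddEv_add, oddEv_add, oddEv_smul, oddEv_smul, mul_add]
  add_smul f g v := oddTangent_ext fun W h a => by
    rw [oddEv_smul, oddEv_add, oddEv_smul, oddEv_smul, map_add, add_mul]
  zero_smul v := oddTangent_ext fun W h a => by rw [oddEv_smul, map_zero, zero_mul, oddEv_zero]

theorem oddTangentRes_smul (h : W ≤ U) (f : O.sec U) (v : S.oddTangent U) :
    S.oddTangentRes h (f • v) = O.res h f • S.oddTangentRes h v :=
  oddTangent_ext fun Z hZ a => by
    rw [oddEv_oddTangentRes, oddEv_smul, oddEv_smul, oddEv_oddTangentRes, O.res_res]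

/-- The defining identities are equalities in `O`, so they cut out a subsheaf of the sheaf of maps
`O_S → O`. -/
theorem isSheafRes_oddTangent (S : SuperSheaf O) :
    IsSheafRes S.oddTangent fun _ _ h => S.oddTangentRes h := by
  refine (IsSheafRes.hom (F := S.sec) (r := fun _ _ h => S.res h) O.isSheafRes
    fun _ _ _ h h' a => S.res_res h h' a).of_injective
    (fun U v => ⟨fun W => v.1 W, v.2.2.2⟩) (fun U v w e => oddTangent_ext fun W h a =>
      congrFun (congrFun (congrArg Subtype.val e) ⟨W, h⟩) a) (fun _ _ _ _ => rfl) fun U v loc => ?_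
  have loc' : ∀ (W : Set.Iic U), ∀ x ∈ W.1, ∃ (Z : Opens X) (h : Z ≤ W.1), x ∈ Z ∧
      ∃ b : S.oddTangent Z, ∀ a, O.res h (v.1 W a) = S.oddEv le_rfl b (S.res h a) := by
    intro W x hx
    obtain ⟨Z, h, hxZ, b, hb⟩ := loc x (W.2 hx)
    refine ⟨W.1 ⊓ Z, inf_le_left, ⟨hx, hxZ⟩, S.oddTangentRes inf_le_right b, fun a => ?_⟩
    rw [v.2 W ⟨W.1 ⊓ Z, Set.mem_Iic.2 (inf_le_left.trans W.2)⟩ inf_le_left a]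
    exact (congrFun (congrFun (congrArg Subtype.val hb)
      ⟨W.1 ⊓ Z, Set.mem_Iic.2 inf_le_right⟩) _).symm
  refine ⟨⟨fun W => AddMonoidHom.mk' (v.1 W) fun a b => ?_, fun W a ha => ?_, fun W a b hb => ?_,
    v.2⟩, rfl⟩
  · refine O.isSheafRes.sep _ _ _ fun x hx => ?_
    obtain ⟨Z, h, hxZ, b, hb⟩ := loc' W x hx
    exact ⟨Z, h, hxZ, by simp only [map_add, hb]⟩
  · refine O.isSheafRes.sep _ _ _ fun x hx => ?_
    obtain ⟨Z, h, hxZ, b, hb⟩ := loc' W x hx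
    exact ⟨Z, h, hxZ, ((hb a).trans (oddEv_even _ b (S.res_mem h ha))).trans
      (map_zero (O.res h)).symm⟩
  · refine O.isSheafRes.sep _ _ _ fun x hx => ?_
    obtain ⟨Z, h, hxZ, w, hw⟩ := loc' W x hx
    refine ⟨Z, h, hxZ, (hw _).trans (Eq.trans ?_ (map_mul (O.res h) _ _).symm)⟩
    rw [map_mul, oddEv_mul_odd _ w _ (S.res_mem h hb), red_res]
    exact congrArg _ (hw b).symm

/-- The presheaf of abelian groups underlying the odd tangent bundle. -/
def oddTangentPresheaf (S : SuperSheaf O) : TopCat.Presheaf AddCommGrpCat.{u} X where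
  obj U := AddCommGrpCat.of (S.oddTangent U.unop)
  map i := AddCommGrpCat.ofHom (S.oddTangentRes i.unop.le)
  map_id _ := rfl
  map_comp _ _ := rfl

/-- The odd tangent bundle `(J/J²)^∨` of a supermanifold. -/
def oddTangentBundle (S : SuperSheaf O) : ModuleSheaf O where
  val :=
    letI : ∀ U : (Opens X)ᵒᵖ, Module (((sheafCompose (Opens.grothendieckTopology X)
        (forget₂ CommRingCat.{u} RingCat.{u})).obj O.sheaf).obj.obj U)
        (S.oddTangentPresheaf.obj U) :=
      fun U => inferInstanceAs (Module (O.sec U.unop) (S.oddTangent U.unop))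
    PresheafOfModules.ofPresheaf S.oddTangentPresheaf
      fun _ _ i f v => oddTangentRes_smul i.unop.le f v
  isSheaf := IsSheafRes.isSheaf S.oddTangentPresheaf S.isSheafRes_oddTangent

end OddTangent

end SuperSheaf

end SuperGeometry

end


/-! ### Frames of the odd tangent bundle; projected means split -/

noncomputable section

namespace SuperGeometry

variable {𝕜 : Type} [Field 𝕜] {X : TopCat.{u}} {O : FunctionSheaf 𝕜 X}

namespace SuperSheaf

variable {S : SuperSheaf O} {U W Z : Opens X}

namespace OddCoordinates

variable (χ : S.OddCoordinates 2 U)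

/-- The derivative with respect to an odd coordinate. -/
def partialDeriv (j : Fin 2) : S.oddTangent U :=
  ⟨fun W => AddMonoidHom.mk' (fun a => (χ.normalForm W.2).coeff a j)
      fun a b => congrFun ((χ.normalForm W.2).coeff_add a b) j,
    fun W _ ha => congrFun ((χ.normalForm W.2).coeff_even ha) j,
    fun W a _ hb => congrFun ((χ.normalForm W.2).coeff_mul a hb) j,
    fun W _ h a => χ.coeff_res W.2 h a j⟩

theorem oddEv_partialDeriv (h : W ≤ U) (j : Fin 2) (a : S.sec W) :
    S.oddEv h (χ.partialDeriv j) a = (χ.normalForm h).coeff a j := rfl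

/-- A section of the odd tangent bundle kills the even part of a superfunction, so it is determined
by its values on the two odd coordinates. -/
theorem oddEv_eq (h : W ≤ U) (v : S.oddTangent W) (h' : Z ≤ W) (a : S.sec Z) :
    S.oddEv h' v a =
      (χ.normalForm (h'.trans h)).coeff a 0 * O.res h' (S.oddEv le_rfl v (S.res h (χ.θ 0))) +
      (χ.normalForm (h'.trans h)).coeff a 1 * O.res h' (S.oddEv le_rfl v (S.res h (χ.θ 1))) := by
  have N := χ.normalForm (h'.trans h)
  obtain ⟨c, hc, e⟩ := (χ.normalForm (h'.trans h)).eq_coeff a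
  have key : ∀ f j, S.oddEv h' v (χ.emb Z (h'.trans h) f * S.res (h'.trans h) (χ.θ j)) =
      f * O.res h' (S.oddEv le_rfl v (S.res h (χ.θ j))) := fun f j => by
    rw [oddEv_mul_odd h' v _ (S.res_mem _ (χ.odd j)), χ.red_emb, res_oddEv, S.res_res]
  refine (congrArg (S.oddEv h' v) e).trans ?_
  refine ((S.oddEv h' v).map_add _ _).trans ?_
  rw [oddEv_even h' v hc, add_zero]
  exact ((S.oddEv h' v).map_add _ _).trans (congrArg₂ (· + ·) (key _ 0) (key _ 1))

/-- The coefficients of a section with respect to the partial derivatives are its values on the odd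
coordinates. -/
theorem linear_bijective (h : W ≤ U) : Function.Bijective fun c : Fin 2 → O.sec W =>
    c 0 • S.oddTangentRes h (χ.partialDeriv 0) + c 1 • S.oddTangentRes h (χ.partialDeriv 1) := by
  have ev : ∀ (c : Fin 2 → O.sec W) (Z : Opens X) (h' : Z ≤ W) (a : S.sec Z), S.oddEv h'
      (c 0 • S.oddTangentRes h (χ.partialDeriv 0) + c 1 • S.oddTangentRes h (χ.partialDeriv 1)) a =
        O.res h' (c 0) * (χ.normalForm (h'.trans h)).coeff a 0 +
          O.res h' (c 1) * (χ.normalForm (h'.trans h)).coeff a 1 := fun _ _ _ _ => rfl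
  constructor
  · intro c d hcd
    have hcd' := fun a => congrArg (fun v => S.oddEv le_rfl v a) hcd
    simp only [ev, O.res_self] at hcd'
    have h0 := hcd' (S.res h (χ.θ 0))
    have h1 := hcd' (S.res h (χ.θ 1))
    rw [(χ.normalForm h).coeff_left] at h0
    rw [(χ.normalForm h).coeff_right] at h1
    simp only [Matrix.cons_val_zero, Matrix.cons_val_one, mul_one, mul_zero, add_zero,
      zero_add] at h0 h1
    funext j
    fin_cases j
    · exact h0
    · exact h1
  · intro v
    refine ⟨fun j => S.oddEv le_rfl v (S.res h (χ.θ j)), oddTangent_ext fun Z h' a => ?_⟩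
    refine (ev (fun j => S.oddEv le_rfl v (S.res h (χ.θ j))) Z h' a).trans ((congrArg₂ (· + ·) (mul_comm _ _) (mul_comm _ _)).trans
      (χ.oddEv_eq h v h' a).symm)

/-- The derivatives with respect to the odd coordinates, as sections of the bundle. -/
def frame (j : Fin 2) : S.oddTangentBundle.sec U := χ.partialDeriv j

theorem isFrame : S.oddTangentBundle.IsFrame χ.frame := by
  intro W h
  refine (congrArg Function.Bijective (funext fun c => ?_)).mpr (χ.linear_bijective h)
  exact Fin.sum_univ_two _

end OddCoordinates

theorem oddTangentBundle_isVectorBundle (hS : S.IsSupermanifold 2) :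
    S.oddTangentBundle.IsVectorBundle 2 := fun x => by
  obtain ⟨U, hx, ⟨χ⟩⟩ := hS x
  exact ⟨U, hx, χ.frame, χ.isFrame⟩

/-- The differential of a superfunction, as a linear form on the odd tangent bundle. -/
def differential (S : SuperSheaf O) (U : Opens X) : S.sec U →+ S.oddTangentBundle.dual U where
  toFun a := ⟨fun W =>
    { toFun := fun v : S.oddTangent W.1 => S.oddEv le_rfl v (S.res W.2 a)
      map_add' := fun v w => rfl
      map_smul' := fun f v => (oddEv_smul le_rfl f v _).trans
        (congrArg (· * _) (O.res_self f)) }, fun W W' h v => by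
      refine (res_oddEv le_rfl h (v : S.oddTangent W.1) (S.res W.2 a)).trans ?_
      exact congrArg (S.oddEv h (v : S.oddTangent W.1)) (S.res_res W.2 h a)⟩
  map_zero' := ModuleSheaf.dual_ext fun W h v =>
    (congrArg (S.oddEv le_rfl (v : S.oddTangent W)) (map_zero (S.res h))).trans (map_zero _)
  map_add' a b := ModuleSheaf.dual_ext fun W h v =>
    (congrArg (S.oddEv le_rfl (v : S.oddTangent W)) (map_add (S.res h) a b)).trans (map_add _ _ _)

theorem ev_differential (h : W ≤ U) (a : S.sec U) (v : S.oddTangent W) :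
    S.oddTangentBundle.ev h (S.differential U a) v = S.oddEv le_rfl v (S.res h a) := rfl

/-- The identification of the odd tangent bundle with the dual of `J/J²`. -/
def oddTangentBundleIso (hS : S.IsSupermanifold 2) : S.OddTangentIso S.oddTangentBundle where
  toDual U := (S.differential U).comp (S.J 1 U).subtype.toAddMonoidHom
  toDual_res h a b e := ModuleSheaf.dual_ext fun W h' v => by
    change S.oddEv le_rfl (v : S.oddTangent W) (S.res h' b) =
      S.oddEv le_rfl (v : S.oddTangent W) (S.res (h'.trans h) a)
    rw [← e, S.res_res]
  toDual_mul U a b c e := ModuleSheaf.dual_ext fun W h v => by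
    change S.oddEv le_rfl (v : S.oddTangent W) (S.res h c) =
      O.res h (S.red U a) * S.oddEv le_rfl (v : S.oddTangent W) (S.res h b)
    rw [e, map_mul, ← red_res]
    exact oddEv_mul le_rfl (v : S.oddTangent W) (S.res h a)
      (by rw [red_res, hS.mem_J_one.1 b.2, map_zero])
  toDual_eq_zero U a := by
    rw [hS.mem_J_two, mem_evenNil]
    constructor
    · refine fun ha => ⟨mem_part_of_locally 0 _ fun x hx => ?_, hS.mem_J_one.1 a.2⟩
      obtain ⟨W, hxW, ⟨χ⟩⟩ := hS x
      refine ⟨U ⊓ W, inf_le_left, ⟨hx, hxW⟩, ?_⟩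
      -- Evaluating the vanishing differential on the partial derivatives shows that both odd
      -- coefficients are zero, so the function is even near `x`.
      have key : ∀ j, (χ.normalForm (inf_le_right : U ⊓ W ≤ W)).coeff
          (S.res inf_le_left (a : S.sec U)) j = 0 := fun j =>
        congrArg (fun φ : S.oddTangentBundle.dual U => S.oddTangentBundle.ev inf_le_left φ
          (S.oddTangentRes inf_le_right (χ.partialDeriv j) : S.oddTangent (U ⊓ W))) ha
      obtain ⟨c, hc, e⟩ := (χ.normalForm (inf_le_right : U ⊓ W ≤ W)).eq_coeff
        (S.res inf_le_left (a : S.sec U))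
      rw [key, key, map_zero, zero_mul, zero_mul, zero_add, zero_add] at e
      rw [e]
      exact hc
    · rintro ⟨h, -⟩
      exact ModuleSheaf.dual_ext fun W hW v => oddEv_even le_rfl _ (S.res_mem hW h)
  toDual_surj U φ x hx := by
    obtain ⟨W, hxW, ⟨χ⟩⟩ := hS x
    have hle : U ⊓ W ≤ W := inf_le_right
    have he := χ.isFrame.res hle
    -- The preimage of `φ` is the linear combination of the odd coordinates whose coefficients are
    -- the values of `φ` on the frame of partial derivatives.
    let f : Fin 2 → O.sec (U ⊓ W) := fun j => S.oddTangentBundle.ev le_rfl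
      (S.oddTangentBundle.dualRes inf_le_left φ) (S.oddTangentBundle.res hle (χ.frame j))
    have hodd : χ.emb _ hle (f 0) * S.res hle (χ.θ 0) + χ.emb _ hle (f 1) * S.res hle (χ.θ 1) ∈
        S.part (U ⊓ W) 1 :=
      add_mem (even_mul_odd (χ.emb_even _ _ _) (S.res_mem _ (χ.odd 0)))
        (even_mul_odd (χ.emb_even _ _ _) (S.res_mem _ (χ.odd 1)))
    refine ⟨U ⊓ W, inf_le_left, ⟨hx, hxW⟩, ⟨_, hS.mem_J_one.2 (S.red_odd _ _ hodd)⟩, ?_⟩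
    have key : ∀ j, S.oddTangentBundle.ev le_rfl (S.differential (U ⊓ W)
        (χ.emb _ hle (f 0) * S.res hle (χ.θ 0) + χ.emb _ hle (f 1) * S.res hle (χ.θ 1)))
        (S.oddTangentBundle.res hle (χ.frame j)) = f j := fun j => by
      refine (ev_differential le_rfl _ (S.oddTangentRes hle (χ.partialDeriv j))).trans ?_
      rw [S.res_self, oddEv_oddTangentRes, χ.oddEv_partialDeriv]
      refine (congrFun ((χ.normalForm hle).coeff_eq (f := f 0) (g := f 1) (zero_mem _)
        (add_zero _).symm) j).trans ?_
      fin_cases j <;> rfl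
    refine (he.dual_eq _).trans (Eq.trans ?_ (he.dual_eq _).symm)
    exact congrArg₂ (fun x y => x • he.dualFrame 0 + y • he.dualFrame 1) (key 0) (key 1)

/-- A global projection together with the odd functions, which are canonically `(T₋S)^∨`, is a
global splitting with `V = T₋S`. Conversely, a splitting contains a projection. -/
theorem IsSupermanifold.isProjected_iff_isSplit (hS : S.IsSupermanifold 2) :
    S.IsProjected ↔ S.IsSplit 2 :=
  ⟨fun ⟨π⟩ => ⟨S.oddTangentBundle, oddTangentBundle_isVectorBundle hS,
    ⟨Projection.splitting hS (oddTangentBundle_isVectorBundle hS) (oddTangentBundleIso hS) π⟩⟩,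
    fun ⟨_, _, ⟨σ⟩⟩ => ⟨σ.toProjection⟩⟩

end SuperSheaf

end SuperGeometry

end
-- The classification theorem
theorem mainTheorem10 {𝕜 : Type} [RCLike 𝕜] {X : TopCat.{u}}
    (O : SuperGeometry.FunctionSheaf 𝕜 X) (m : ℕ) (kind : SuperGeometry.ManifoldKind)
    (hO : O.IsManifold m kind) :
    (∀ S : SuperGeometry.SuperSheaf O, S.IsSupermanifold 2 →
      ∃ V : SuperGeometry.ModuleSheaf O, V.IsVectorBundle 2 ∧ Nonempty (S.OddTangentIso V)) ∧
    (∀ V : SuperGeometry.ModuleSheaf O, V.IsVectorBundle 2 →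
      (∀ S : SuperGeometry.SuperSheaf O, S.IsSupermanifold 2 → ∀ ρ : S.OddTangentIso V,
        ∃! ω : SuperGeometry.Cech.H1 V.homExtSqTangent, S.IsFirstObstruction ρ ω) ∧
      (∀ S S' : SuperGeometry.SuperSheaf O, S.IsSupermanifold 2 → S'.IsSupermanifold 2 →
        ∀ (ρ : S.OddTangentIso V) (ρ' : S'.OddTangentIso V)
          (ω ω' : SuperGeometry.Cech.H1 V.homExtSqTangent),
          S.IsFirstObstruction ρ ω → S'.IsFirstObstruction ρ' ω' →
          (Nonempty (SuperGeometry.SuperSheaf.Iso ρ ρ') ↔ ω = ω')) ∧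
      (∀ ω : SuperGeometry.Cech.H1 V.homExtSqTangent,
        ∃ S : SuperGeometry.SuperSheaf O, S.IsSupermanifold 2 ∧
          ∃ ρ : S.OddTangentIso V, S.IsFirstObstruction ρ ω)) ∧
    (∀ S : SuperGeometry.SuperSheaf O, S.IsSupermanifold 2 →
      (S.IsProjected ↔ S.IsSplit 2)) := by 
  refine ⟨fun S hS => ⟨S.oddTangentBundle,
    SuperGeometry.SuperSheaf.oddTangentBundle_isVectorBundle hS,
    ⟨SuperGeometry.SuperSheaf.oddTangentBundleIso hS⟩⟩,
    fun V hV => ⟨fun S hS ρ => ρ.existsUnique_isFirstObstruction hS hV,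
      fun S S' hS hS' ρ ρ' ω ω' hω hω' =>
        SuperGeometry.SuperSheaf.nonempty_iso_iff hS hS' hV hω hω', fun ω => ?_⟩,
    fun S hS => hS.isProjected_iff_isSplit⟩
  -- Every class comes from a cocycle on some cover, and the supermanifold twisted by that cocycle
  -- realises it.
  obtain ⟨𝒰, z, rfl⟩ := SuperGeometry.Cech.exists_classOf _ ω
  exact ⟨SuperGeometry.ModuleSheaf.twisted z,
    SuperGeometry.ModuleSheaf.twisted_isSupermanifold z hV,
    SuperGeometry.ModuleSheaf.twistedOddTangentIso z hV,
    SuperGeometry.ModuleSheaf.twisted_isFirstObstruction z hV⟩
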